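/- **Setting.** Let $\mathbb G=(\mathbb R^N,\circ)$, $N\ge 1$, be a stratified Lie group (homogeneous Carnot group): a Lie group law on $\mathbb R^N=\mathbb R^{N_1}\times\dots\times\mathbb R^{N_k}$ with identity $0$ for which the dilations $D_t(x^{(1)},\dots,x^{(k)})=(tx^{(1)},\dots,t^kx^{(k)})$, $t>0$, are automorphisms, and such that the left-invariant vector fields $X_1,\dots,X_{N_1}$ with $X_j(0)=\partial_{x_j}|_0$ generate a Lie algebra of rank $N$ at every point. Let $Q=\sum_i iN_i$ be the homogeneous dimension, let $dx$ and $|\cdot|$ (applied to sets) denote Lebesgue (= Haar) measure, and let $|\cdot|$ (applied to points) be a homogeneous quasi-norm on $\mathbb G$, i.e. a continuous function $\mathbb G\to[0,\infty)$ with $|x|=0\iff x=0$, $|x^{-1}|=|x|$, $|D_tx|=t|x|$ for $t>0$, such that $d(x,y)=|y^{-1}\circ x|$ is a distance (so $|x\circ y|\le|x|+|y|$). Let $\sigma$ be the measure on $\{|x|=1\}$ with $\int_{\mathbb G} f\,dx=\int_0^\infty\!\int_{\{|y|=1\}} f(D_ty)\,t^{Q-1}\,d\sigma(y)\,dt$ for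 all $f\in L^1(\mathbb G)$, and put $\omega_Q=\sigma(\{|x|=1\})$. Let $0<s<1<p<\infty$ with $sp>Q$, let $\Omega\subset\mathbb G$ be a bounded open set, let $\beta\in L^\infty(\Omega)$ with $\beta_0:=\operatorname{ess\,inf}_\Omega\beta>0$, and let $g:\mathbb R\to\mathbb R$ be continuous. Put $$[u]_{s,p,\mathbb G}=\Big(\int_{\mathbb G}\int_{\mathbb G}\frac{|u(x)-u(y)|^p}{|y^{-1}\circ x|^{Q+sp}}\,dx\,dy\Big)^{1/p}.$$ Let $X_0^{s,p}(\Omega)$ be the completion of $C_0^\infty(\Omega)$ under $\|u\|_{L^p(\Omega)}+[u]_{s,p,\mathbb G}$ (a space of functions on $\mathbb G$ vanishing a.e. outside $\Omega$), with the norm $\|u\|_{X_0^{s,p}(\Omega)}=[u]_{s,p,\mathbb G}$. For $\lambda>0$, a (weak) solution of $$(-\Delta_{\mathbb G,p})^s u=\lambda\beta(x)g(u)\ \text{ in }\Omega,\qquad u=0\ \text{ in }\mathbb G\setminus\Omega \tag{1}$$ is a function $u\in X_0^{s,p}(\Omega)\setminus\{0\}$ such that for every $\varphi\in X_0^{s,p}(\Omega)$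 $$\int_{\mathbb G}\int_{\mathbb G}\frac{|u(x)-u(y)|^{p-2}(u(x)-u(y))(\varphi(x)-\varphi(y))}{|y^{-1}\circ x|^{Q+sp}}\,dx\,dy=\lambda\int_\Omega\beta(x)g(u)\varphi\,dx$$ (both integrals converging absolutely). For $M\in\{0^+,+\infty\}$ put $G(\tau)=\int_0^\tau g(\xi)\,d\xi$, $$A_M=\liminf_{\tau\to M}\frac{\max_{|\xi|\le\tau}G(\xi)}{\tau^p},\qquad B_M=\limsup_{\tau\to M}\frac{G(\tau)}{\tau^p},$$ $$C_{p,Q,s}=\Big(\frac{2^{p(2-s)}}{(1-s)p}+\frac{2^{2+ps}}{ps}\Big)\Big(1-\frac1{2^Q}\Big)+\frac{2^{1+ps-Q}}{ps},$$ $$r=\sup_{x\in\Omega}\operatorname{dist}_d(x,\partial\Omega),\qquad L=\sup\Big\{\frac{\|u\|_{L^\infty(\Omega)}}{\|u\|_{X_0^{s,p}(\Omega)}}:u\in X_0^{s,p}(\Omega)\setminus\{0\}\Big\},$$ $$D=\frac{r^{sp}}{2^Q\,C_{p,Q,s}\,L^p\,|\Omega|\,\omega_Q}\cdot\frac{\beta_0}{\|\beta\|_{L^\infty(\Omega)}},$$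 $$\lambda_{1,M}=\frac{2^Q\,C_{p,Q,s}\,\omega_Q}{p\,r^{sp}\,\beta_0\,B_M},\qquad \lambda_{2,M}=\frac1{p\,\|\beta\|_{L^\infty(\Omega)}\,|\Omega|\,L^p\,A_M},$$ with $\lambda_{1,M}=0$ if $B_M=+\infty$ and $\lambda_{2,M}=+\infty$ if $A_M=0$. **Theorem 1.4.** Let $M\in\{0^+,+\infty\}$ and suppose that $\inf_{\tau\ge0}G(\tau)=0$ and $A_M<D\,B_M$. Then for every $\lambda\in(\lambda_{1,M},\lambda_{2,M})$ the problem (1) has a sequence of weak solutions $\{u_{\lambda,n}\}\subset X_0^{s,p}(\Omega)$. Moreover, $$\lim_{n\to\infty}\|u_{\lambda,n}\|_{X_0^{s,p}(\Omega)}=+\infty\quad\text{if }M=+\infty,$$ $$\lim_{n\to\infty}\|u_{\lambda,n}\|_{X_0^{s,p}(\Omega)}=\lim_{n\to\infty}\|u_{\lambda,n}\|_{L^\infty(\Omega)}=0\quad\text{if }M=0^+.$$ -/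

import Mathlib

open MeasureTheory Filter Topology Set
open scoped ENNReal ContDiff

noncomputable section

namespace Carnot

/-- The Lie algebra of vector fields on `E` generated by a set `S` of vector fields. -/
inductive LieGenerated {E : Type*} [NormedAddCommGroup E] [NormedSpace ℝ E]
    (S : Set (E → E)) : (E → E) → Prop
  | base (X : E → E) (hX : X ∈ S) : LieGenerated S X
  | add (X Y : E → E) (hX : LieGenerated S X) (hY : LieGenerated S Y) :
      LieGenerated S (X + Y)
  | smul (c : ℝ) (X : E → E) (hX : LieGenerated S X) : LieGenerated S (c • X)
  | bracket (X Y : E → E) (hX : LieGenerated S X) (hY : LieGenerated S Y) :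
      LieGenerated S (VectorField.lieBracket ℝ X Y)

/-- The anisotropic dilation `D_t x = (t ^ w 1 * x 1, …, t ^ w N * x N)` of `ℝ^N`. -/
def dilation {N : ℕ} (w : Fin N → ℕ) (t : ℝ) (x : Fin N → ℝ) : Fin N → ℝ :=
  fun i => t ^ w i * x i

/-- The left-invariant vector field of the group law `mul` on `ℝ^N` (identity `0`) that
equals `∂ / ∂ x i` at the origin. -/
def leftInvariantField {N : ℕ} (mul : (Fin N → ℝ) → (Fin N → ℝ) → (Fin N → ℝ))
    (i : Fin N) : (Fin N → ℝ) → (Fin N → ℝ) :=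
  fun x => fderiv ℝ (mul x) 0 (Pi.single i 1)

/-- A stratified Lie group (homogeneous Carnot group) on `ℝ^N`: a Lie group law on `ℝ^N`
with identity `0`; the coordinate `x i` lies in the layer `weight i`, the layers being
listed in increasing order; the dilations are automorphisms; and the left-invariant vector
fields of the first layer satisfy the Hörmander rank condition. -/
structure StratifiedGroup (N : ℕ) where
  mul : (Fin N → ℝ) → (Fin N → ℝ) → (Fin N → ℝ)
  inv : (Fin N → ℝ) → (Fin N → ℝ)
  mul_assoc : ∀ x y z, mul (mul x y) z = mul x (mul y z)
  zero_mul : ∀ x, mul 0 x = x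
  mul_zero : ∀ x, mul x 0 = x
  inv_mul : ∀ x, mul (inv x) x = 0
  contDiff_mul : ContDiff ℝ ∞ (fun z : (Fin N → ℝ) × (Fin N → ℝ) => mul z.1 z.2)
  contDiff_inv : ContDiff ℝ ∞ inv
  weight : Fin N → ℕ
  one_le_weight : ∀ i, 1 ≤ weight i
  weight_mono : Monotone weight
  dilation_mul : ∀ t : ℝ, 0 < t → ∀ x y,
    dilation weight t (mul x y) = mul (dilation weight t x) (dilation weight t y)
  hormander : ∀ x : Fin N → ℝ,
    Submodule.span ℝ {v : Fin N → ℝ |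
      ∃ Y, LieGenerated {X | ∃ i, weight i = 1 ∧ X = leftInvariantField mul i} Y ∧ v = Y x} = ⊤

/-- The homogeneous dimension `Q`. -/
def StratifiedGroup.Q {N : ℕ} (𝔾 : StratifiedGroup N) : ℕ := ∑ i, 𝔾.weight i

/-- A homogeneous quasi-norm `|·|` for which `d(x, y) = |y⁻¹ ∘ x|` is a distance, that is,
one satisfying the triangle inequality. -/
structure HomogeneousNorm {N : ℕ} (𝔾 : StratifiedGroup N) where
  toFun : (Fin N → ℝ) → ℝ
  continuous' : Continuous toFun
  nonneg : ∀ x, 0 ≤ toFun x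
  eq_zero_iff : ∀ x, toFun x = 0 ↔ x = 0
  inv_eq : ∀ x, toFun (𝔾.inv x) = toFun x
  dilation_eq : ∀ t : ℝ, 0 < t → ∀ x, toFun (dilation 𝔾.weight t x) = t * toFun x
  triangle : ∀ x y, toFun (𝔾.mul x y) ≤ toFun x + toFun y

variable {N : ℕ} {𝔾 : StratifiedGroup N}

/-- The left-invariant homogeneous distance `d(x, y) = |y⁻¹ ∘ x|`. -/
def HomogeneousNorm.dist (ρ : HomogeneousNorm 𝔾) (x y : Fin N → ℝ) : ℝ :=
  ρ.toFun (𝔾.mul (𝔾.inv y) x)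

/-- The surface measure `σ` of the unit quasi-sphere, i.e. the measure of the polar
decomposition `∫ f = ∫₀^∞ ∫ f (D_t y) t^(Q-1) dσ(y) dt`:
`σ(A) = Q * |{x : 0 < |x| < 1, D_{1/|x|} x ∈ A}|`. -/
def HomogeneousNorm.surfaceMeasure (ρ : HomogeneousNorm 𝔾) : Measure (Fin N → ℝ) :=
  (𝔾.Q : ℝ≥0∞) • Measure.map (fun x => dilation 𝔾.weight (ρ.toFun x)⁻¹ x)
    (volume.restrict {x | 0 < ρ.toFun x ∧ ρ.toFun x < 1})

/-- The surface measure `ω_Q` of the unit quasi-sphere. -/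
def HomogeneousNorm.omega (ρ : HomogeneousNorm 𝔾) : ℝ≥0∞ :=
  ρ.surfaceMeasure {x | ρ.toFun x = 1}

/-- The Gagliardo seminorm `[u]_{s,p,𝔾}`, with values in `[0, ∞]`. -/
def gagliardo (ρ : HomogeneousNorm 𝔾) (s p : ℝ) (u : (Fin N → ℝ) → ℝ) : ℝ≥0∞ :=
  (∫⁻ z : (Fin N → ℝ) × (Fin N → ℝ),
    ENNReal.ofReal (|u z.1 - u z.2| ^ p / ρ.dist z.1 z.2 ^ ((𝔾.Q : ℝ) + p * s))) ^ (1 / p)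

/-- Membership in `W^{s,p}(𝔾)`. -/
def MemW (ρ : HomogeneousNorm 𝔾) (s p : ℝ) (u : (Fin N → ℝ) → ℝ) : Prop :=
  MemLp u (ENNReal.ofReal p) ∧ gagliardo ρ s p u < ⊤

/-- Membership in `C_0^∞(Ω)`. -/
def IsTestFunction (Ω : Set (Fin N → ℝ)) (φ : (Fin N → ℝ) → ℝ) : Prop :=
  ContDiff ℝ ∞ φ ∧ HasCompactSupport φ ∧ tsupport φ ⊆ Ω

/-- Membership in `X_0^{s,p}(Ω)`, the completion of `C_0^∞(Ω)` under the norm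
`‖u‖_{L^p} + [u]_{s,p,𝔾}`, realized as the closure of `C_0^∞(Ω)` in `W^{s,p}(𝔾)`
(functions that agree almost everywhere are identified). -/
def MemX0 (ρ : HomogeneousNorm 𝔾) (s p : ℝ) (Ω : Set (Fin N → ℝ))
    (u : (Fin N → ℝ) → ℝ) : Prop :=
  MemW ρ s p u ∧ ∃ φ : ℕ → (Fin N → ℝ) → ℝ, (∀ n, IsTestFunction Ω (φ n)) ∧
    Tendsto (fun n => eLpNorm (u - φ n) (ENNReal.ofReal p) volume + gagliardo ρ s p (u - φ n))
      atTop (𝓝 0)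

/-- The norm of `L^∞(Ω)`, with values in `[0, ∞]`. -/
def normLinf (Ω : Set (Fin N → ℝ)) (u : (Fin N → ℝ) → ℝ) : ℝ≥0∞ :=
  eLpNorm u ⊤ (volume.restrict Ω)

/-- The density of the nonlocal form tested in the weak formulation. -/
def energyDensity (ρ : HomogeneousNorm 𝔾) (s p : ℝ) (u φ : (Fin N → ℝ) → ℝ)
    (z : (Fin N → ℝ) × (Fin N → ℝ)) : ℝ :=
  |u z.1 - u z.2| ^ (p - 2) * (u z.1 - u z.2) * (φ z.1 - φ z.2)
    / ρ.dist z.1 z.2 ^ ((𝔾.Q : ℝ) + s * p)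

/-- `u` is a (nonzero) weak solution of `(-Δ_{𝔾,p})^s u = lam * β * g(u)` in `Ω`, `u = 0`
outside `Ω`; both sides are required to be absolutely convergent integrals. -/
def IsWeakSolution (ρ : HomogeneousNorm 𝔾) (s p : ℝ) (Ω : Set (Fin N → ℝ))
    (β : (Fin N → ℝ) → ℝ) (g : ℝ → ℝ) (lam : ℝ) (u : (Fin N → ℝ) → ℝ) : Prop :=
  MemX0 ρ s p Ω u ∧ ¬ (u =ᵐ[volume] 0) ∧
    ∀ φ, MemX0 ρ s p Ω φ →
      Integrable (energyDensity ρ s p u φ) ∧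
      IntegrableOn (fun x => β x * g (u x) * φ x) Ω ∧
      ∫ z, energyDensity ρ s p u φ z = lam * ∫ x in Ω, β x * g (u x) * φ x

/-- `G(τ) = ∫_0^τ g`. -/
def primitive (g : ℝ → ℝ) (τ : ℝ) : ℝ := ∫ ξ in (0 : ℝ)..τ, g ξ

/-- `A_M = liminf_{τ → M} max_{|ξ| ≤ τ} G(ξ) / τ^p`, in `[0, ∞]`; the maximum is
nonnegative because `G(0) = 0`. The filter `M` is `𝓝[>] 0` or `atTop`. -/
def constA (g : ℝ → ℝ) (p : ℝ) (M : Filter ℝ) : ℝ≥0∞ :=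
  liminf (fun τ : ℝ => ENNReal.ofReal (sSup (primitive g '' Icc (-τ) τ) / τ ^ p)) M

/-- `B_M = limsup_{τ → M} G(τ) / τ^p`, in `[0, ∞]`, for `G` nonnegative on `[0, ∞)`. -/
def constB (g : ℝ → ℝ) (p : ℝ) (M : Filter ℝ) : ℝ≥0∞ :=
  limsup (fun τ : ℝ => ENNReal.ofReal (primitive g τ / τ ^ p)) M

/-- The constant `C_{p,Q,s}`. -/
def constC (p : ℝ) (Q : ℕ) (s : ℝ) : ℝ :=
  (2 ^ (p * (2 - s)) / ((1 - s) * p) + 2 ^ (2 + p * s) / (p * s)) * (1 - 1 / 2 ^ Q)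
    + 2 ^ (1 + p * s - (Q : ℝ)) / (p * s)

/-- The inradius `r = sup_{x ∈ Ω} dist(x, ∂Ω)` for the distance `d`. -/
def inradius (ρ : HomogeneousNorm 𝔾) (Ω : Set (Fin N → ℝ)) : ℝ≥0∞ :=
  ⨆ x ∈ Ω, ⨅ y ∈ frontier Ω, ENNReal.ofReal (ρ.dist x y)

/-- The embedding constant
`L = sup {‖u‖_{L^∞(Ω)} / ‖u‖_{X_0^{s,p}(Ω)} : u ∈ X_0^{s,p}(Ω) \ {0}}`. -/
def constL (ρ : HomogeneousNorm 𝔾) (s p : ℝ) (Ω : Set (Fin N → ℝ)) : ℝ≥0∞ :=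
  ⨆ (u : (Fin N → ℝ) → ℝ) (_ : MemX0 ρ s p Ω u ∧ ¬ (u =ᵐ[volume] 0)),
    normLinf Ω u / gagliardo ρ s p u

/-- The essential infimum `β_0` of `β` on `Ω`. -/
def betaZero (Ω : Set (Fin N → ℝ)) (β : (Fin N → ℝ) → ℝ) : ℝ :=
  essInf β (volume.restrict Ω)

/-- The constant `D`. -/
def constD (ρ : HomogeneousNorm 𝔾) (s p : ℝ) (Ω : Set (Fin N → ℝ))
    (β : (Fin N → ℝ) → ℝ) : ℝ≥0∞ :=
  inradius ρ Ω ^ (s * p) /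
      (2 ^ 𝔾.Q * ENNReal.ofReal (constC p 𝔾.Q s) * constL ρ s p Ω ^ p * volume Ω * ρ.omega)
    * (ENNReal.ofReal (betaZero Ω β) / normLinf Ω β)

/-- `λ_{1,M}`, with `λ_{1,M} = 0` if `B_M = ∞`. -/
def lambda1 (ρ : HomogeneousNorm 𝔾) (s p : ℝ) (Ω : Set (Fin N → ℝ))
    (β : (Fin N → ℝ) → ℝ) (g : ℝ → ℝ) (M : Filter ℝ) : ℝ≥0∞ :=
  2 ^ 𝔾.Q * ENNReal.ofReal (constC p 𝔾.Q s) * ρ.omega /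
    (ENNReal.ofReal p * inradius ρ Ω ^ (s * p) * ENNReal.ofReal (betaZero Ω β) * constB g p M)

/-- `λ_{2,M}`, with `λ_{2,M} = ∞` if `A_M = 0`. -/
def lambda2 (ρ : HomogeneousNorm 𝔾) (s p : ℝ) (Ω : Set (Fin N → ℝ))
    (β : (Fin N → ℝ) → ℝ) (g : ℝ → ℝ) (M : Filter ℝ) : ℝ≥0∞ :=
  1 / (ENNReal.ofReal p * normLinf Ω β * volume Ω * constL ρ s p Ω ^ p * constA g p M)

end Carnot

end

/-! Solutions are critical points of J(u) = [u]^p / p − λ ∫_Ω β G(u), found as minimizers of J on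
balls of X_0. The problem has no growth condition on `g`; none is needed because sp > Q makes X_0
embed in L^∞ with a finite constant L.

On the ball [u] ≤ τ / L one has |u| ≤ τ, so the potential term is at most ‖β‖_∞ |Ω| max_{[-τ,τ]} G.
The condition λ < λ_2 says that λ times this bound is below (τ / L)^p / p for τ arbitrarily close to
M. For such τ a minimizer u on the ball with J(u) < 0 has [u]^p / p < λ ∫ β G(u) < (τ / L)^p / p. It
is therefore interior, nonzero and a weak solution (`exists_isWeakSolution`).

Negative energy comes from multiples of a truncated cone w on a ball of radius R contained in Ω.
Splitting the double integral over the inner ball, the annulus and the exterior gives the constant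
C_{p,Q,s} (`gagliardo_cone_rpow_le`). With it, λ > λ_1 yields ε > 0 such that J(τw) ≤ −ε τ^p for τ
arbitrarily close to M (`exists_energy_smul_cone_le`).

For M = 0⁺ the ball is fixed first, with radius below 1 / (n + 1), and then a multiple of w small
enough to lie in it; the solution is as small as the ball. For M = ∞ the multiple of w is fixed
first, with energy lower than every energy attained on [u] ≤ n; the ball is then taken large enough
to contain it, and its minimizer must have [u] > n.

Minimizers exist by compactness. Morrey's inequality (`exists_abs_sub_le_dist_rpow`) and a diagonal
extraction give almost everywhere limits that are continuous and vanish off Ω, and the seminorm is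
lower semicontinuous by Fatou. Such a limit is again in X_0, with no regularity of ∂Ω, by soft
thresholding followed by mollification (`memX0_of_continuous`). The analysis rests on the invariance
of Lebesgue measure, deduced from the dilations, and on polar integration of radial functions. -/

noncomputable section

namespace Carnot

variable {N : ℕ}

/-! ### The group law -/

namespace StratifiedGroup

variable (𝔾 : StratifiedGroup N)

theorem mul_left_cancel {x y z : Fin N → ℝ} (h : 𝔾.mul x y = 𝔾.mul x z) : y = z := by
  have := congrArg (𝔾.mul (𝔾.inv x)) h
  rwa [← 𝔾.mul_assoc, ← 𝔾.mul_assoc, 𝔾.inv_mul, 𝔾.zero_mul, 𝔾.zero_mul] at this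

theorem mul_inv (x : Fin N → ℝ) : 𝔾.mul x (𝔾.inv x) = 0 := by
  apply 𝔾.mul_left_cancel (x := 𝔾.inv x)
  rw [← 𝔾.mul_assoc, 𝔾.inv_mul, 𝔾.zero_mul, 𝔾.mul_zero]

theorem inv_mul_cancel_left (x y : Fin N → ℝ) : 𝔾.mul (𝔾.inv x) (𝔾.mul x y) = y := by
  rw [← 𝔾.mul_assoc, 𝔾.inv_mul, 𝔾.zero_mul]

theorem mul_inv_cancel_left (x y : Fin N → ℝ) : 𝔾.mul x (𝔾.mul (𝔾.inv x) y) = y := by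
  rw [← 𝔾.mul_assoc, 𝔾.mul_inv, 𝔾.zero_mul]

theorem eq_inv_of_mul_eq_zero {x y : Fin N → ℝ} (h : 𝔾.mul x y = 0) : y = 𝔾.inv x := by
  apply 𝔾.mul_left_cancel (x := x)
  rw [h, 𝔾.mul_inv]

theorem inv_inv (x : Fin N → ℝ) : 𝔾.inv (𝔾.inv x) = x :=
  (𝔾.eq_inv_of_mul_eq_zero (𝔾.inv_mul x)).symm

theorem inv_zero : 𝔾.inv 0 = 0 :=
  (𝔾.eq_inv_of_mul_eq_zero (𝔾.mul_zero 0)).symm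

theorem mul_inv_rev (x y : Fin N → ℝ) :
    𝔾.inv (𝔾.mul x y) = 𝔾.mul (𝔾.inv y) (𝔾.inv x) := by
  symm
  apply 𝔾.eq_inv_of_mul_eq_zero
  rw [𝔾.mul_assoc, 𝔾.mul_inv_cancel_left, 𝔾.mul_inv]

theorem continuous_mul :
    Continuous (fun z : (Fin N → ℝ) × (Fin N → ℝ) => 𝔾.mul z.1 z.2) :=
  𝔾.contDiff_mul.continuous

theorem continuous_inv : Continuous 𝔾.inv := 𝔾.contDiff_inv.continuous

end StratifiedGroup

/-! ### Dilations -/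

/-- The dilation `D_t` as a continuous linear map. -/
def dilationCLM (w : Fin N → ℕ) (t : ℝ) : (Fin N → ℝ) →L[ℝ] (Fin N → ℝ) :=
  ContinuousLinearMap.pi fun i => (t ^ w i) • ContinuousLinearMap.proj i

theorem dilationCLM_apply (w : Fin N → ℕ) (t : ℝ) (x : Fin N → ℝ) :
    dilationCLM w t x = dilation w t x := by
  ext i; simp [dilationCLM, dilation]

theorem det_dilationCLM (w : Fin N → ℕ) (t : ℝ) :
    (dilationCLM w t).det = t ^ (∑ i, w i) := by
  have h : ((dilationCLM w t : (Fin N → ℝ) →L[ℝ] (Fin N → ℝ)) :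
      (Fin N → ℝ) →ₗ[ℝ] (Fin N → ℝ)) = Matrix.toLin' (Matrix.diagonal fun i => t ^ w i) := by
    ext i j
    simp [dilationCLM_apply, dilation, Matrix.mulVec_diagonal]
  rw [ContinuousLinearMap.det, h, LinearMap.det_toLin', Matrix.det_diagonal,
    Finset.prod_pow_eq_pow_sum]

theorem dilation_dilation (w : Fin N → ℕ) (s t : ℝ) (x : Fin N → ℝ) :
    dilation w s (dilation w t x) = dilation w (s * t) x := by
  ext i; simp [dilation, mul_pow, mul_assoc]

theorem dilation_one (w : Fin N → ℕ) (x : Fin N → ℝ) : dilation w 1 x = x := by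
  ext i; simp [dilation]

theorem dilation_dilation_inv (w : Fin N → ℕ) {t : ℝ} (ht : t ≠ 0) (x : Fin N → ℝ) :
    dilation w t (dilation w t⁻¹ x) = x := by
  rw [dilation_dilation, mul_inv_cancel₀ ht, dilation_one]

theorem continuous_dilation_prod (w : Fin N → ℕ) :
    Continuous (fun z : ℝ × (Fin N → ℝ) => dilation w z.1 z.2) := by
  unfold dilation; fun_prop

theorem dilation_zero_left {w : Fin N → ℕ} (hw : ∀ i, 1 ≤ w i) (x : Fin N → ℝ) :
    dilation w 0 x = 0 := by
  ext i
  simp [dilation, zero_pow (Nat.one_le_iff_ne_zero.mp (hw i))]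

theorem dilation_zero (w : Fin N → ℕ) (t : ℝ) : dilation w t (0 : Fin N → ℝ) = 0 := by
  ext i; simp [dilation]

theorem tendsto_dilation_zero {w : Fin N → ℕ} (hw : ∀ i, 1 ≤ w i) (x : Fin N → ℝ) :
    Tendsto (fun t : ℝ => dilation w t x) (𝓝[>] 0) (𝓝 0) := by
  have h : Continuous (fun t : ℝ => dilation w t x) :=
    (continuous_dilation_prod w).comp (by fun_prop : Continuous fun t : ℝ => (t, x))
  have := h.tendsto 0
  rw [dilation_zero_left hw] at this
  exact this.mono_left nhdsWithin_le_nhds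

theorem volume_dilation_image (w : Fin N → ℕ) {t : ℝ} (ht : 0 < t) (A : Set (Fin N → ℝ)) :
    volume (dilation w t '' A) = ENNReal.ofReal (t ^ (∑ i, w i)) * volume A := by
  have := Measure.addHaar_image_continuousLinearMap volume (dilationCLM w t) A
  have hd := det_dilationCLM w t
  rw [ContinuousLinearMap.det] at hd
  rw [hd, abs_of_pos (pow_pos ht _)] at this
  rw [← this]
  congr 1

/-! ### Invariance of Lebesgue measure -/

/-- Change of variables; surjectivity identifies the image of the preimage of a set with the set
itself. -/
theorem measurePreserving_of_abs_det_eq_one {F F' : (Fin N → ℝ) → (Fin N → ℝ)}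
    (hF : Differentiable ℝ F) (hl : Function.LeftInverse F' F) (hr : Function.RightInverse F' F)
    (hdet : ∀ x, |(fderiv ℝ F x).det| = 1) : MeasurePreserving F volume volume := by
  refine ⟨hF.continuous.measurable, ?_⟩
  ext S hS
  rw [Measure.map_apply hF.continuous.measurable hS]
  have h := lintegral_abs_det_fderiv_eq_addHaar_image volume
    (hF.continuous.measurable hS) (f := F) (f' := fderiv ℝ F)
    (fun x _ => (hF x).hasFDerivAt.hasFDerivWithinAt) hl.injective.injOn
  rw [image_preimage_eq _ hr.surjective] at h
  simpa [hdet] using h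

namespace StratifiedGroup

variable (𝔾 : StratifiedGroup N)

theorem differentiable_mul_left (x : Fin N → ℝ) : Differentiable ℝ (𝔾.mul x) :=
  (𝔾.contDiff_mul.comp (contDiff_const.prodMk contDiff_id)).differentiable (by simp)

/-- Joint continuity matters because the limit t → 0 below moves the translating element and the
base point together. The partial derivative is the full derivative restricted to the second factor.
-/
theorem continuous_fderiv_mul :
    Continuous fun z : (Fin N → ℝ) × (Fin N → ℝ) => fderiv ℝ (𝔾.mul z.1) z.2 := by
  have h : ∀ z : (Fin N → ℝ) × (Fin N → ℝ), fderiv ℝ (𝔾.mul z.1) z.2 =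
      (fderiv ℝ (fun z : (Fin N → ℝ) × (Fin N → ℝ) => 𝔾.mul z.1 z.2) z).comp
        (ContinuousLinearMap.inr ℝ _ _) := by
    intro z
    have h1 : HasFDerivAt (fun y : Fin N → ℝ => (z.1, y))
        (ContinuousLinearMap.inr ℝ (Fin N → ℝ) (Fin N → ℝ)) z.2 := hasFDerivAt_prodMk_right _ _
    have h2 := (𝔾.contDiff_mul.differentiable (by simp) z).hasFDerivAt
    exact (HasFDerivAt.comp z.2 (f := fun y : Fin N → ℝ => (z.1, y)) h2 h1).fderiv
  simp_rw [h]
  exact (𝔾.contDiff_mul.continuous_fderiv (by simp)).clm_comp continuous_const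

/-- Differentiating D_t(x ∘ y) = D_t x ∘ D_t y in y and taking determinants, the factor det D_t
appears on both sides and cancels. -/
theorem det_fderiv_mul_dilation {t : ℝ} (ht : 0 < t) (x y : Fin N → ℝ) :
    (fderiv ℝ (𝔾.mul (dilation 𝔾.weight t x)) (dilation 𝔾.weight t y)).det =
      (fderiv ℝ (𝔾.mul x) y).det := by
  set D := dilationCLM 𝔾.weight t
  have h1 : HasFDerivAt (fun y => 𝔾.mul (dilation 𝔾.weight t x) (D y))
      ((fderiv ℝ (𝔾.mul (dilation 𝔾.weight t x)) (dilation 𝔾.weight t y)).comp D) y := by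
    have := (𝔾.differentiable_mul_left (dilation 𝔾.weight t x) (D y)).hasFDerivAt.comp y
      D.hasFDerivAt
    rwa [dilationCLM_apply] at this
  have h2 : HasFDerivAt (fun y => D (𝔾.mul x y)) (D.comp (fderiv ℝ (𝔾.mul x) y)) y :=
    D.hasFDerivAt.comp y (𝔾.differentiable_mul_left x y).hasFDerivAt
  have h3 : (fun y => D (𝔾.mul x y)) = fun y => 𝔾.mul (dilation 𝔾.weight t x) (D y) := by
    ext1 y
    simp only [D, dilationCLM_apply]
    exact 𝔾.dilation_mul t ht x y
  rw [h3] at h2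
  have h4 := congrArg ContinuousLinearMap.det (h1.unique h2)
  have hD : D.det ≠ 0 := by
    rw [det_dilationCLM]; positivity
  simp only [ContinuousLinearMap.det, ContinuousLinearMap.toLinearMap_comp, LinearMap.det_comp] at h4 hD ⊢
  rw [mul_comm] at h4
  exact mul_left_cancel₀ hD h4

/-- The Jacobian is constant along dilation orbits and continuous, and every orbit tends to the
origin, where left translation by 0 is the identity. -/
theorem det_fderiv_mul (x y : Fin N → ℝ) : (fderiv ℝ (𝔾.mul x) y).det = 1 := by
  have hc := ContinuousLinearMap.continuous_det.comp 𝔾.continuous_fderiv_mul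
  have h1 : Tendsto (fun t : ℝ => (fderiv ℝ (𝔾.mul (dilation 𝔾.weight t x))
      (dilation 𝔾.weight t y)).det) (𝓝[>] 0) (𝓝 (fderiv ℝ (𝔾.mul 0) 0).det) :=
    (hc.tendsto (0, 0)).comp ((tendsto_dilation_zero 𝔾.one_le_weight x).prodMk_nhds
      (tendsto_dilation_zero 𝔾.one_le_weight y))
  have h2 : Tendsto (fun t : ℝ => (fderiv ℝ (𝔾.mul (dilation 𝔾.weight t x))
      (dilation 𝔾.weight t y)).det) (𝓝[>] 0) (𝓝 (fderiv ℝ (𝔾.mul x) y).det) := by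
    apply tendsto_const_nhds.congr'
    filter_upwards [self_mem_nhdsWithin] with t ht
    exact (𝔾.det_fderiv_mul_dilation ht x y).symm
  rw [tendsto_nhds_unique h2 h1]
  have : 𝔾.mul 0 = id := by ext1 z; exact 𝔾.zero_mul z
  rw [this, fderiv_id]
  simp [ContinuousLinearMap.det]

theorem measurePreserving_mul_left (x : Fin N → ℝ) :
    MeasurePreserving (𝔾.mul x) volume volume :=
  measurePreserving_of_abs_det_eq_one (𝔾.differentiable_mul_left x) (F' := 𝔾.mul (𝔾.inv x))
    (𝔾.inv_mul_cancel_left x) (𝔾.mul_inv_cancel_left x) (by simp [𝔾.det_fderiv_mul])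

theorem inv_dilation {t : ℝ} (ht : 0 < t) (x : Fin N → ℝ) :
    𝔾.inv (dilation 𝔾.weight t x) = dilation 𝔾.weight t (𝔾.inv x) := by
  symm
  apply 𝔾.eq_inv_of_mul_eq_zero
  rw [← 𝔾.dilation_mul t ht, 𝔾.mul_inv, dilation_zero]

theorem differentiable_inv : Differentiable ℝ 𝔾.inv := 𝔾.contDiff_inv.differentiable (by simp)

theorem det_fderiv_inv_dilation {t : ℝ} (ht : 0 < t) (y : Fin N → ℝ) :
    (fderiv ℝ 𝔾.inv (dilation 𝔾.weight t y)).det = (fderiv ℝ 𝔾.inv y).det := by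
  set D := dilationCLM 𝔾.weight t
  have h1 : HasFDerivAt (fun y => 𝔾.inv (D y))
      ((fderiv ℝ 𝔾.inv (dilation 𝔾.weight t y)).comp D) y := by
    have := (𝔾.differentiable_inv (D y)).hasFDerivAt.comp y D.hasFDerivAt
    rwa [dilationCLM_apply] at this
  have h2 : HasFDerivAt (fun y => D (𝔾.inv y)) (D.comp (fderiv ℝ 𝔾.inv y)) y :=
    D.hasFDerivAt.comp y (𝔾.differentiable_inv y).hasFDerivAt
  have h3 : (fun y => D (𝔾.inv y)) = fun y => 𝔾.inv (D y) := by
    ext1 y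
    simp only [D, dilationCLM_apply]
    exact (𝔾.inv_dilation ht y).symm
  rw [h3] at h2
  have h4 := congrArg ContinuousLinearMap.det (h1.unique h2)
  have hD : D.det ≠ 0 := by
    rw [det_dilationCLM]; positivity
  simp only [ContinuousLinearMap.det, ContinuousLinearMap.toLinearMap_comp, LinearMap.det_comp] at h4 hD ⊢
  rw [mul_comm] at h4
  exact mul_left_cancel₀ hD h4

theorem det_fderiv_inv_eq (y : Fin N → ℝ) :
    (fderiv ℝ 𝔾.inv y).det = (fderiv ℝ 𝔾.inv 0).det := by
  have hc := ContinuousLinearMap.continuous_det.comp (𝔾.contDiff_inv.continuous_fderiv (by simp))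
  have h1 : Tendsto (fun t : ℝ => (fderiv ℝ 𝔾.inv (dilation 𝔾.weight t y)).det) (𝓝[>] 0)
      (𝓝 (fderiv ℝ 𝔾.inv 0).det) :=
    (hc.tendsto 0).comp (tendsto_dilation_zero 𝔾.one_le_weight y)
  have h2 : Tendsto (fun t : ℝ => (fderiv ℝ 𝔾.inv (dilation 𝔾.weight t y)).det) (𝓝[>] 0)
      (𝓝 (fderiv ℝ 𝔾.inv y).det) := by
    apply tendsto_const_nhds.congr'
    filter_upwards [self_mem_nhdsWithin] with t ht
    exact (𝔾.det_fderiv_inv_dilation ht y).symm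
  exact tendsto_nhds_unique h2 h1

/-- Dilations make the Jacobian of the inversion constant, as for translations. The inversion is an
involution fixing 0, so the determinant there squares to 1. -/
theorem abs_det_fderiv_inv (y : Fin N → ℝ) : |(fderiv ℝ 𝔾.inv y).det| = 1 := by
  have h1 : HasFDerivAt (fun y => 𝔾.inv (𝔾.inv y))
      ((fderiv ℝ 𝔾.inv 0).comp (fderiv ℝ 𝔾.inv 0)) 0 := by
    have := (𝔾.differentiable_inv (𝔾.inv 0)).hasFDerivAt.comp 0 (𝔾.differentiable_inv 0).hasFDerivAt
    rwa [𝔾.inv_zero] at this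
  have h2 : (fun y => 𝔾.inv (𝔾.inv y)) = id := by ext1 y; exact 𝔾.inv_inv y
  rw [h2] at h1
  have h3 := congrArg ContinuousLinearMap.det (h1.unique (hasFDerivAt_id 0))
  simp only [ContinuousLinearMap.det, ContinuousLinearMap.toLinearMap_comp, LinearMap.det_comp,
    ContinuousLinearMap.coe_id, LinearMap.det_id] at h3
  rw [𝔾.det_fderiv_inv_eq]
  have h4 : ((fderiv ℝ 𝔾.inv 0).det) ^ 2 = 1 := by rw [sq]; exact h3
  exact (pow_eq_one_iff_of_nonneg (abs_nonneg _) two_ne_zero).mp (by rw [sq_abs, h4])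

theorem measurePreserving_inv : MeasurePreserving 𝔾.inv volume volume :=
  measurePreserving_of_abs_det_eq_one 𝔾.differentiable_inv 𝔾.inv_inv 𝔾.inv_inv
    𝔾.abs_det_fderiv_inv

end StratifiedGroup

end Carnot

namespace Carnot

variable {N : ℕ} {𝔾 : StratifiedGroup N}

theorem StratifiedGroup.Q_pos (𝔾 : StratifiedGroup N) (hN : 0 < N) : 0 < 𝔾.Q := by
  have h := 𝔾.one_le_weight ⟨0, hN⟩
  have h2 := Finset.single_le_sum (f := 𝔾.weight) (fun _ _ => Nat.zero_le _)
    (Finset.mem_univ (⟨0, hN⟩ : Fin N))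
  unfold StratifiedGroup.Q
  omega

/-! ### The homogeneous norm and its left-invariant distance. -/

namespace HomogeneousNorm

variable (ρ : HomogeneousNorm 𝔾)

theorem map_zero : ρ.toFun 0 = 0 := (ρ.eq_zero_iff 0).mpr rfl

theorem pos {x : Fin N → ℝ} (hx : x ≠ 0) : 0 < ρ.toFun x :=
  (ρ.nonneg x).lt_of_ne fun h => hx ((ρ.eq_zero_iff x).mp h.symm)

theorem dist_nonneg (x y : Fin N → ℝ) : 0 ≤ ρ.dist x y := ρ.nonneg _

theorem dist_comm (x y : Fin N → ℝ) : ρ.dist x y = ρ.dist y x := by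
  unfold dist
  rw [← ρ.inv_eq, 𝔾.mul_inv_rev, 𝔾.inv_inv]

theorem dist_mul_left (h x y : Fin N → ℝ) :
    ρ.dist (𝔾.mul h x) (𝔾.mul h y) = ρ.dist x y := by
  unfold dist
  rw [𝔾.mul_inv_rev, 𝔾.mul_assoc, 𝔾.inv_mul_cancel_left]

theorem dist_mul_right (x z : Fin N → ℝ) : ρ.dist (𝔾.mul x z) x = ρ.toFun z := by
  unfold dist
  rw [𝔾.inv_mul_cancel_left]

theorem dist_mul_right' (x z : Fin N → ℝ) : ρ.dist x (𝔾.mul x z) = ρ.toFun z := by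
  rw [dist_comm, dist_mul_right]

theorem dist_triangle (x y z : Fin N → ℝ) : ρ.dist x z ≤ ρ.dist x y + ρ.dist y z := by
  have := ρ.triangle (𝔾.mul (𝔾.inv z) y) (𝔾.mul (𝔾.inv y) x)
  rw [𝔾.mul_assoc, 𝔾.mul_inv_cancel_left] at this
  unfold dist
  linarith

theorem dist_self (x : Fin N → ℝ) : ρ.dist x x = 0 := by
  unfold dist
  rw [𝔾.inv_mul, ρ.map_zero]

theorem continuous_dist :
    Continuous fun z : (Fin N → ℝ) × (Fin N → ℝ) => ρ.dist z.1 z.2 :=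
  ρ.continuous'.comp (𝔾.continuous_mul.comp
    ((𝔾.continuous_inv.comp continuous_snd).prodMk continuous_fst))

theorem continuous_dist_left (x : Fin N → ℝ) : Continuous (ρ.dist x) :=
  ρ.continuous_dist.comp (by fun_prop : Continuous fun y : Fin N → ℝ => (x, y))

theorem measurable_dist :
    Measurable fun z : (Fin N → ℝ) × (Fin N → ℝ) => ρ.dist z.1 z.2 :=
  ρ.continuous_dist.measurable

/-! ### Sublevel sets of the norm -/

/-- The norm has a positive minimum m on the compact Euclidean unit sphere. A point outside the
Euclidean unit ball is carried onto that sphere by some D_t with t ≤ 1, which does not increase the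
homogeneous norm. -/
theorem exists_lt_subset_ball :
    ∃ m > 0, ∀ x, ρ.toFun x < m → ‖x‖ < 1 := by
  have hS : IsCompact (Metric.sphere (0 : Fin N → ℝ) 1) := isCompact_sphere _ _
  have hm : ∃ m > 0, ∀ x ∈ Metric.sphere (0 : Fin N → ℝ) 1, m ≤ ρ.toFun x := by
    rcases (Metric.sphere (0 : Fin N → ℝ) 1).eq_empty_or_nonempty with h | h
    · exact ⟨1, one_pos, by simp [h]⟩
    · obtain ⟨x, hx, hmin⟩ := hS.exists_isMinOn h ρ.continuous'.continuousOn
      refine ⟨ρ.toFun x, ρ.pos ?_, fun y hy => hmin hy⟩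
      rintro rfl
      simp at hx
  obtain ⟨m, hm0, hm⟩ := hm
  refine ⟨m, hm0, fun x hx => ?_⟩
  by_contra! hx1
  have hc : ContinuousOn (fun t : ℝ => ‖dilation 𝔾.weight t x‖) (Icc 0 1) := by
    have h : Continuous (fun t : ℝ => dilation 𝔾.weight t x) :=
      (continuous_dilation_prod _).comp (by fun_prop : Continuous fun t : ℝ => (t, x))
    exact h.norm.continuousOn
  obtain ⟨t, ht, h1⟩ := intermediate_value_Icc zero_le_one hc
    (by simpa [dilation_zero_left 𝔾.one_le_weight, dilation_one] using hx1 :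
      (1 : ℝ) ∈ Icc ‖dilation 𝔾.weight 0 x‖ ‖dilation 𝔾.weight 1 x‖)
  have ht0 : 0 < t := by
    refine ht.1.lt_of_ne ?_
    rintro rfl
    simp [dilation_zero_left 𝔾.one_le_weight] at h1
  have h2 := hm (dilation 𝔾.weight t x) (by simpa using h1)
  rw [ρ.dilation_eq t ht0] at h2
  have := mul_le_of_le_one_left (ρ.nonneg x) ht.2
  linarith

theorem setOf_lt_eq_image {c t : ℝ} (ht : 0 < t) :
    {x | ρ.toFun x < t * c} = dilation 𝔾.weight t '' {x | ρ.toFun x < c} := by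
  ext x
  constructor
  · intro hx
    refine ⟨dilation 𝔾.weight t⁻¹ x, ?_, dilation_dilation_inv _ ht.ne' x⟩
    simp only [mem_ofPred_eq] at hx ⊢
    rw [ρ.dilation_eq _ (inv_pos.mpr ht), inv_mul_lt_iff₀ ht]
    exact hx
  · rintro ⟨y, hy, rfl⟩
    simp only [mem_ofPred_eq] at hy ⊢
    rw [ρ.dilation_eq t ht]
    exact mul_lt_mul_of_pos_left hy ht

theorem isBounded_lt (c : ℝ) : Bornology.IsBounded {x | ρ.toFun x < c} := by
  obtain ⟨m, hm, h⟩ := ρ.exists_lt_subset_ball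
  have hb : Bornology.IsBounded {x | ρ.toFun x < m} :=
    (Metric.isBounded_ball (x := 0) (r := 1)).subset fun x hx => by
      simpa using h x hx
  -- The maximum with 1 keeps the dilation factor positive when c ≤ 0.
  set t := max (c / m) 1
  have ht : 0 < t := lt_of_lt_of_le one_pos (le_max_right _ _)
  have hsub : {x | ρ.toFun x < c} ⊆ {x | ρ.toFun x < t * m} := by
    intro x hx
    have : c ≤ t * m := by
      rw [← div_le_iff₀ hm]; exact le_max_left _ _
    exact lt_of_lt_of_le hx this
  refine Bornology.IsBounded.subset ?_ hsub
  rw [ρ.setOf_lt_eq_image ht]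
  have : dilation 𝔾.weight t = dilationCLM 𝔾.weight t := by
    ext1 x; rw [dilationCLM_apply]
  rw [this]
  obtain ⟨R, hR⟩ := hb.exists_norm_le
  refine isBounded_iff_forall_norm_le.mpr ⟨‖dilationCLM 𝔾.weight t‖ * R, ?_⟩
  rintro _ ⟨y, hy, rfl⟩
  exact (ContinuousLinearMap.le_opNorm _ _).trans
    (mul_le_mul_of_nonneg_left (hR y hy) (norm_nonneg _))

/-- Homogeneous smallness implies Euclidean smallness: {ρ < t m} is the image under D_t of a subset
of the unit ball, and for t ≤ 1 each coordinate shrinks at least by the factor t because the weights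
are at least 1. -/
theorem tendsto_nhds_zero_of_norm {ι : Type*} {l : Filter ι} {z : ι → Fin N → ℝ}
    (h : Tendsto (fun i => ρ.toFun (z i)) l (𝓝 0)) : Tendsto z l (𝓝 0) := by
  obtain ⟨m, hm, hb⟩ := ρ.exists_lt_subset_ball
  rw [Metric.tendsto_nhds]
  intro ε hε
  set t := min ε 1
  have ht : 0 < t := lt_min hε one_pos
  filter_upwards [h.eventually (gt_mem_nhds (mul_pos ht hm))] with i hi
  have hmem : z i ∈ {x | ρ.toFun x < t * m} := hi
  rw [ρ.setOf_lt_eq_image ht] at hmem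
  obtain ⟨y, hy, hyz⟩ := hmem
  rw [dist_zero_right, ← hyz]
  have hy1 := hb y hy
  refine lt_of_le_of_lt ((pi_norm_le_iff_of_nonneg (r := t * ‖y‖) (by positivity)).mpr
    fun i => ?_) (lt_of_lt_of_le (mul_lt_of_lt_one_right ht hy1) (min_le_left _ _))
  simp only [dilation, norm_mul, norm_pow, Real.norm_of_nonneg ht.le]
  refine mul_le_mul ?_ (norm_le_pi_norm y i) (norm_nonneg _) ht.le
  exact pow_le_of_le_one ht.le (min_le_right _ _) (Nat.one_le_iff_ne_zero.mp (𝔾.one_le_weight i))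

theorem isOpen_lt (c : ℝ) : IsOpen {x | ρ.toFun x < c} :=
  _root_.isOpen_lt ρ.continuous' continuous_const

theorem volume_lt_pos : 0 < volume {x | ρ.toFun x < 1} :=
  (ρ.isOpen_lt 1).measure_pos _ ⟨0, by simp [ρ.map_zero]⟩

theorem volume_lt_lt_top (c : ℝ) : volume {x | ρ.toFun x < c} < ⊤ :=
  (ρ.isBounded_lt c).measure_lt_top

theorem volume_lt {t : ℝ} (ht : 0 < t) :
    volume {x | ρ.toFun x < t} = ENNReal.ofReal (t ^ 𝔾.Q) * volume {x | ρ.toFun x < 1} := by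
  have := volume_dilation_image 𝔾.weight ht {x | ρ.toFun x < 1}
  rw [← ρ.setOf_lt_eq_image ht, mul_one] at this
  exact this

theorem volume_eq_zero (hN : 0 < N) : volume {x | ρ.toFun x = 0} = 0 := by
  have h : {x | ρ.toFun x = 0} = {0} := by ext x; simp [ρ.eq_zero_iff]
  have : Nonempty (Fin N) := ⟨⟨0, hN⟩⟩
  rw [h, measure_singleton]

/-- Normalization sends the whole punctured unit ball into the unit sphere, and the origin is a null
set in positive dimension. -/
theorem omega_eq (hN : 0 < N) : ρ.omega = 𝔾.Q * volume {x | ρ.toFun x < 1} := by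
  have hmeas : Measurable fun x => dilation 𝔾.weight (ρ.toFun x)⁻¹ x := by
    refine measurable_pi_lambda _ fun i => ?_
    exact (((ρ.continuous'.measurable).inv).pow_const _).mul (measurable_pi_apply i)
  have hS : MeasurableSet {x | ρ.toFun x = 1} :=
    (isClosed_eq ρ.continuous' continuous_const).measurableSet
  have hR : MeasurableSet {x | 0 < ρ.toFun x ∧ ρ.toFun x < 1} :=
    ((_root_.isOpen_lt continuous_const ρ.continuous').inter (ρ.isOpen_lt 1)).measurableSet
  unfold omega surfaceMeasure
  rw [Measure.smul_apply, Measure.map_apply hmeas hS, Measure.restrict_apply (hmeas hS),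
    smul_eq_mul]
  congr 1
  have h1 : ((fun x => dilation 𝔾.weight (ρ.toFun x)⁻¹ x) ⁻¹' {x | ρ.toFun x = 1} ∩
      {x | 0 < ρ.toFun x ∧ ρ.toFun x < 1}) = {x | ρ.toFun x < 1} \ {x | ρ.toFun x = 0} := by
    ext x
    simp only [mem_inter_iff, mem_preimage, mem_ofPred_eq, Set.mem_sdiff]
    constructor
    · rintro ⟨_, h0, h1⟩; exact ⟨h1, h0.ne'⟩
    · rintro ⟨h1, h0⟩
      have h0' : 0 < ρ.toFun x := (ρ.nonneg x).lt_of_ne (Ne.symm h0)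
      refine ⟨?_, h0', h1⟩
      rw [ρ.dilation_eq _ (inv_pos.mpr h0'), inv_mul_cancel₀ h0]
  rw [h1, measure_sdiff_null (ρ.volume_eq_zero hN)]

theorem omega_pos (hN : 0 < N) : 0 < ρ.omega := by
  rw [ρ.omega_eq hN]
  refine ENNReal.mul_pos ?_ ρ.volume_lt_pos.ne'
  exact_mod_cast (𝔾.Q_pos hN).ne'

theorem omega_lt_top (hN : 0 < N) : ρ.omega < ⊤ := by
  rw [ρ.omega_eq hN]
  exact ENNReal.mul_lt_top (by simp) (ρ.volume_lt_lt_top 1)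

theorem volume_lt_eq_omega (hN : 0 < N) {t : ℝ} (ht : 0 < t) :
    volume {x | ρ.toFun x < t} = ENNReal.ofReal (t ^ 𝔾.Q / 𝔾.Q) * ρ.omega := by
  have hQ : (0 : ℝ) < 𝔾.Q := by exact_mod_cast 𝔾.Q_pos hN
  rw [ρ.volume_lt ht, ρ.omega_eq hN, ← mul_assoc, ENNReal.ofReal_div_of_pos hQ,
    ENNReal.ofReal_natCast, ENNReal.div_mul_cancel]
  · exact_mod_cast (𝔾.Q_pos hN).ne'
  · simp

/-! ### Balls of the left-invariant distance. -/

theorem setOf_dist_lt (x : Fin N → ℝ) (t : ℝ) :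
    {y | ρ.dist x y < t} = 𝔾.mul (𝔾.inv x) ⁻¹' {z | ρ.toFun z < t} := by
  ext y
  simp only [mem_ofPred_eq, mem_preimage]
  rw [ρ.dist_comm]
  rfl

theorem isOpen_dist_lt (x : Fin N → ℝ) (t : ℝ) : IsOpen {y | ρ.dist x y < t} :=
  _root_.isOpen_lt (ρ.continuous_dist_left x) continuous_const

theorem volume_dist_lt (x : Fin N → ℝ) (t : ℝ) :
    volume {y | ρ.dist x y < t} = volume {z | ρ.toFun z < t} := by
  rw [setOf_dist_lt]
  exact (𝔾.measurePreserving_mul_left _).measure_preimage (ρ.isOpen_lt t).measurableSet.nullMeasurableSet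

theorem isBounded_dist_lt (x : Fin N → ℝ) (t : ℝ) :
    Bornology.IsBounded {y | ρ.dist x y < t} := by
  have h : {y | ρ.dist x y < t} ⊆ 𝔾.mul x '' closure {z | ρ.toFun z < t} := by
    intro y hy
    rw [setOf_dist_lt] at hy
    exact ⟨_, subset_closure hy, 𝔾.mul_inv_cancel_left x y⟩
  refine Bornology.IsBounded.subset ?_ h
  exact ((ρ.isBounded_lt t).isCompact_closure.image
    (𝔾.differentiable_mul_left x).continuous).isBounded

/-- The dilation orbit of a point of a ball stays in the ball, so a ball that misses the boundary of
a set and whose centre lies in the set is contained in the set. -/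
theorem setOf_dist_lt_subset {Ω : Set (Fin N → ℝ)} {x : Fin N → ℝ} {t : ℝ}
    (hx : x ∈ Ω) (h : ∀ y ∈ frontier Ω, t ≤ ρ.dist x y) : {y | ρ.dist x y < t} ⊆ Ω := by
  intro y hy
  by_contra hyΩ
  set z := 𝔾.mul (𝔾.inv x) y
  have hyz : y = 𝔾.mul x z := (𝔾.mul_inv_cancel_left x y).symm
  set γ : ℝ → (Fin N → ℝ) := fun τ => 𝔾.mul x (dilation 𝔾.weight τ z)
  have hγ : Continuous γ := by
    have h1 : Continuous (fun t : ℝ => dilation 𝔾.weight t z) :=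
      (continuous_dilation_prod _).comp (by fun_prop : Continuous fun t : ℝ => (t, z))
    exact 𝔾.continuous_mul.comp (continuous_const.prodMk h1)
  have hγ0 : γ 0 = x := by
    simp only [γ, dilation_zero_left 𝔾.one_le_weight, 𝔾.mul_zero]
  have hγ1 : γ 1 = y := by simp only [γ, dilation_one, ← hyz]
  have hconn : IsPreconnected (γ '' Icc 0 1) := isPreconnected_Icc.image _ hγ.continuousOn
  have hx' : (γ '' Icc 0 1 ∩ Ω).Nonempty := ⟨x, ⟨0, by simp, hγ0⟩, hx⟩
  have hy' : (γ '' Icc 0 1 ∩ Ωᶜ).Nonempty := ⟨y, ⟨1, by simp, hγ1⟩, hyΩ⟩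
  have hne : (γ '' Icc 0 1 ∩ frontier Ω).Nonempty := by
    by_contra hemp
    rw [not_nonempty_iff_eq_empty] at hemp
    have hnot : ∀ w ∈ γ '' Icc 0 1, w ∉ frontier Ω := fun w hw hf => by
      have : w ∈ γ '' Icc 0 1 ∩ frontier Ω := ⟨hw, hf⟩
      simp [hemp] at this
    obtain ⟨w, _, hw1, hw2⟩ := hconn (interior Ω) (closure Ω)ᶜ isOpen_interior
      isClosed_closure.isOpen_compl (fun w hw => by
        by_contra h'
        simp only [mem_union, mem_compl_iff, not_or, not_not] at h'
        exact hnot w hw ⟨h'.2, h'.1⟩)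
      (by
        obtain ⟨w, hw, hwΩ⟩ := hx'
        exact ⟨w, hw, by_contra fun h' => hnot w hw ⟨subset_closure hwΩ, h'⟩⟩)
      (by
        obtain ⟨w, hw, hwΩ⟩ := hy'
        exact ⟨w, hw, fun h' => hnot w hw ⟨h', fun hi => hwΩ (interior_subset hi)⟩⟩)
    exact hw2 (interior_subset.trans subset_closure hw1)
  obtain ⟨_, ⟨τ, hτ, rfl⟩, hfr⟩ := hne
  have h1 := h _ hfr
  rw [dist_mul_right'] at h1
  have hy2 : ρ.toFun z < t := by
    rw [mem_ofPred_eq, hyz, dist_mul_right'] at hy; exact hy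
  rcases hτ.1.eq_or_lt with h0 | h0
  · rw [← h0, dilation_zero_left 𝔾.one_le_weight, ρ.map_zero] at h1
    linarith [ρ.nonneg z]
  · rw [ρ.dilation_eq τ h0] at h1
    have := mul_le_of_le_one_left (ρ.nonneg z) hτ.2
    linarith

/-! ### Polar integration of radial functions -/

/-- This is the polar formula for radial functions in the form of the law of the norm. It suffices
to compare both measures on intervals [a, b), where homogeneity gives ω_Q (b^Q − a^Q) / Q for a ≥ 0;
a negative a can be replaced by 0. -/
theorem map_volume (hN : 0 < N) :
    Measure.map ρ.toFun volume = ρ.omega •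
      (volume.restrict (Ioi (0 : ℝ))).withDensity fun t => ENNReal.ofReal (t ^ ((𝔾.Q : ℝ) - 1)) := by
  have hQ : (0 : ℝ) < 𝔾.Q := by exact_mod_cast 𝔾.Q_pos hN
  have hmeas := ρ.continuous'.measurable
  have key : ∀ a b : ℝ, 0 ≤ a → a < b → ∫⁻ t in Ico a b ∩ Ioi 0,
      ENNReal.ofReal (t ^ ((𝔾.Q : ℝ) - 1)) = ENNReal.ofReal ((b ^ 𝔾.Q - a ^ 𝔾.Q) / 𝔾.Q) := by
    intro a b ha hab
    have h1 : ∫⁻ t in Ico a b ∩ Ioi 0, ENNReal.ofReal (t ^ ((𝔾.Q : ℝ) - 1)) =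
        ∫⁻ t in Ioc a b, ENNReal.ofReal (t ^ ((𝔾.Q : ℝ) - 1)) := by
      apply setLIntegral_congr
      have h3 : (Ico a b ∩ Ioi 0 : Set ℝ) =ᵐ[volume] Ioo a b := by
        have : Ioo a b = (Ioo a b ∩ Ioi 0 : Set ℝ) := by
          rw [inter_eq_left.mpr]; intro x hx; exact lt_of_le_of_lt ha hx.1
        rw [this]
        exact Ioo_ae_eq_Ico.symm.inter (ae_eq_refl _)
      exact h3.trans Ioo_ae_eq_Ioc
    have hint : IntervalIntegrable (fun x : ℝ => x ^ ((𝔾.Q : ℝ) - 1)) volume a b :=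
      intervalIntegral.intervalIntegrable_rpow' (by linarith)
    rw [h1, ← ofReal_integral_eq_lintegral_ofReal]
    · rw [← intervalIntegral.integral_of_le hab.le, integral_rpow (Or.inl (by linarith))]
      simp [Real.rpow_natCast]
    · exact (intervalIntegrable_iff_integrableOn_Ioc_of_le hab.le).mp hint
    · filter_upwards [ae_restrict_mem measurableSet_Ioc] with t ht
      exact Real.rpow_nonneg (ha.trans ht.1.le) _
  have hnn : ∀ a b : ℝ, a < b → Measure.map ρ.toFun volume (Ico a b) ≤
      volume {x | ρ.toFun x < b} := by
    intro a b _
    rw [Measure.map_apply hmeas measurableSet_Ico]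
    exact measure_mono fun x hx => hx.2
  refine Measure.ext_of_Ico' _ _ (fun a b hab => ne_top_of_le_ne_top
    (ρ.volume_lt_lt_top b).ne (hnn a b hab)) fun a b hab => ?_
  rw [Measure.smul_apply, withDensity_apply _ measurableSet_Ico,
    Measure.restrict_restrict measurableSet_Ico, smul_eq_mul]
  rcases le_or_gt b 0 with hb | hb
  · have h1 : (Ico a b ∩ Ioi 0 : Set ℝ) = ∅ := by
      ext x; simp only [mem_inter_iff, mem_Ico, mem_Ioi, mem_empty_iff_false, iff_false]
      rintro ⟨⟨_, h⟩, h'⟩; linarith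
    have h2 : volume {x | ρ.toFun x < b} = 0 := by
      have : {x | ρ.toFun x < b} = ∅ := by
        ext x; simp; exact hb.trans (ρ.nonneg x)
      simp [this]
    rw [h1]
    simpa [h2] using hnn a b hab
  · have h0 : ∀ a, 0 ≤ a → a < b → volume (ρ.toFun ⁻¹' Ico a b) =
        ENNReal.ofReal ((b ^ 𝔾.Q - a ^ 𝔾.Q) / 𝔾.Q) * ρ.omega := by
      intro a ha hab
      have h1 : ρ.toFun ⁻¹' Ico a b = {x | ρ.toFun x < b} \ {x | ρ.toFun x < a} := by
        ext x; simp [and_comm]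
      have h2 : volume {x | ρ.toFun x < a} = ENNReal.ofReal (a ^ 𝔾.Q / 𝔾.Q) * ρ.omega := by
        rcases ha.eq_or_lt with rfl | ha
        · have : {x | ρ.toFun x < 0} = ∅ := by
            ext x; simp [ρ.nonneg x]
          simp [this, (𝔾.Q_pos hN).ne']
        · exact ρ.volume_lt_eq_omega hN ha
      have hsub : {x | ρ.toFun x < a} ⊆ {x | ρ.toFun x < b} := fun x hx => lt_trans hx hab
      rw [h1, measure_sdiff hsub
        (ρ.isOpen_lt a).measurableSet.nullMeasurableSet (ρ.volume_lt_lt_top a).ne, h2,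
        ρ.volume_lt_eq_omega hN hb, ← ENNReal.sub_mul (fun _ _ => (ρ.omega_lt_top hN).ne),
        ← ENNReal.ofReal_sub _ (by positivity), sub_div]
    rw [Measure.map_apply hmeas measurableSet_Ico, mul_comm]
    rcases le_or_gt 0 a with ha | ha
    · rw [key a b ha hab, h0 a ha hab]
    · have h1 : ρ.toFun ⁻¹' Ico a b = ρ.toFun ⁻¹' Ico 0 b := by
        ext x; simp only [mem_preimage, mem_Ico]
        exact ⟨fun h => ⟨ρ.nonneg x, h.2⟩, fun h => ⟨ha.le.trans (ρ.nonneg x), h.2⟩⟩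
      have h2 : (Ico a b ∩ Ioi 0 : Set ℝ) = Ico 0 b ∩ Ioi 0 := by
        ext x; simp only [mem_inter_iff, mem_Ico, mem_Ioi]
        exact ⟨fun h => ⟨⟨h.2.le, h.1.2⟩, h.2⟩, fun h => ⟨⟨ha.le.trans h.1.1, h.1.2⟩, h.2⟩⟩
      rw [h1, h2, key 0 b le_rfl hb, h0 0 le_rfl hb]

theorem lintegral_radial (hN : 0 < N) {f : ℝ → ℝ≥0∞} (hf : Measurable f) :
    ∫⁻ x, f (ρ.toFun x) = ρ.omega * ∫⁻ t in Ioi 0, ENNReal.ofReal (t ^ ((𝔾.Q : ℝ) - 1)) * f t := by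
  rw [← lintegral_map hf ρ.continuous'.measurable, ρ.map_volume hN, lintegral_smul_measure,
    lintegral_withDensity_eq_lintegral_mul _ (by fun_prop) hf]
  rfl

theorem lintegral_rpow_lt (hN : 0 < N) {a δ : ℝ} (ha : 0 < a) (hδ : 0 < δ) :
    ∫⁻ x, (Iio δ).indicator (fun t => ENNReal.ofReal (t ^ (a - 𝔾.Q))) (ρ.toFun x) =
      ENNReal.ofReal (δ ^ a / a) * ρ.omega := by
  have hf : Measurable ((Iio δ).indicator fun t : ℝ => ENNReal.ofReal (t ^ (a - 𝔾.Q))) :=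
    (by fun_prop : Measurable fun t : ℝ => ENNReal.ofReal (t ^ (a - 𝔾.Q))).indicator
      measurableSet_Iio
  rw [ρ.lintegral_radial hN hf, mul_comm]
  congr 1
  have h1 : ∀ t ∈ Ioi (0 : ℝ), ENNReal.ofReal (t ^ ((𝔾.Q : ℝ) - 1)) *
      (Iio δ).indicator (fun t : ℝ => ENNReal.ofReal (t ^ (a - 𝔾.Q))) t =
      (Iio δ).indicator (fun t : ℝ => ENNReal.ofReal (t ^ (a - 1))) t := by
    intro t ht
    by_cases h : t ∈ Iio δ
    · rw [indicator_of_mem h, indicator_of_mem h, ← ENNReal.ofReal_mul (Real.rpow_nonneg ht.le _),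
        ← Real.rpow_add ht]
      congr 2; ring
    · simp [indicator_of_notMem h]
  rw [setLIntegral_congr_fun measurableSet_Ioi h1, lintegral_indicator measurableSet_Iio,
    Measure.restrict_restrict measurableSet_Iio]
  have h2 : (Iio δ ∩ Ioi 0 : Set ℝ) = Ioo 0 δ := by ext; simp [and_comm]
  have hint : IntervalIntegrable (fun x : ℝ => x ^ (a - 1)) volume 0 δ :=
    intervalIntegral.intervalIntegrable_rpow' (by linarith)
  rw [h2, setLIntegral_congr Ioo_ae_eq_Ioc, ← ofReal_integral_eq_lintegral_ofReal]
  · rw [← intervalIntegral.integral_of_le hδ.le, integral_rpow (Or.inl (by linarith))]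
    simp [Real.zero_rpow ha.ne']
  · exact (intervalIntegrable_iff_integrableOn_Ioc_of_le hδ.le).mp hint
  · filter_upwards [ae_restrict_mem measurableSet_Ioc] with t ht
    exact Real.rpow_nonneg ht.1.le _

theorem lintegral_rpow_ge (hN : 0 < N) {b δ : ℝ} (hb : 0 < b) (hδ : 0 < δ) :
    ∫⁻ x, (Ici δ).indicator (fun t => ENNReal.ofReal (t ^ (-b - 𝔾.Q))) (ρ.toFun x) =
      ENNReal.ofReal (δ ^ (-b) / b) * ρ.omega := by
  have hf : Measurable ((Ici δ).indicator fun t : ℝ => ENNReal.ofReal (t ^ (-b - 𝔾.Q))) :=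
    (by fun_prop : Measurable fun t : ℝ => ENNReal.ofReal (t ^ (-b - 𝔾.Q))).indicator
      measurableSet_Ici
  rw [ρ.lintegral_radial hN hf, mul_comm]
  congr 1
  have h1 : ∀ t ∈ Ioi (0 : ℝ), ENNReal.ofReal (t ^ ((𝔾.Q : ℝ) - 1)) *
      (Ici δ).indicator (fun t : ℝ => ENNReal.ofReal (t ^ (-b - 𝔾.Q))) t =
      (Ici δ).indicator (fun t : ℝ => ENNReal.ofReal (t ^ (-b - 1))) t := by
    intro t ht
    by_cases h : t ∈ Ici δ
    · rw [indicator_of_mem h, indicator_of_mem h, ← ENNReal.ofReal_mul (Real.rpow_nonneg ht.le _),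
        ← Real.rpow_add ht]
      congr 2; ring
    · simp [indicator_of_notMem h]
  rw [setLIntegral_congr_fun measurableSet_Ioi h1, lintegral_indicator measurableSet_Ici,
    Measure.restrict_restrict measurableSet_Ici]
  have h2 : (Ici δ ∩ Ioi 0 : Set ℝ) = Ici δ := by
    rw [inter_eq_left.mpr]; intro x hx; exact lt_of_lt_of_le hδ hx
  rw [h2, setLIntegral_congr Ioi_ae_eq_Ici.symm, ← ofReal_integral_eq_lintegral_ofReal]
  · rw [integral_Ioi_rpow_of_lt (by linarith) hδ]
    congr 1
    rw [show -b - 1 + 1 = -b by ring, neg_div_neg_eq]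
  · exact integrableOn_Ioi_rpow_of_lt (by linarith) hδ
  · filter_upwards [ae_restrict_mem measurableSet_Ioi] with t ht
    exact Real.rpow_nonneg (hδ.le.trans ht.le) _

/-- Radial integrals may be centred at any point. -/
theorem lintegral_dist (x : Fin N → ℝ) (f : ℝ → ℝ≥0∞) (hf : Measurable f) :
    ∫⁻ y, f (ρ.dist x y) = ∫⁻ z, f (ρ.toFun z) := by
  have h := (𝔾.measurePreserving_mul_left (𝔾.inv x)).lintegral_comp
    (f := fun z => f (ρ.toFun z)) (hf.comp ρ.continuous'.measurable)
  rw [← h]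
  congr 1; ext1 y
  rw [ρ.dist_comm]
  rfl

end HomogeneousNorm

end Carnot

namespace Carnot

variable {N : ℕ} {𝔾 : StratifiedGroup N} {ρ : HomogeneousNorm 𝔾} {s p : ℝ}
  {Ω : Set (Fin N → ℝ)}

/-! ### The Gagliardo seminorm as an `L^p` norm -/

/-- The fractional difference quotient, whose `L^p` norm is the Gagliardo seminorm. -/
def diffQuot (ρ : HomogeneousNorm 𝔾) (s p : ℝ) (u : (Fin N → ℝ) → ℝ)
    (z : (Fin N → ℝ) × (Fin N → ℝ)) : ℝ :=
  (u z.1 - u z.2) / ρ.dist z.1 z.2 ^ (((𝔾.Q : ℝ) + p * s) / p)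

theorem abs_diffQuot_rpow (hp : 0 < p) (u : (Fin N → ℝ) → ℝ)
    (z : (Fin N → ℝ) × (Fin N → ℝ)) :
    |diffQuot ρ s p u z| ^ p = |u z.1 - u z.2| ^ p / ρ.dist z.1 z.2 ^ ((𝔾.Q : ℝ) + p * s) := by
  have hd := ρ.dist_nonneg z.1 z.2
  rw [diffQuot, abs_div, Real.div_rpow (abs_nonneg _) (abs_nonneg _),
    abs_of_nonneg (Real.rpow_nonneg hd _), ← Real.rpow_mul hd, div_mul_cancel₀ _ hp.ne']

theorem gagliardo_eq_eLpNorm (hp : 0 < p) (u : (Fin N → ℝ) → ℝ) :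
    gagliardo ρ s p u = eLpNorm (diffQuot ρ s p u) (ENNReal.ofReal p) volume := by
  rw [eLpNorm_eq_lintegral_rpow_enorm_toReal (by simpa using hp) ENNReal.ofReal_ne_top,
    ENNReal.toReal_ofReal hp.le, gagliardo]
  congr 2
  ext1 z
  rw [← abs_diffQuot_rpow hp, ← ENNReal.ofReal_rpow_of_nonneg (abs_nonneg _) hp.le,
    Real.enorm_eq_ofReal_abs]

theorem gagliardo_rpow (hp : 0 < p) (u : (Fin N → ℝ) → ℝ) :
    gagliardo ρ s p u ^ p = ∫⁻ z : (Fin N → ℝ) × (Fin N → ℝ),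
      ENNReal.ofReal (|u z.1 - u z.2| ^ p / ρ.dist z.1 z.2 ^ ((𝔾.Q : ℝ) + p * s)) := by
  rw [gagliardo, ← ENNReal.rpow_mul, one_div_mul_cancel hp.ne', ENNReal.rpow_one]

theorem diffQuot_add (u v : (Fin N → ℝ) → ℝ) :
    diffQuot ρ s p (u + v) = diffQuot ρ s p u + diffQuot ρ s p v := by
  ext z; simp only [diffQuot, Pi.add_apply]; ring

theorem diffQuot_sub (u v : (Fin N → ℝ) → ℝ) :
    diffQuot ρ s p (u - v) = diffQuot ρ s p u - diffQuot ρ s p v := by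
  ext z; simp only [diffQuot, Pi.sub_apply]; ring

theorem diffQuot_smul (c : ℝ) (u : (Fin N → ℝ) → ℝ) :
    diffQuot ρ s p (c • u) = c • diffQuot ρ s p u := by
  ext z; simp only [diffQuot, Pi.smul_apply, smul_eq_mul]; ring

theorem ae_prod_of_ae {P : (Fin N → ℝ) → Prop} (h : ∀ᵐ x, P x) :
    ∀ᵐ z : (Fin N → ℝ) × (Fin N → ℝ), P z.1 ∧ P z.2 := by
  have h1 : ∀ᵐ z : (Fin N → ℝ) × (Fin N → ℝ), P z.1 :=
    Measure.quasiMeasurePreserving_fst.ae h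
  have h2 : ∀ᵐ z : (Fin N → ℝ) × (Fin N → ℝ), P z.2 :=
    Measure.quasiMeasurePreserving_snd.ae h
  exact h1.and h2

theorem diffQuot_congr_ae {u v : (Fin N → ℝ) → ℝ} (h : u =ᵐ[volume] v) :
    diffQuot ρ s p u =ᵐ[volume] diffQuot ρ s p v := by
  filter_upwards [ae_prod_of_ae h] with z hz
  simp only [diffQuot, hz.1, hz.2]

theorem gagliardo_congr_ae (hp : 0 < p) {u v : (Fin N → ℝ) → ℝ} (h : u =ᵐ[volume] v) :
    gagliardo ρ s p u = gagliardo ρ s p v := by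
  rw [gagliardo_eq_eLpNorm hp, gagliardo_eq_eLpNorm hp, eLpNorm_congr_ae (diffQuot_congr_ae h)]

theorem measurable_dist_rpow (c : ℝ) :
    Measurable fun z : (Fin N → ℝ) × (Fin N → ℝ) => ρ.dist z.1 z.2 ^ c :=
  ρ.measurable_dist.pow_const c

theorem aestronglyMeasurable_diffQuot {u : (Fin N → ℝ) → ℝ}
    (hu : AEStronglyMeasurable u volume) : AEStronglyMeasurable (diffQuot ρ s p u) volume := by
  have h1 : AEMeasurable (fun z : (Fin N → ℝ) × (Fin N → ℝ) => u z.1) volume :=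
    hu.aemeasurable.comp_quasiMeasurePreserving Measure.quasiMeasurePreserving_fst
  have h2 : AEMeasurable (fun z : (Fin N → ℝ) × (Fin N → ℝ) => u z.2) volume :=
    hu.aemeasurable.comp_quasiMeasurePreserving Measure.quasiMeasurePreserving_snd
  exact ((h1.sub h2).div (measurable_dist_rpow _).aemeasurable).aestronglyMeasurable

theorem gagliardo_add_le (hp : 1 ≤ p) {u v : (Fin N → ℝ) → ℝ}
    (hu : AEStronglyMeasurable u volume) (hv : AEStronglyMeasurable v volume) :
    gagliardo ρ s p (u + v) ≤ gagliardo ρ s p u + gagliardo ρ s p v := by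
  have hp0 : 0 < p := by linarith
  simp only [gagliardo_eq_eLpNorm hp0, diffQuot_add]
  exact eLpNorm_add_le (aestronglyMeasurable_diffQuot hu) (aestronglyMeasurable_diffQuot hv)
    (by simpa using hp)

theorem gagliardo_sub_le (hp : 1 ≤ p) {u v : (Fin N → ℝ) → ℝ}
    (hu : AEStronglyMeasurable u volume) (hv : AEStronglyMeasurable v volume) :
    gagliardo ρ s p (u - v) ≤ gagliardo ρ s p u + gagliardo ρ s p v := by
  have hp0 : 0 < p := by linarith
  simp only [gagliardo_eq_eLpNorm hp0, diffQuot_sub]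
  exact eLpNorm_sub_le (aestronglyMeasurable_diffQuot hu) (aestronglyMeasurable_diffQuot hv)
    (by simpa using hp)

theorem gagliardo_smul (hp : 0 < p) (c : ℝ) (u : (Fin N → ℝ) → ℝ) :
    gagliardo ρ s p (c • u) = ENNReal.ofReal |c| * gagliardo ρ s p u := by
  simp only [gagliardo_eq_eLpNorm hp, diffQuot_smul]
  rw [eLpNorm_const_smul, Real.enorm_eq_ofReal_abs]

theorem gagliardo_sub_comm (hp : 0 < p) (u v : (Fin N → ℝ) → ℝ) :
    gagliardo ρ s p (u - v) = gagliardo ρ s p (v - u) := by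
  have : u - v = (-1 : ℝ) • (v - u) := by ext; simp
  rw [this, gagliardo_smul hp]; simp

theorem memLp_diffQuot (hp : 0 < p) {u : (Fin N → ℝ) → ℝ} (hu : MemW ρ s p u) :
    MemLp (diffQuot ρ s p u) (ENNReal.ofReal p) volume :=
  ⟨aestronglyMeasurable_diffQuot hu.1.1, by rw [← gagliardo_eq_eLpNorm hp]; exact hu.2⟩

theorem MemW.add (hp : 1 ≤ p) {u v : (Fin N → ℝ) → ℝ} (hu : MemW ρ s p u) (hv : MemW ρ s p v) :
    MemW ρ s p (u + v) :=
  ⟨hu.1.add hv.1, lt_of_le_of_lt (gagliardo_add_le hp hu.1.1 hv.1.1)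
    (ENNReal.add_lt_top.mpr ⟨hu.2, hv.2⟩)⟩

theorem MemW.smul (hp : 0 < p) (c : ℝ) {u : (Fin N → ℝ) → ℝ} (hu : MemW ρ s p u) :
    MemW ρ s p (c • u) :=
  ⟨hu.1.const_smul c, by
    rw [gagliardo_smul hp]; exact ENNReal.mul_lt_top ENNReal.ofReal_lt_top hu.2⟩

/-! ### The space `X_0` -/

theorem IsTestFunction.add {φ ψ : (Fin N → ℝ) → ℝ} (hφ : IsTestFunction Ω φ)
    (hψ : IsTestFunction Ω ψ) : IsTestFunction Ω (φ + ψ) :=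
  ⟨hφ.1.add hψ.1, hφ.2.1.add hψ.2.1,
    (tsupport_add φ ψ).trans (union_subset hφ.2.2 hψ.2.2)⟩

theorem IsTestFunction.smul {φ : (Fin N → ℝ) → ℝ} (hφ : IsTestFunction Ω φ) (c : ℝ) :
    IsTestFunction Ω (c • φ) :=
  ⟨contDiff_const.smul hφ.1, hφ.2.1.smul_left (f := fun _ => c),
    (tsupport_smul_subset_right (fun _ => c) φ).trans hφ.2.2⟩

theorem IsTestFunction.eq_zero {φ : (Fin N → ℝ) → ℝ} (hφ : IsTestFunction Ω φ)
    {x : Fin N → ℝ} (hx : x ∉ Ω) : φ x = 0 :=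
  image_eq_zero_of_notMem_tsupport fun h => hx (hφ.2.2 h)

theorem IsTestFunction.memLp {φ : (Fin N → ℝ) → ℝ} (hφ : IsTestFunction Ω φ) (q : ℝ≥0∞) :
    MemLp φ q volume :=
  hφ.1.continuous.memLp_of_hasCompactSupport hφ.2.1

theorem MemX0.add (hp : 1 ≤ p) {u v : (Fin N → ℝ) → ℝ} (hu : MemX0 ρ s p Ω u)
    (hv : MemX0 ρ s p Ω v) : MemX0 ρ s p Ω (u + v) := by
  obtain ⟨hu1, φ, hφ, hφt⟩ := hu
  obtain ⟨hv1, ψ, hψ, hψt⟩ := hv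
  refine ⟨hu1.add hp hv1, fun n => φ n + ψ n, fun n => (hφ n).add (hψ n), ?_⟩
  have hsum := hφt.add hψt
  rw [add_zero] at hsum
  refine tendsto_of_tendsto_of_tendsto_of_le_of_le tendsto_const_nhds hsum
    (fun _ => zero_le) fun n => ?_
  have h : u + v - (φ n + ψ n) = (u - φ n) + (v - ψ n) := by ext; simp; ring
  have m1 := hu1.1.1.sub ((hφ n).memLp 1).1
  have m2 := hv1.1.1.sub ((hψ n).memLp 1).1
  simp only [h]
  calc _ ≤ (eLpNorm (u - φ n) (ENNReal.ofReal p) volume +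
        eLpNorm (v - ψ n) (ENNReal.ofReal p) volume) +
        (gagliardo ρ s p (u - φ n) + gagliardo ρ s p (v - ψ n)) :=
        add_le_add (eLpNorm_add_le m1 m2 (by simpa using hp)) (gagliardo_add_le hp m1 m2)
    _ = _ := by ring

theorem MemX0.smul (hp : 0 < p) {u : (Fin N → ℝ) → ℝ} (hu : MemX0 ρ s p Ω u) (c : ℝ) :
    MemX0 ρ s p Ω (c • u) := by
  obtain ⟨hu1, φ, hφ, hφt⟩ := hu
  refine ⟨hu1.smul hp c, fun n => c • φ n, fun n => (hφ n).smul c, ?_⟩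
  have hsum := ENNReal.Tendsto.const_mul hφt (Or.inr (ENNReal.ofReal_ne_top (r := |c|)))
  rw [mul_zero] at hsum
  refine hsum.congr fun n => ?_
  have h : c • u - c • φ n = c • (u - φ n) := by rw [smul_sub]
  rw [h, gagliardo_smul hp, eLpNorm_const_smul, Real.enorm_eq_ofReal_abs, mul_add]

theorem IsTestFunction.zero : IsTestFunction Ω (0 : (Fin N → ℝ) → ℝ) :=
  ⟨contDiff_const, HasCompactSupport.zero, by simp [tsupport]⟩

theorem gagliardo_zero (hp : 0 < p) : gagliardo ρ s p 0 = 0 := by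
  have := gagliardo_smul (ρ := ρ) (s := s) hp 0 0
  simpa using this

theorem MemX0.zero (hp : 0 < p) : MemX0 ρ s p Ω 0 :=
  ⟨⟨MemLp.zero, by simp [gagliardo_zero hp]⟩, fun _ => 0, fun _ => IsTestFunction.zero, by
    simp [gagliardo_zero hp]⟩

theorem IsTestFunction.memX0 (hp : 0 < p) {φ : (Fin N → ℝ) → ℝ} (hφ : IsTestFunction Ω φ)
    (h : gagliardo ρ s p φ < ⊤) : MemX0 ρ s p Ω φ :=
  ⟨⟨hφ.memLp _, h⟩, fun _ => φ, fun _ => hφ, by simp [gagliardo_zero hp]⟩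

/-- Approximation of elements of `X_0` by test functions, almost everywhere and in seminorm. -/
theorem MemX0.exists_testFunction (hp : 1 ≤ p) {u : (Fin N → ℝ) → ℝ} (hu : MemX0 ρ s p Ω u)
    {ε : ℝ≥0∞} (hε : 0 < ε) : ∃ φ, IsTestFunction Ω φ ∧ MemX0 ρ s p Ω φ ∧
      eLpNorm (u - φ) (ENNReal.ofReal p) volume < ε ∧ gagliardo ρ s p (u - φ) < ε := by
  obtain ⟨hu1, φ, hφ, hφt⟩ := hu
  -- The cap at 1 keeps the seminorm of u − φ finite even if ε is infinite; finiteness of the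
  -- seminorm of φ is then inherited from u.
  have hmin : (0 : ℝ≥0∞) < min ε 1 := lt_min hε one_pos
  obtain ⟨n, hn⟩ := (hφt.eventually (gt_mem_nhds hmin)).exists
  have h1 : gagliardo ρ s p (u - φ n) < min ε 1 := lt_of_le_of_lt le_add_self hn
  refine ⟨φ n, hφ n, (hφ n).memX0 (by linarith) ?_,
    lt_of_lt_of_le (lt_of_le_of_lt le_self_add hn) (min_le_left _ _),
    lt_of_lt_of_le h1 (min_le_left _ _)⟩
  have h2 : φ n = u - (u - φ n) := by ext; simp
  rw [h2]
  exact lt_of_le_of_lt (gagliardo_sub_le hp hu1.1.1 (hu1.1.1.sub ((hφ n).memLp 1).1))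
    (ENNReal.add_lt_top.mpr ⟨hu1.2, h1.trans_le (le_trans (min_le_right _ _) le_top)⟩)

end Carnot

namespace Carnot

variable {N : ℕ} {𝔾 : StratifiedGroup N} {ρ : HomogeneousNorm 𝔾} {s p : ℝ}
  {Ω : Set (Fin N → ℝ)}

/-! ### Comparison of the distance with the Euclidean topology. -/

namespace HomogeneousNorm

variable (ρ : HomogeneousNorm 𝔾)

theorem eq_of_dist_eq_zero {x y : Fin N → ℝ} (h : ρ.dist x y = 0) : x = y := by
  have h1 := (ρ.eq_zero_iff _).mp h
  have h2 := 𝔾.eq_inv_of_mul_eq_zero h1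
  rwa [𝔾.inv_inv] at h2

/-- Left translation by the inverse of x reduces the claim to the origin, where convergence in the
norm implies Euclidean convergence. -/
theorem exists_dist_lt_subset {x : Fin N → ℝ} {U : Set (Fin N → ℝ)} (hU : U ∈ 𝓝 x) :
    ∃ R > 0, {y | ρ.dist x y < R} ⊆ U := by
  have h1 : Tendsto (fun y => 𝔾.mul (𝔾.inv x) y) (comap (ρ.dist x) (𝓝 0)) (𝓝 0) := by
    refine ρ.tendsto_nhds_zero_of_norm ?_
    refine tendsto_comap.congr fun y => ?_
    rw [ρ.dist_comm]; rfl
  have h2 : Tendsto id (comap (ρ.dist x) (𝓝 0)) (𝓝 x) := by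
    have h3 := ((𝔾.differentiable_mul_left x).continuous.tendsto 0).comp h1
    rw [𝔾.mul_zero] at h3
    exact h3.congr fun y => 𝔾.mul_inv_cancel_left x y
  have h4 : U ∈ comap (ρ.dist x) (𝓝 0) := h2 hU
  obtain ⟨V, hV, hVU⟩ := h4
  obtain ⟨R, hR, hRV⟩ := Metric.mem_nhds_iff.mp hV
  refine ⟨R, hR, fun y hy => hVU (hRV ?_)⟩
  simpa [abs_of_nonneg (ρ.dist_nonneg x y)] using hy

end HomogeneousNorm

/-! ### Hölder continuity -/

theorem abs_sub_eq_diffQuot (u : (Fin N → ℝ) → ℝ) (z : (Fin N → ℝ) × (Fin N → ℝ)) :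
    |u z.1 - u z.2| = |diffQuot ρ s p u z| * ρ.dist z.1 z.2 ^ (((𝔾.Q : ℝ) + p * s) / p) := by
  have hd := ρ.dist_nonneg z.1 z.2
  rcases hd.eq_or_lt with h | h
  · rw [ρ.eq_of_dist_eq_zero h.symm]
    simp [diffQuot, ρ.eq_of_dist_eq_zero h.symm]
  · have h1 := Real.rpow_pos_of_pos h (((𝔾.Q : ℝ) + p * s) / p)
    rw [diffQuot, abs_div, abs_of_pos h1, div_mul_cancel₀ _ h1.ne']

/-- The difference of the averages is the average of u(x) − u(y) over A × B. There the difference is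
at most κ^((Q + ps)/p) times the difference quotient, and Hölder's inequality passes from L^1 to L^p
at the cost of a power of |A| |B|. -/
theorem abs_average_sub_le (hs : 0 ≤ s) (hp : 1 ≤ p) {u : (Fin N → ℝ) → ℝ}
    (hug : gagliardo ρ s p u < ⊤) {A B : Set (Fin N → ℝ)} {κ : ℝ}
    (hA : 0 < volume.real A) (hB : 0 < volume.real B)
    (huA : IntegrableOn u A) (huB : IntegrableOn u B)
    (hAm : MeasurableSet A) (hBm : MeasurableSet B)
    (hκ : ∀ x ∈ A, ∀ y ∈ B, ρ.dist x y ≤ κ) :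
    |(⨍ x in A, u x) - ⨍ x in B, u x| ≤
      (volume.real A * volume.real B) ^ (-(1 / p)) * κ ^ (((𝔾.Q : ℝ) + p * s) / p) *
        (gagliardo ρ s p u).toReal := by
  have hp0 : 0 < p := by linarith
  set a := volume.real A
  set b := volume.real B
  set c := ((𝔾.Q : ℝ) + p * s) / p
  have hc : 0 ≤ c := by positivity
  have hAt : volume A ≠ ⊤ := fun h => by simp [a, measureReal_def, h] at hA
  have hBt : volume B ≠ ⊤ := fun h => by simp [b, measureReal_def, h] at hB
  have : IsFiniteMeasure (volume.restrict A) := ⟨by simpa using hAt.lt_top⟩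
  have : IsFiniteMeasure (volume.restrict B) := ⟨by simpa using hBt.lt_top⟩
  set μ := (volume.restrict A).prod (volume.restrict B) with hμ
  have hκ0 : 0 ≤ κ := by
    have hAn : A.Nonempty := nonempty_of_measure_ne_zero (μ := volume) fun h => by
      simp [a, measureReal_def, h] at hA
    have hBn : B.Nonempty := nonempty_of_measure_ne_zero (μ := volume) fun h => by
      simp [b, measureReal_def, h] at hB
    obtain ⟨x, hx⟩ := hAn
    obtain ⟨y, hy⟩ := hBn
    exact (ρ.dist_nonneg x y).trans (hκ x hx y hy)
  have hμr : μ = (volume : Measure ((Fin N → ℝ) × (Fin N → ℝ))).restrict (A ×ˢ B) := by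
    rw [hμ, Measure.prod_restrict]; rfl
  have hμu : μ univ = ENNReal.ofReal (a * b) := by
    rw [hμ, ← univ_prod_univ, Measure.prod_prod, ENNReal.ofReal_mul hA.le]
    simp [a, b, measureReal_def, ENNReal.ofReal_toReal hAt, ENNReal.ofReal_toReal hBt]
  set f : (Fin N → ℝ) × (Fin N → ℝ) → ℝ := fun z => u z.1 - u z.2
  have hint : ∫ z, f z ∂μ = b * (∫ x in A, u x) - a * ∫ x in B, u x := by
    rw [integral_sub (huA.comp_fst _) (huB.comp_snd _), integral_fun_fst, integral_fun_snd]
    simp only [smul_eq_mul, measureReal_restrict_apply_univ]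
    rfl
  have hfm : AEStronglyMeasurable f μ := (huA.comp_fst _).1.sub (huB.comp_snd _).1
  have h1 : eLpNorm f (ENNReal.ofReal p) μ ≤ ENNReal.ofReal (κ ^ c) * gagliardo ρ s p u := by
    rw [gagliardo_eq_eLpNorm hp0]
    calc eLpNorm f (ENNReal.ofReal p) μ ≤ eLpNorm ((κ ^ c) • diffQuot ρ s p u)
          (ENNReal.ofReal p) μ := by
          rw [hμr]
          refine eLpNorm_mono_ae ?_
          filter_upwards [ae_restrict_mem (hAm.prod hBm)] with z hz
          simp only [f, Pi.smul_apply, norm_smul, Real.norm_eq_abs]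
          rw [abs_sub_eq_diffQuot (ρ := ρ) (s := s) (p := p), mul_comm,
            abs_of_nonneg (Real.rpow_nonneg hκ0 _)]
          gcongr
          · exact ρ.dist_nonneg _ _
          · exact hκ _ hz.1 _ hz.2
      _ = ENNReal.ofReal (κ ^ c) * eLpNorm (diffQuot ρ s p u) (ENNReal.ofReal p) μ := by
          rw [eLpNorm_const_smul, Real.enorm_eq_ofReal (Real.rpow_nonneg hκ0 _)]
      _ ≤ _ := by
          rw [hμr]
          gcongr
          exact Measure.restrict_le_self
  have h2 : ‖∫ z, f z ∂μ‖ₑ ≤ ENNReal.ofReal (κ ^ c) * gagliardo ρ s p u *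
      ENNReal.ofReal (a * b) ^ (1 - 1 / p) := by
    calc ‖∫ z, f z ∂μ‖ₑ ≤ ∫⁻ z, ‖f z‖ₑ ∂μ := enorm_integral_le_lintegral_enorm _
      _ = eLpNorm f 1 μ := (eLpNorm_one_eq_lintegral_enorm).symm
      _ ≤ eLpNorm f (ENNReal.ofReal p) μ * μ univ ^ (1 / (1 : ℝ≥0∞).toReal -
          1 / (ENNReal.ofReal p).toReal) :=
          eLpNorm_le_eLpNorm_mul_rpow_measure_univ (by simpa using hp) hfm
      _ ≤ _ := by
          rw [ENNReal.toReal_one, div_one, ENNReal.toReal_ofReal hp0.le, hμu]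
          gcongr
  have hab : 0 < a * b := mul_pos hA hB
  have h3 : |∫ z, f z ∂μ| ≤ κ ^ c * (gagliardo ρ s p u).toReal * (a * b) ^ (1 - 1 / p) := by
    rw [Real.enorm_eq_ofReal_abs, ENNReal.ofReal_rpow_of_pos hab,
      ← ENNReal.ofReal_toReal hug.ne, ← ENNReal.ofReal_mul (Real.rpow_nonneg hκ0 _),
      ← ENNReal.ofReal_mul (by positivity)] at h2
    exact (ENNReal.ofReal_le_ofReal_iff (by positivity)).mp h2
  have h4 : (⨍ x in A, u x) - ⨍ x in B, u x = (a * b)⁻¹ * ∫ z, f z ∂μ := by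
    rw [hint, setAverage_eq, setAverage_eq]
    simp only [smul_eq_mul]
    change a⁻¹ * (∫ x in A, u x) - b⁻¹ * (∫ x in B, u x) = _
    field_simp
  rw [h4, abs_mul, abs_of_pos (inv_pos.mpr hab)]
  calc (a * b)⁻¹ * |∫ z, f z ∂μ| ≤
        (a * b)⁻¹ * (κ ^ c * (gagliardo ρ s p u).toReal * (a * b) ^ (1 - 1 / p)) := by gcongr
    _ = ((a * b)⁻¹ * (a * b) ^ (1 - 1 / p)) * κ ^ c * (gagliardo ρ s p u).toReal := by ring
    _ = _ := by
        rw [← Real.rpow_neg_one, ← Real.rpow_add hab]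
        congr 3; ring

/-- Averages of `u` over comparable balls differ by a power of the radius. -/
theorem exists_abs_average_ball_sub_le (ρ : HomogeneousNorm 𝔾) (hs : 0 ≤ s)
    (hp : 1 ≤ p) : ∃ K ≥ 0, ∀ u : (Fin N → ℝ) → ℝ, Continuous u → gagliardo ρ s p u < ⊤ →
      ∀ x y r r', 0 < r → r / 2 ≤ r' → r' ≤ r → ρ.dist x y ≤ r →
      |(⨍ z in {z | ρ.dist x z < r}, u z) - ⨍ z in {z | ρ.dist y z < r'}, u z| ≤
        K * (gagliardo ρ s p u).toReal * r ^ (s - 𝔾.Q / p) := by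
  have hp0 : 0 < p := by linarith
  set v := volume.real {z | ρ.toFun z < 1}
  have hv : 0 < v := by
    exact ENNReal.toReal_pos ρ.volume_lt_pos.ne' (ρ.volume_lt_lt_top 1).ne
  have hvol : ∀ x r, 0 < r → volume.real {z | ρ.dist x z < r} = r ^ 𝔾.Q * v := by
    intro x r hr
    rw [measureReal_def, ρ.volume_dist_lt, ρ.volume_lt hr, ENNReal.toReal_mul,
      ENNReal.toReal_ofReal (by positivity)]
    rfl
  set c := ((𝔾.Q : ℝ) + p * s) / p
  -- The first factor comes from r' ≥ r / 2, which bounds the product of the two volumes from below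
  -- by a multiple of r^(2Q). The factor 4 covers the distances between points of the two balls,
  -- which are at most r + r + r'.
  refine ⟨(v * ((1 / 2) ^ 𝔾.Q * v)) ^ (-(1 / p)) * 4 ^ c, by positivity, ?_⟩
  intro u hu hug x y r r' hr hr2 hr' hxy
  have hr'0 : 0 < r' := by linarith
  have hloc : LocallyIntegrable u volume := hu.locallyIntegrable
  have hI : ∀ x r, IntegrableOn u {z | ρ.dist x z < r} := fun x r =>
    (hloc.integrableOn_isCompact (ρ.isBounded_dist_lt x r).isCompact_closure).mono_set
      subset_closure
  have h := abs_average_sub_le hs hp hug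
    (A := {z | ρ.dist x z < r}) (B := {z | ρ.dist y z < r'}) (κ := 4 * r)
    (by rw [hvol x r hr]; positivity) (by rw [hvol y r' hr'0]; positivity) (hI x r) (hI y r')
    (ρ.isOpen_dist_lt x r).measurableSet (ρ.isOpen_dist_lt y r').measurableSet (by
      intro a ha b hb
      simp only [mem_ofPred_eq] at ha hb
      have h1 := ρ.dist_triangle a x b
      have h2 := ρ.dist_triangle x y b
      rw [ρ.dist_comm] at h1
      rw [ρ.dist_comm b a] at h1
      have h3 := ρ.dist_triangle a x b
      rw [ρ.dist_comm a x] at h3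
      linarith)
  refine h.trans ?_
  have hg0 : 0 ≤ (gagliardo ρ s p u).toReal := ENNReal.toReal_nonneg
  rw [hvol x r hr, hvol y r' hr'0]
  have h1 : (r ^ 𝔾.Q * v * (r' ^ 𝔾.Q * v)) ^ (-(1 / p)) ≤
      (r ^ 𝔾.Q * v * ((r / 2) ^ 𝔾.Q * v)) ^ (-(1 / p)) := by
    refine Real.rpow_le_rpow_of_nonpos (by positivity) (by gcongr) ?_
    rw [neg_nonpos]; positivity
  calc _ ≤ (r ^ 𝔾.Q * v * ((r / 2) ^ 𝔾.Q * v)) ^ (-(1 / p)) * (4 * r) ^ c *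
        (gagliardo ρ s p u).toReal := by gcongr
    _ = _ := by
        have h2 : r ^ 𝔾.Q * v * ((r / 2) ^ 𝔾.Q * v) =
            (v * ((1 / 2) ^ 𝔾.Q * v)) * r ^ (2 * 𝔾.Q : ℝ) := by
          rw [show (2 * 𝔾.Q : ℝ) = ((2 * 𝔾.Q : ℕ) : ℝ) by push_cast; ring, Real.rpow_natCast,
            div_eq_mul_one_div, mul_pow]
          ring
        rw [h2, Real.mul_rpow (by positivity) (by positivity), ← Real.rpow_mul hr.le,
          Real.mul_rpow (by norm_num) hr.le]
        -- Exponent count: −2Q/p + (Q + ps)/p = s − Q/p.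
        have h3 : r ^ (s - 𝔾.Q / p) = r ^ (2 * (𝔾.Q : ℝ) * -(1 / p)) * r ^ c := by
          rw [← Real.rpow_add hr]
          congr 1
          simp only [c]
          field_simp
          ring
        rw [h3]; ring

/-- By continuity u maps small balls into a closed interval about u(x), and averages remain in
closed convex sets. -/
theorem tendsto_average_ball (ρ : HomogeneousNorm 𝔾) {u : (Fin N → ℝ) → ℝ} (hu : Continuous u)
    (x : Fin N → ℝ) {r : ℕ → ℝ} (hr : ∀ n, 0 < r n) (hr0 : Tendsto r atTop (𝓝 0)) :
    Tendsto (fun n => ⨍ z in {z | ρ.dist x z < r n}, u z) atTop (𝓝 (u x)) := by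
  rw [Metric.tendsto_nhds]
  intro ε hε
  obtain ⟨R, hR, hRU⟩ := ρ.exists_dist_lt_subset
    (hu.continuousAt.preimage_mem_nhds (Metric.closedBall_mem_nhds (u x) (half_pos hε)))
  filter_upwards [hr0.eventually (gt_mem_nhds hR)] with n hn
  have h1 : volume {z | ρ.dist x z < r n} ≠ 0 :=
    ((ρ.isOpen_dist_lt x (r n)).measure_pos _ ⟨x, by simp [ρ.dist_self, hr n]⟩).ne'
  have h := (convex_closedBall (u x) (ε / 2)).set_average_mem Metric.isClosed_closedBall
    (μ := volume) (t := {z | ρ.dist x z < r n}) (f := u) h1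
    (ρ.isBounded_dist_lt x (r n)).measure_lt_top.ne
    (by
      filter_upwards [ae_restrict_mem (ρ.isOpen_dist_lt x (r n)).measurableSet] with z hz
      exact hRU (lt_trans (hz : ρ.dist x z < r n) hn))
    ((hu.locallyIntegrable.integrableOn_isCompact
      (ρ.isBounded_dist_lt x (r n)).isCompact_closure).mono_set subset_closure)
  rw [Metric.mem_closedBall] at h
  linarith

/-- **Morrey's inequality** on a stratified group. -/
theorem exists_abs_sub_le_dist_rpow (ρ : HomogeneousNorm 𝔾) (hs : 0 ≤ s) (hp : 1 ≤ p)
    (hsp : (𝔾.Q : ℝ) < s * p) : ∃ K ≥ 0, ∀ u : (Fin N → ℝ) → ℝ, Continuous u →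
      gagliardo ρ s p u < ⊤ → ∀ x y,
        |u x - u y| ≤ K * (gagliardo ρ s p u).toReal * ρ.dist x y ^ (s - 𝔾.Q / p) := by
  have hp0 : 0 < p := by linarith
  obtain ⟨K, hK, hav⟩ := exists_abs_average_ball_sub_le ρ hs hp
  set α := s - 𝔾.Q / p
  have hα : 0 < α := by
    simp only [α]; rw [sub_pos, div_lt_iff₀ hp0]; exact hsp
  set q : ℝ := (1 / 2) ^ α
  have hq1 : q < 1 := Real.rpow_lt_one (by norm_num) (by norm_num) hα
  have hq0 : 0 ≤ q := by positivity
  -- The 1 is the comparison of the two balls of radius d(x, y) about x and y. Each of the two terms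
  -- 1 / (1 − q) sums the geometric series obtained by halving the radius at one of the points, each
  -- halving costing a factor q = 2^(−α).
  refine ⟨K * (1 + 2 / (1 - q)), mul_nonneg hK (by have : 0 < 1 - q := by linarith
                                                   positivity), ?_⟩
  intro u hu hug x y
  set G := (gagliardo ρ s p u).toReal
  rcases (ρ.dist_nonneg x y).eq_or_lt with h0 | hr
  · rw [ρ.eq_of_dist_eq_zero h0.symm, ρ.dist_self, Real.zero_rpow hα.ne']; simp
  set r := ρ.dist x y
  have hpt : ∀ x, |(⨍ z in {z | ρ.dist x z < r}, u z) - u x| ≤ K * G * r ^ α / (1 - q) := by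
    intro x
    have hlim := tendsto_average_ball ρ hu x (r := fun n => r * (1 / 2) ^ n)
      (fun n => by positivity) (by
        have := (tendsto_pow_atTop_nhds_zero_of_lt_one (r := (1 / 2 : ℝ)) (by norm_num)
          (by norm_num)).const_mul r
        simpa using this)
    have h := dist_le_of_le_geometric_of_tendsto₀ q (K * G * r ^ α) hq1 (fun n => by
      have h1 := hav u hu hug x x (r * (1 / 2) ^ n) (r * (1 / 2) ^ (n + 1)) (by positivity)
        (by rw [pow_succ]; apply le_of_eq; ring) (by
          rw [pow_succ]
          have : 0 < r * (1 / 2) ^ n := by positivity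
          nlinarith) (by rw [ρ.dist_self]; positivity)
      rw [Real.dist_eq]
      refine h1.trans (le_of_eq ?_)
      rw [Real.mul_rpow hr.le (by positivity), ← Real.rpow_natCast, ← Real.rpow_mul (by norm_num),
        mul_comm (n : ℝ) α, Real.rpow_mul (by norm_num), Real.rpow_natCast]
      ring) hlim
    rw [Real.dist_eq] at h
    simpa using h
  have hm := hav u hu hug x y r r hr (by linarith) le_rfl le_rfl
  have hx := hpt x
  have hy := hpt y
  have hcalc : K * (1 + 2 / (1 - q)) * G * r ^ α =
      K * G * r ^ α + (K * G * r ^ α / (1 - q) + K * G * r ^ α / (1 - q)) := by ring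
  rw [hcalc]
  rw [abs_le] at hm hx hy ⊢
  constructor <;> linarith [hm.1, hm.2, hx.1, hx.2, hy.1, hy.2]

end Carnot

namespace Carnot

variable {N : ℕ} {𝔾 : StratifiedGroup N} {ρ : HomogeneousNorm 𝔾} {s p : ℝ}
  {Ω : Set (Fin N → ℝ)}

/-! ### The embedding of `X_0` into `L^∞` -/

theorem exists_notMem_of_isBounded (hN : 0 < N) (hΩb : Bornology.IsBounded Ω) :
    ∃ x, x ∉ Ω := by
  by_contra! h
  have : Nonempty (Fin N) := ⟨⟨0, hN⟩⟩
  have h1 : Ω = univ := eq_univ_of_forall h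
  rw [h1] at hΩb
  exact NormedSpace.unbounded_univ ℝ (Fin N → ℝ) hΩb

/-- Morrey's inequality is applied between x and a fixed point outside Ω, where test functions
vanish; the distance to that point is bounded on Ω. -/
theorem IsTestFunction.exists_abs_le (ρ : HomogeneousNorm 𝔾) (hN : 0 < N) (hs : 0 ≤ s) (hp : 1 ≤ p)
    (hsp : (𝔾.Q : ℝ) < s * p) (hΩb : Bornology.IsBounded Ω) :
    ∃ C ≥ 0, ∀ φ, IsTestFunction Ω φ → gagliardo ρ s p φ < ⊤ → ∀ x,
      |φ x| ≤ C * (gagliardo ρ s p φ).toReal := by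
  obtain ⟨K, hK, hM⟩ := exists_abs_sub_le_dist_rpow ρ hs hp hsp
  obtain ⟨x₁, hx₁⟩ := exists_notMem_of_isBounded hN hΩb
  have hα : 0 < s - 𝔾.Q / p := by
    rw [sub_pos, div_lt_iff₀ (by linarith)]; exact hsp
  obtain ⟨B, hB⟩ := (hΩb.isCompact_closure.image (ρ.continuous_dist_left x₁)).isBounded.bddAbove
  have hB' : ∀ x ∈ Ω, ρ.dist x x₁ ≤ max B 0 := fun x hx => by
    rw [ρ.dist_comm]
    exact (hB ⟨x, subset_closure hx, rfl⟩).trans (le_max_left _ _)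
  refine ⟨K * max B 0 ^ (s - 𝔾.Q / p), by positivity, fun φ hφ hg x => ?_⟩
  by_cases hx : x ∈ Ω
  · have h1 := hM φ hφ.1.continuous hg x x₁
    rw [hφ.eq_zero hx₁, sub_zero] at h1
    refine h1.trans ?_
    rw [mul_right_comm]
    gcongr
    · exact ρ.dist_nonneg _ _
    · exact hB' x hx
  · rw [hφ.eq_zero hx, abs_zero]
    positivity

/-- An element of `X_0` is an almost everywhere limit of test functions that also converge to it in
the seminorm. -/
theorem MemX0.exists_seq (hp : 1 ≤ p) {u : (Fin N → ℝ) → ℝ} (hu : MemX0 ρ s p Ω u) :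
    ∃ φ : ℕ → (Fin N → ℝ) → ℝ, (∀ n, IsTestFunction Ω (φ n)) ∧
      (∀ n, gagliardo ρ s p (φ n) < ⊤) ∧
      Tendsto (fun n => gagliardo ρ s p (u - φ n)) atTop (𝓝 0) ∧
      ∀ᵐ x, Tendsto (fun n => φ n x) atTop (𝓝 (u x)) := by
  have hpos : ∀ n : ℕ, (0 : ℝ≥0∞) < ((n : ℝ≥0∞) + 1)⁻¹ := fun n => by simp
  choose φ hφ hX hL hG using fun n : ℕ => hu.exists_testFunction hp (hpos n)
  have hlim : Tendsto (fun n : ℕ => ((n : ℝ≥0∞) + 1)⁻¹) atTop (𝓝 0) := by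
    have := (tendsto_add_atTop_iff_nat 1).mpr ENNReal.tendsto_inv_nat_nhds_zero
    simpa using this
  have h1 : Tendsto (fun n => eLpNorm (φ n - u) (ENNReal.ofReal p) volume) atTop (𝓝 0) := by
    refine tendsto_of_tendsto_of_tendsto_of_le_of_le tendsto_const_nhds hlim
      (fun _ => zero_le) fun n => ?_
    simp only
    rw [eLpNorm_sub_comm]
    exact (hL n).le
  have h2 := tendstoInMeasure_of_tendsto_eLpNorm (by simp; linarith)
    (fun n => ((hφ n).memLp 1).1) hu.1.1.1 h1
  obtain ⟨ns, hns, hae⟩ := h2.exists_seq_tendsto_ae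
  refine ⟨fun n => φ (ns n), fun n => hφ _, fun n => (hX _).1.2, ?_, hae⟩
  exact (tendsto_of_tendsto_of_tendsto_of_le_of_le tendsto_const_nhds hlim
      (fun _ => zero_le) fun n => (hG n).le).comp hns.tendsto_atTop

theorem gagliardo_le_add_sub (hp : 1 ≤ p) {u v : (Fin N → ℝ) → ℝ}
    (hu : AEStronglyMeasurable u volume) (hv : AEStronglyMeasurable v volume) :
    gagliardo ρ s p v ≤ gagliardo ρ s p u + gagliardo ρ s p (u - v) := by
  have h : v = u - (u - v) := by ext; simp
  conv_lhs => rw [h]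
  exact gagliardo_sub_le hp hu (hu.sub hv)

/-- The uniform bound for test functions passes to almost everywhere limits, since the seminorm of
φ_n is at most that of u plus that of u − φ_n, which tends to 0. -/
theorem MemX0.exists_normLinf_le (ρ : HomogeneousNorm 𝔾) (hN : 0 < N) (hs : 0 ≤ s) (hp : 1 ≤ p)
    (hsp : (𝔾.Q : ℝ) < s * p) (hΩb : Bornology.IsBounded Ω) :
    ∃ C : ℝ, 0 ≤ C ∧ ∀ u, MemX0 ρ s p Ω u →
      normLinf Ω u ≤ ENNReal.ofReal C * gagliardo ρ s p u := by
  obtain ⟨C, hC, h⟩ := IsTestFunction.exists_abs_le ρ hN hs hp hsp hΩb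
  refine ⟨C, hC, fun u hu => ?_⟩
  obtain ⟨φ, hφ, hg, hG, hae⟩ := hu.exists_seq hp
  have hb : ∀ᵐ x, ‖u x‖ₑ ≤ ENNReal.ofReal C * gagliardo ρ s p u := by
    filter_upwards [hae] with x hx
    have h1 : Tendsto (fun n => ENNReal.ofReal C *
        (gagliardo ρ s p u + gagliardo ρ s p (u - φ n))) atTop
        (𝓝 (ENNReal.ofReal C * (gagliardo ρ s p u + 0))) :=
      ENNReal.Tendsto.const_mul (tendsto_const_nhds.add hG) (Or.inr ENNReal.ofReal_ne_top)
    rw [add_zero] at h1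
    refine le_of_tendsto_of_tendsto hx.enorm h1 (Eventually.of_forall fun n => ?_)
    have h2 := h (φ n) (hφ n) (hg n) x
    calc ‖φ n x‖ₑ = ENNReal.ofReal |φ n x| := Real.enorm_eq_ofReal_abs _
      _ ≤ ENNReal.ofReal (C * (gagliardo ρ s p (φ n)).toReal) := ENNReal.ofReal_le_ofReal h2
      _ = ENNReal.ofReal C * gagliardo ρ s p (φ n) := by
          rw [ENNReal.ofReal_mul hC, ENNReal.ofReal_toReal (hg n).ne]
      _ ≤ _ := by
          exact mul_le_mul' le_rfl (gagliardo_le_add_sub hp hu.1.1.1 ((hφ n).memLp 1).1)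
  rw [normLinf, eLpNorm_exponent_top]
  exact eLpNormEssSup_le_of_ae_enorm_bound (ae_restrict_of_ae hb)

theorem constL_lt_top (ρ : HomogeneousNorm 𝔾) (hN : 0 < N) (hs : 0 ≤ s) (hp : 1 ≤ p)
    (hsp : (𝔾.Q : ℝ) < s * p) (hΩb : Bornology.IsBounded Ω) : constL ρ s p Ω < ⊤ := by
  obtain ⟨C, -, h⟩ := MemX0.exists_normLinf_le ρ hN hs hp hsp hΩb
  refine lt_of_le_of_lt (iSup₂_le fun u hu => ?_) (ENNReal.ofReal_lt_top (r := C))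
  exact ENNReal.div_le_of_le_mul (h u hu.1)

/-- The supremum defining L says nothing when u vanishes almost everywhere, and the quotient cannot
be cleared when the seminorm is 0. In the latter case the embedding already forces the sup norm to
vanish. -/
theorem MemX0.normLinf_le (hN : 0 < N) (hs : 0 ≤ s) (hp : 1 ≤ p)
    (hsp : (𝔾.Q : ℝ) < s * p) (hΩb : Bornology.IsBounded Ω) {u : (Fin N → ℝ) → ℝ}
    (hu : MemX0 ρ s p Ω u) : normLinf Ω u ≤ constL ρ s p Ω * gagliardo ρ s p u := by
  by_cases h0 : u =ᵐ[volume] 0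
  · rw [normLinf, eLpNorm_congr_ae (ae_restrict_of_ae h0)]
    simp
  by_cases hg : gagliardo ρ s p u = 0
  · obtain ⟨C, -, h⟩ := MemX0.exists_normLinf_le ρ hN hs hp hsp hΩb
    have := h u hu
    rw [hg, mul_zero] at this
    exact this.trans zero_le
  · exact (ENNReal.div_le_iff_le_mul (Or.inl hg) (Or.inl hu.1.2.ne)).mp
      (le_iSup₂ (f := fun (u : (Fin N → ℝ) → ℝ) (_ : MemX0 ρ s p Ω u ∧ ¬ (u =ᵐ[volume] 0)) =>
        normLinf Ω u / gagliardo ρ s p u) u ⟨hu, h0⟩)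

/-! ### Compactness -/

/-- Fatou's lemma for the difference quotients, which converge almost everywhere on the product
space. -/
theorem gagliardo_le_liminf (hp : 0 < p) {u : (Fin N → ℝ) → ℝ} {v : ℕ → (Fin N → ℝ) → ℝ}
    (hv : ∀ n, AEStronglyMeasurable (v n) volume)
    (h : ∀ᵐ x, Tendsto (fun n => v n x) atTop (𝓝 (u x))) :
    gagliardo ρ s p u ≤ liminf (fun n => gagliardo ρ s p (v n)) atTop := by
  simp only [gagliardo_eq_eLpNorm hp]
  refine Lp.eLpNorm_lim_le_liminf_eLpNorm (fun n => aestronglyMeasurable_diffQuot (hv n)) _ ?_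
  filter_upwards [ae_prod_of_ae h] with z hz
  exact (hz.1.sub hz.2).div_const _

/-- A sequence of functions that is bounded and equi-Hölder for the homogeneous distance has a
pointwise convergent subsequence. -/
theorem exists_subseq_tendsto_of_equiHolder {f : ℕ → (Fin N → ℝ) → ℝ} {B K α : ℝ} (hα : 0 < α)
    (hB : ∀ n x, |f n x| ≤ B) (hK : ∀ n x y, |f n x - f n y| ≤ K * ρ.dist x y ^ α) :
    ∃ (ns : ℕ → ℕ) (u : (Fin N → ℝ) → ℝ), StrictMono ns ∧ Continuous u ∧
      ∀ x, Tendsto (fun n => f (ns n) x) atTop (𝓝 (u x)) := by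
  set d := TopologicalSpace.denseSeq (Fin N → ℝ)
  have hd : DenseRange d := TopologicalSpace.denseRange_denseSeq _
  have hcpt : IsCompact (Set.pi univ fun _ : ℕ => Icc (-B) B) :=
    isCompact_univ_pi fun _ => isCompact_Icc
  obtain ⟨a, -, ns, hns, ha⟩ := hcpt.tendsto_subseq (x := fun n j => f n (d j))
    fun n j _ => abs_le.mp (hB n (d j))
  have hdist : ∀ x, Tendsto (fun y => K * ρ.dist x y ^ α) (𝓝 x) (𝓝 0) := by
    intro x
    have h1 := (ρ.continuous_dist_left x).tendsto x
    rw [ρ.dist_self] at h1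
    have h2 := ((Real.continuousAt_rpow_const 0 α (Or.inr hα.le)).tendsto.comp h1).const_mul K
    rw [Real.zero_rpow hα.ne', mul_zero] at h2
    exact h2
  have hlim : ∀ x, ∃ l, Tendsto (fun n => f (ns n) x) atTop (𝓝 l) := by
    intro x
    refine cauchySeq_tendsto_of_complete (Metric.cauchySeq_iff'.mpr fun ε hε => ?_)
    -- Two Hölder errors and one Cauchy error, each below ε / 4, add up to less than ε.
    have hU : {y | K * ρ.dist x y ^ α < ε / 4} ∈ 𝓝 x :=
      (hdist x).eventually (gt_mem_nhds (by linarith))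
    obtain ⟨j, hj⟩ := hd.exists_mem_open isOpen_interior ⟨x, mem_interior_iff_mem_nhds.mpr hU⟩
    have hjU : d j ∈ {y | K * ρ.dist x y ^ α < ε / 4} := interior_subset hj
    have hj' : K * ρ.dist x (d j) ^ α < ε / 4 := hjU
    have hc : CauchySeq fun n => f (ns n) (d j) := ((tendsto_pi_nhds.mp ha) j).cauchySeq
    obtain ⟨n₀, hn₀⟩ := Metric.cauchySeq_iff'.mp hc (ε / 4) (by linarith)
    refine ⟨n₀, fun n hn => ?_⟩
    have h1 := hn₀ n hn
    rw [Real.dist_eq] at h1 ⊢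
    have h2 := hK (ns n) x (d j)
    have h3 := hK (ns n₀) x (d j)
    rw [abs_lt] at h1 ⊢
    rw [abs_le] at h2 h3
    constructor <;> linarith [h1.1, h1.2, h2.1, h2.2, h3.1, h3.2]
  choose u hu using hlim
  refine ⟨ns, u, hns, ?_, hu⟩
  rw [continuous_iff_continuousAt]
  intro x
  have h1 : ∀ y, |u y - u x| ≤ K * ρ.dist x y ^ α := fun y => by
    refine le_of_tendsto ((hu y).sub (hu x)).abs (Eventually.of_forall fun n => ?_)
    rw [abs_sub_comm]
    exact hK _ _ _
  rw [ContinuousAt, tendsto_iff_dist_tendsto_zero]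
  exact squeeze_zero (fun _ => dist_nonneg) (fun y => by rw [Real.dist_eq]; exact h1 y) (hdist x)

/-- A sequence bounded in `X_0` has a subsequence that converges almost everywhere to a continuous
function vanishing outside `Ω`. -/
theorem exists_subseq_tendsto_ae (hN : 0 < N) (hs : 0 ≤ s) (hp : 1 ≤ p)
    (hsp : (𝔾.Q : ℝ) < s * p) (hΩb : Bornology.IsBounded Ω) {v : ℕ → (Fin N → ℝ) → ℝ} {R : ℝ≥0∞}
    (hR : R ≠ ⊤) (hv : ∀ n, MemX0 ρ s p Ω (v n)) (hvR : ∀ n, gagliardo ρ s p (v n) ≤ R) :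
    ∃ (ns : ℕ → ℕ) (u : (Fin N → ℝ) → ℝ), StrictMono ns ∧ Continuous u ∧ (∀ x ∉ Ω, u x = 0) ∧
      ∀ᵐ x, Tendsto (fun n => v (ns n) x) atTop (𝓝 (u x)) := by
  have hpos : ∀ n : ℕ, (0 : ℝ≥0∞) < ((n : ℝ≥0∞) + 1)⁻¹ := fun n => by simp
  -- The v_n are determined only almost everywhere, so the pointwise Hölder bounds are applied to
  -- test functions φ_n that approach them in norm.
  choose φ hφ hX hL hG using fun n : ℕ => (hv n).exists_testFunction hp (hpos n)
  have hlim : Tendsto (fun n : ℕ => ((n : ℝ≥0∞) + 1)⁻¹) atTop (𝓝 0) := by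
    have := (tendsto_add_atTop_iff_nat 1).mpr ENNReal.tendsto_inv_nat_nhds_zero
    simpa using this
  have hφR : ∀ n, gagliardo ρ s p (φ n) ≤ R + 1 := fun n => by
    refine (gagliardo_le_add_sub hp (hv n).1.1.1 ((hφ n).memLp 1).1).trans ?_
    gcongr
    · exact hvR n
    · exact (hG n).le.trans (by simp)
  have hφR' : ∀ n, (gagliardo ρ s p (φ n)).toReal ≤ (R + 1).toReal := fun n =>
    ENNReal.toReal_mono (by simp [hR]) (hφR n)
  obtain ⟨C, hC, hb⟩ := IsTestFunction.exists_abs_le ρ hN hs hp hsp hΩb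
  obtain ⟨K, hK, hM⟩ := exists_abs_sub_le_dist_rpow ρ hs hp hsp
  have hα : 0 < s - 𝔾.Q / p := by
    rw [sub_pos, div_lt_iff₀ (by linarith)]; exact hsp
  obtain ⟨ns, u, hns, hu, hlimu⟩ := exists_subseq_tendsto_of_equiHolder (ρ := ρ)
    (B := C * (R + 1).toReal) (K := K * (R + 1).toReal) hα
    (fun n x => (hb (φ n) (hφ n) (hX n).1.2 x).trans (mul_le_mul_of_nonneg_left (hφR' n) hC))
    (fun n x y => (hM (φ n) (hφ n).1.continuous (hX n).1.2 x y).trans 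
      (mul_le_mul_of_nonneg_right (mul_le_mul_of_nonneg_left (hφR' n) hK)
        (Real.rpow_nonneg (ρ.dist_nonneg x y) _)))
  have h1 : Tendsto (fun n => eLpNorm ((v (ns n) - φ (ns n)) - 0) (ENNReal.ofReal p) volume)
      atTop (𝓝 0) := by
    refine tendsto_of_tendsto_of_tendsto_of_le_of_le tendsto_const_nhds
      (hlim.comp hns.tendsto_atTop) (fun _ => zero_le) fun n => ?_
    simp only [sub_zero]
    exact (hL _).le
  -- The L^p smallness of v_n − φ_n gives, along a further subsequence, almost everywhere
  -- convergence to 0, so the limit of the φ_n is also that of the v_n.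
  have h2 := tendstoInMeasure_of_tendsto_eLpNorm (by simp; linarith)
    (fun n => (hv (ns n)).1.1.1.sub ((hφ (ns n)).memLp 1).1) aestronglyMeasurable_const h1
  obtain ⟨ms, hms, hae⟩ := h2.exists_seq_tendsto_ae
  refine ⟨ns ∘ ms, u, hns.comp hms, hu, fun x hx => ?_, ?_⟩
  · refine tendsto_nhds_unique (hlimu x) ?_
    simp [(hφ _).eq_zero hx]
  · filter_upwards [hae] with x hx
    have hx' : Tendsto (fun i => (v (ns (ms i)) - φ (ns (ms i))) x) atTop (𝓝 (0 : ℝ)) := hx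
    have h3 := hx'.add ((hlimu x).comp hms.tendsto_atTop)
    rw [zero_add] at h3
    exact h3.congr fun n => by simp

theorem memLp_of_eq_zero_off (hΩb : Bornology.IsBounded Ω) {u : (Fin N → ℝ) → ℝ}
    (hu : Continuous u) (h0 : ∀ x ∉ Ω, u x = 0) (q : ℝ≥0∞) : MemLp u q volume :=
  hu.memLp_of_hasCompactSupport (HasCompactSupport.intro hΩb.isCompact_closure fun x hx =>
    h0 x fun h => hx (subset_closure h))

end Carnot

namespace Carnot

/-! ### Strong convergence in `L^p` from almost everywhere convergence -/

/-- Fatou's lemma is applied to 2^(p−1) (|f_n|^p + |g|^p) − |f_n − g|^p, nonnegative by convexity.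
Its limit has integral c = 2^p ∫ |g|^p, while the norm bound keeps the sum of its integral and that
of |f_n − g|^p below c. The smoothing operations used later do not increase norms, so the bound
costs nothing. -/
theorem tendsto_lintegral_rpow_sub_zero {α : Type*} [MeasurableSpace α] {μ : Measure α} {p : ℝ}
    (hp : 1 ≤ p) {f : ℕ → α → ℝ} {g : α → ℝ} (hf : ∀ n, AEStronglyMeasurable (f n) μ)
    (hg : AEStronglyMeasurable g μ) (hgt : ∫⁻ x, ‖g x‖ₑ ^ p ∂μ ≠ ⊤)
    (hle : ∀ n, ∫⁻ x, ‖f n x‖ₑ ^ p ∂μ ≤ ∫⁻ x, ‖g x‖ₑ ^ p ∂μ)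
    (hlim : ∀ᵐ x ∂μ, Tendsto (fun n => f n x) atTop (𝓝 (g x))) :
    Tendsto (fun n => ∫⁻ x, ‖f n x - g x‖ₑ ^ p ∂μ) atTop (𝓝 0) := by
  have hp0 : 0 < p := by linarith
  set A := ∫⁻ x, ‖g x‖ₑ ^ p ∂μ
  set k : ℝ≥0∞ := 2 ^ (p - 1)
  have hk : k ≠ ⊤ := ENNReal.rpow_ne_top_of_nonneg (by linarith) (by simp)
  set c := k * (A + A)
  have hc : c ≠ ⊤ := ENNReal.mul_ne_top hk (ENNReal.add_ne_top.mpr ⟨hgt, hgt⟩)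
  have hfe : ∀ n, AEMeasurable (fun x => ‖f n x‖ₑ ^ p) μ := fun n => (hf n).enorm.pow_const p
  have hge : AEMeasurable (fun x => ‖g x‖ₑ ^ p) μ := hg.enorm.pow_const p
  have hde : ∀ n, AEMeasurable (fun x => ‖f n x - g x‖ₑ ^ p) μ := fun n =>
    ((hf n).sub hg).enorm.pow_const p
  have hpt : ∀ n x, ‖f n x - g x‖ₑ ^ p ≤ k * (‖f n x‖ₑ ^ p + ‖g x‖ₑ ^ p) := fun n x =>
    (ENNReal.rpow_le_rpow enorm_sub_le hp0.le).trans
      (ENNReal.rpow_add_le_mul_rpow_add_rpow _ _ hp)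
  set h : ℕ → α → ℝ≥0∞ := fun n x => k * (‖f n x‖ₑ ^ p + ‖g x‖ₑ ^ p) - ‖f n x - g x‖ₑ ^ p
  have hhm : ∀ n, AEMeasurable (h n) μ := fun n =>
    (((hfe n).add hge).const_mul k).sub (hde n)
  have hsum : ∀ n, ∫⁻ x, h n x ∂μ + ∫⁻ x, ‖f n x - g x‖ₑ ^ p ∂μ ≤ c := fun n => by
    rw [← lintegral_add_left' (hhm n)]
    have : ∀ x, h n x + ‖f n x - g x‖ₑ ^ p = k * (‖f n x‖ₑ ^ p + ‖g x‖ₑ ^ p) := fun x =>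
      tsub_add_cancel_of_le (hpt n x)
    simp only [this]
    have hadd : AEMeasurable (fun x => ‖f n x‖ₑ ^ p + ‖g x‖ₑ ^ p) μ := (hfe n).add hge
    rw [lintegral_const_mul'' _ hadd, lintegral_add_left' (hfe n)]
    exact mul_le_mul' le_rfl (add_le_add (hle n) le_rfl)
  have hhlim : ∀ᵐ x ∂μ, Tendsto (fun n => h n x) atTop
      (𝓝 (k * (‖g x‖ₑ ^ p + ‖g x‖ₑ ^ p))) := by
    filter_upwards [hlim] with x hx
    have h1 : Tendsto (fun n => ‖f n x‖ₑ ^ p) atTop (𝓝 (‖g x‖ₑ ^ p)) :=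
      (ENNReal.continuous_rpow_const.tendsto _).comp hx.enorm
    have h2 : Tendsto (fun n => ‖f n x - g x‖ₑ ^ p) atTop (𝓝 0) := by
      have h3 := (hx.sub_const (g x)).enorm
      rw [sub_self, enorm_zero] at h3
      have h4 := (ENNReal.continuous_rpow_const (y := p)).tendsto 0
      rw [ENNReal.zero_rpow_of_pos hp0] at h4
      exact h4.comp h3
    have h5 := ENNReal.Tendsto.sub
      (ENNReal.Tendsto.const_mul (h1.add_const (‖g x‖ₑ ^ p)) (Or.inr hk)) h2
      (Or.inr ENNReal.zero_ne_top)
    simpa using h5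
  have hfat : c ≤ liminf (fun n => ∫⁻ x, h n x ∂μ) atTop := by
    calc c = ∫⁻ x, k * (‖g x‖ₑ ^ p + ‖g x‖ₑ ^ p) ∂μ := by
          have hadd : AEMeasurable (fun x => ‖g x‖ₑ ^ p + ‖g x‖ₑ ^ p) μ := hge.add hge
          rw [lintegral_const_mul'' _ hadd, lintegral_add_left' hge]
      _ = ∫⁻ x, liminf (fun n => h n x) atTop ∂μ := by
          refine lintegral_congr_ae ?_
          filter_upwards [hhlim] with x hx
          exact hx.liminf_eq.symm
      _ ≤ _ := lintegral_liminf_le' hhm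
  rw [ENNReal.tendsto_nhds_zero]
  intro ε hε
  have hsub : ∀ n, ∫⁻ x, ‖f n x - g x‖ₑ ^ p ∂μ ≤ c - ∫⁻ x, h n x ∂μ := fun n => by
    have hfin : ∫⁻ x, h n x ∂μ ≠ ⊤ :=
      ne_top_of_le_ne_top hc (le_self_add.trans (hsum n))
    exact ENNReal.le_sub_of_add_le_left hfin (hsum n)
  rcases eq_or_ne c 0 with h0 | h0
  · refine Eventually.of_forall fun n => (hsub n).trans ?_
    simp [h0]
  · have hlt : c - ε < liminf (fun n => ∫⁻ x, h n x ∂μ) atTop :=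
      lt_of_lt_of_le (ENNReal.sub_lt_self hc h0 hε.ne') hfat
    filter_upwards [eventually_lt_of_lt_liminf hlt] with n hn
    refine (hsub n).trans (tsub_le_iff_left.mpr ?_)
    exact tsub_le_iff_right.mp hn.le

theorem tendsto_eLpNorm_sub_zero {α : Type*} [MeasurableSpace α] {μ : Measure α} {p : ℝ}
    (hp : 1 ≤ p) {f : ℕ → α → ℝ} {g : α → ℝ} (hf : ∀ n, AEStronglyMeasurable (f n) μ)
    (hg : MemLp g (ENNReal.ofReal p) μ)
    (hle : ∀ n, eLpNorm (f n) (ENNReal.ofReal p) μ ≤ eLpNorm g (ENNReal.ofReal p) μ)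
    (hlim : ∀ᵐ x ∂μ, Tendsto (fun n => f n x) atTop (𝓝 (g x))) :
    Tendsto (fun n => eLpNorm (f n - g) (ENNReal.ofReal p) μ) atTop (𝓝 0) := by
  have hp0 : 0 < p := by linarith
  have hE : ∀ F : α → ℝ, eLpNorm F (ENNReal.ofReal p) μ = (∫⁻ x, ‖F x‖ₑ ^ p ∂μ) ^ (1 / p) := by
    intro F
    rw [eLpNorm_eq_lintegral_rpow_enorm_toReal (by simpa using hp0) ENNReal.ofReal_ne_top,
      ENNReal.toReal_ofReal hp0.le]
  have h1p : 0 < 1 / p := by positivity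
  have h := tendsto_lintegral_rpow_sub_zero hp hf hg.1 (by
      have := hg.2
      rw [hE] at this
      intro h
      simp [h, hp0] at this) (fun n => by
      have := hle n
      rw [hE, hE] at this
      exact (ENNReal.rpow_le_rpow_iff h1p).mp this) hlim
  have h4 := (ENNReal.continuous_rpow_const (y := 1 / p)).tendsto 0
  rw [ENNReal.zero_rpow_of_pos h1p] at h4
  refine (h4.comp h).congr fun n => ?_
  rw [hE]
  rfl

/-- Averaging over a family of measure preserving maps does not increase the `L^p` norm. -/
theorem eLpNorm_integral_comp_le {H X : Type*} [MeasurableSpace H] [MeasurableSpace X]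
    {m : Measure H} [IsProbabilityMeasure m] {μ : Measure X} [SFinite μ] {p : ℝ} (hp : 1 ≤ p)
    {T : H → X → X} (hT : Measurable (Function.uncurry T)) (hTm : ∀ h, MeasurePreserving (T h) μ μ)
    {f : X → ℝ} (hf : Measurable f) :
    eLpNorm (fun x => ∫ h, f (T h x) ∂m) (ENNReal.ofReal p) μ ≤
      eLpNorm f (ENNReal.ofReal p) μ := by
  have hp0 : 0 < p := by linarith
  have hE : ∀ F : X → ℝ, eLpNorm F (ENNReal.ofReal p) μ = (∫⁻ x, ‖F x‖ₑ ^ p ∂μ) ^ (1 / p) := by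
    intro F
    rw [eLpNorm_eq_lintegral_rpow_enorm_toReal (by simpa using hp0) ENNReal.ofReal_ne_top,
      ENNReal.toReal_ofReal hp0.le]
  rw [hE, hE]
  refine ENNReal.rpow_le_rpow ?_ (by positivity)
  have hTx : ∀ x, Measurable fun h => T h x := fun x => hT.comp measurable_prodMk_right
  -- Jensen's inequality, in the form of monotonicity of L^p norms on a probability space.
  have hpt : ∀ x, ‖∫ h, f (T h x) ∂m‖ₑ ^ p ≤ ∫⁻ h, ‖f (T h x)‖ₑ ^ p ∂m := by
    intro x
    have h1 : ‖∫ h, f (T h x) ∂m‖ₑ ≤ eLpNorm (fun h => f (T h x)) (ENNReal.ofReal p) m := by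
      calc _ ≤ ∫⁻ h, ‖f (T h x)‖ₑ ∂m := enorm_integral_le_lintegral_enorm _
        _ = eLpNorm (fun h => f (T h x)) 1 m := eLpNorm_one_eq_lintegral_enorm.symm
        _ ≤ _ := eLpNorm_le_eLpNorm_of_exponent_le (by simpa using hp)
          (hf.comp (hTx x)).aestronglyMeasurable
    refine (ENNReal.rpow_le_rpow h1 hp0.le).trans (le_of_eq ?_)
    rw [eLpNorm_eq_lintegral_rpow_enorm_toReal (by simpa using hp0) ENNReal.ofReal_ne_top,
      ENNReal.toReal_ofReal hp0.le, ← ENNReal.rpow_mul, one_div_mul_cancel hp0.ne',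
      ENNReal.rpow_one]
  calc ∫⁻ x, ‖∫ h, f (T h x) ∂m‖ₑ ^ p ∂μ ≤ ∫⁻ x, ∫⁻ h, ‖f (T h x)‖ₑ ^ p ∂m ∂μ :=
        lintegral_mono hpt
    _ = ∫⁻ h, ∫⁻ x, ‖f (T h x)‖ₑ ^ p ∂μ ∂m := by
        refine lintegral_lintegral_swap (Measurable.aemeasurable ?_)
        exact ((hf.comp (hT.comp measurable_swap)).enorm).pow_const p
    _ = ∫⁻ _, ∫⁻ x, ‖f x‖ₑ ^ p ∂μ ∂m := by
        congr 1; ext1 h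
        exact (hTm h).lintegral_comp (f := fun x => ‖f x‖ₑ ^ p) (hf.enorm.pow_const p)
    _ = _ := by simp

variable {N : ℕ} {𝔾 : StratifiedGroup N} {ρ : HomogeneousNorm 𝔾} {s p : ℝ}
  {Ω : Set (Fin N → ℝ)}

/-! ### Mollification by left translations -/

/-- The average of the left translates of `v` with weight `η`. -/
def mollify (𝔾 : StratifiedGroup N) (η : ContDiffBump (0 : Fin N → ℝ)) (v : (Fin N → ℝ) → ℝ)
    (x : Fin N → ℝ) : ℝ :=
  ∫ h, η.normed volume h * v (𝔾.mul (𝔾.inv h) x)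

/-- The probability measure with the normalized bump function as its density. -/
def bumpMeasure (η : ContDiffBump (0 : Fin N → ℝ)) : Measure (Fin N → ℝ) :=
  volume.withDensity fun h => ENNReal.ofReal (η.normed volume h)

instance (η : ContDiffBump (0 : Fin N → ℝ)) : IsProbabilityMeasure (bumpMeasure η) := by
  refine ⟨?_⟩
  rw [bumpMeasure, withDensity_apply _ MeasurableSet.univ, Measure.restrict_univ,
    ← ofReal_integral_eq_lintegral_ofReal η.integrable_normed
      (Eventually.of_forall η.nonneg_normed), η.integral_normed, ENNReal.ofReal_one]

theorem integral_bumpMeasure (η : ContDiffBump (0 : Fin N → ℝ)) (f : (Fin N → ℝ) → ℝ) :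
    ∫ h, f h ∂bumpMeasure η = ∫ h, η.normed volume h * f h := by
  rw [bumpMeasure, integral_withDensity_eq_integral_toReal_smul
    (η.continuous_normed.measurable.ennreal_ofReal) (by simp)]
  simp [ENNReal.toReal_ofReal (η.nonneg_normed _)]

theorem mollify_eq (η : ContDiffBump (0 : Fin N → ℝ)) (v : (Fin N → ℝ) → ℝ) (x : Fin N → ℝ) :
    mollify 𝔾 η v x = ∫ h, v (𝔾.mul (𝔾.inv h) x) ∂bumpMeasure η :=
  (integral_bumpMeasure η _).symm

theorem StratifiedGroup.continuous_inv_mul (𝔾 : StratifiedGroup N) :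
    Continuous fun z : (Fin N → ℝ) × (Fin N → ℝ) => 𝔾.mul (𝔾.inv z.1) z.2 :=
  𝔾.continuous_mul.comp ((𝔾.continuous_inv.comp continuous_fst).prodMk continuous_snd)

theorem eLpNorm_mollify_le (hp : 1 ≤ p) (η : ContDiffBump (0 : Fin N → ℝ))
    {v : (Fin N → ℝ) → ℝ} (hv : Continuous v) :
    eLpNorm (mollify 𝔾 η v) (ENNReal.ofReal p) volume ≤ eLpNorm v (ENNReal.ofReal p) volume := by
  have h := eLpNorm_integral_comp_le (m := bumpMeasure η) (μ := volume) hp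
    (T := fun h x => 𝔾.mul (𝔾.inv h) x) 𝔾.continuous_inv_mul.measurable
    (fun h => 𝔾.measurePreserving_mul_left (𝔾.inv h)) hv.measurable
  simpa only [← mollify_eq] using h

theorem integrable_translate (η : ContDiffBump (0 : Fin N → ℝ)) {v : (Fin N → ℝ) → ℝ}
    (hv : Continuous v) (hvc : HasCompactSupport v) (x : Fin N → ℝ) :
    Integrable (fun h => v (𝔾.mul (𝔾.inv h) x)) (bumpMeasure η) := by
  obtain ⟨C, hC⟩ := hv.bounded_above_of_compact_support hvc
  refine Integrable.of_bound (C := C) ?_ (Eventually.of_forall fun h => hC _)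
  exact (hv.comp (𝔾.continuous_inv_mul.comp
    (by fun_prop : Continuous fun h : Fin N → ℝ => (h, x)))).aestronglyMeasurable

theorem measurable_diffQuot {v : (Fin N → ℝ) → ℝ} (hv : Continuous v) :
    Measurable (diffQuot ρ s p v) :=
  ((hv.comp continuous_fst).sub (hv.comp continuous_snd)).measurable.div (measurable_dist_rpow _)

/-- Left invariance of the distance makes the difference quotient of the average the average of the
diagonally translated difference quotients, and diagonal translations preserve the product measure.
-/
theorem gagliardo_mollify_le (hp : 1 ≤ p) (η : ContDiffBump (0 : Fin N → ℝ))
    {v : (Fin N → ℝ) → ℝ} (hv : Continuous v) (hvc : HasCompactSupport v) :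
    gagliardo ρ s p (mollify 𝔾 η v) ≤ gagliardo ρ s p v := by
  have hp0 : 0 < p := by linarith
  rw [gagliardo_eq_eLpNorm hp0, gagliardo_eq_eLpNorm hp0]
  have hT : Measurable (Function.uncurry fun (h : Fin N → ℝ)
      (z : (Fin N → ℝ) × (Fin N → ℝ)) => (𝔾.mul (𝔾.inv h) z.1, 𝔾.mul (𝔾.inv h) z.2)) := by
    refine Continuous.measurable (Continuous.prodMk ?_ ?_)
    · exact 𝔾.continuous_inv_mul.comp (continuous_fst.prodMk (continuous_fst.comp continuous_snd))
    · exact 𝔾.continuous_inv_mul.comp (continuous_fst.prodMk (continuous_snd.comp continuous_snd))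
  have h := eLpNorm_integral_comp_le (m := bumpMeasure η)
    (μ := (volume : Measure ((Fin N → ℝ) × (Fin N → ℝ)))) hp hT
    (fun h => (𝔾.measurePreserving_mul_left (𝔾.inv h)).prod
      (𝔾.measurePreserving_mul_left (𝔾.inv h))) (measurable_diffQuot (ρ := ρ) (s := s) (p := p) hv)
  refine le_trans (le_of_eq ?_) h
  congr 1
  ext1 z
  simp only [diffQuot, ρ.dist_mul_left]
  rw [integral_div, integral_sub (integrable_translate η hv hvc _)
    (integrable_translate η hv hvc _), mollify_eq, mollify_eq]

/-- The substitution h = x ∘ z⁻¹, measure preserving by invariance under inversion and left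
translation, moves the variable x from v to the smooth bump. -/
theorem mollify_eq_integral_mul (η : ContDiffBump (0 : Fin N → ℝ)) {v : (Fin N → ℝ) → ℝ}
    (hv : Continuous v) (x : Fin N → ℝ) :
    mollify 𝔾 η v x = ∫ z, v z * η.normed volume (𝔾.mul x (𝔾.inv z)) := by
  have hmp : MeasurePreserving (fun z => 𝔾.mul x (𝔾.inv z)) volume volume :=
    (𝔾.measurePreserving_mul_left x).comp 𝔾.measurePreserving_inv
  have hc : Continuous fun h => η.normed volume h * v (𝔾.mul (𝔾.inv h) x) :=
    η.continuous_normed.mul (hv.comp (𝔾.continuous_inv_mul.comp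
      (by fun_prop : Continuous fun h : Fin N → ℝ => (h, x))))
  have h := integral_map (μ := volume) hmp.measurable.aemeasurable hc.aestronglyMeasurable
  rw [hmp.map_eq] at h
  rw [mollify, h]
  congr 1; ext1 z
  rw [𝔾.mul_inv_rev, 𝔾.inv_inv, 𝔾.mul_assoc, 𝔾.inv_mul, 𝔾.mul_zero, mul_comm]

/-- The smooth kernel is turned into a convolution with parameter x, evaluated at 0; this is why `g`
contains −w. -/
theorem contDiff_mollify (η : ContDiffBump (0 : Fin N → ℝ)) {v : (Fin N → ℝ) → ℝ}
    (hv : Continuous v) (hvc : HasCompactSupport v) : ContDiff ℝ ∞ (mollify 𝔾 η v) := by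
  obtain ⟨R, hR⟩ := hvc.isCompact.isBounded.subset_closedBall (0 : Fin N → ℝ)
  -- The cutoff equals 1 on the support of v, so it leaves the integral unchanged while giving the
  -- kernel compact support in w uniformly in x.
  set χ : ContDiffBump (0 : Fin N → ℝ) := ⟨max R 1, max R 1 + 1, by positivity, by linarith⟩
  have hχ : ∀ z, v z ≠ 0 → χ z = 1 := fun z hz =>
    χ.one_of_mem_closedBall (Metric.closedBall_subset_closedBall (le_max_left R 1)
      (hR (subset_tsupport v hz)))
  set g : (Fin N → ℝ) → (Fin N → ℝ) → ℝ := fun x w =>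
    χ (-w) * η.normed volume (𝔾.mul x (𝔾.inv (-w)))
  have hg : ContDiff ℝ ∞ (Function.uncurry g) := by
    have h1 : ContDiff ℝ ∞ fun q : (Fin N → ℝ) × (Fin N → ℝ) => χ (-q.2) :=
      χ.contDiff.comp contDiff_snd.neg
    have h2 : ContDiff ℝ ∞ fun q : (Fin N → ℝ) × (Fin N → ℝ) => 𝔾.mul q.1 (𝔾.inv (-q.2)) :=
      𝔾.contDiff_mul.comp (contDiff_fst.prodMk (𝔾.contDiff_inv.comp contDiff_snd.neg))
    have h3 : ContDiff ℝ ∞ (η.normed volume) := η.contDiff_normed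
    exact h1.mul (h3.comp h2)
  have hconv := contDiffOn_convolution_right_with_param (μ := volume) (n := ⊤)
    (ContinuousLinearMap.mul ℝ ℝ) (f := v) (g := g) (s := univ)
    (k := Metric.closedBall 0 (max R 1 + 1)) isOpen_univ (isCompact_closedBall _ _)
    (fun x w _ hw => by
      have : χ (-w) = 0 := χ.zero_of_le_dist (by
        rw [Metric.mem_closedBall, not_le, dist_zero_right] at hw
        rw [dist_zero_right, norm_neg]
        exact hw.le)
      simp [g, this]) hv.locallyIntegrable (hg.contDiffOn)
  rw [univ_prod_univ, contDiffOn_univ] at hconv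
  have hcomp := hconv.comp (contDiff_id.prodMk (contDiff_const (c := (0 : Fin N → ℝ))))
  convert! hcomp using 1
  ext1 x
  rw [mollify_eq_integral_mul η hv]
  simp only [Function.comp_apply, convolution_def, ContinuousLinearMap.mul_apply', id]
  congr 1; ext1 z
  by_cases hz : v z = 0
  · simp [hz]
  · simp [g, hχ z hz]

theorem tsupport_mollify_subset (η : ContDiffBump (0 : Fin N → ℝ)) {v : (Fin N → ℝ) → ℝ}
    (hvc : HasCompactSupport v) :
    tsupport (mollify 𝔾 η v) ⊆
      (fun z : (Fin N → ℝ) × (Fin N → ℝ) => 𝔾.mul z.1 z.2) ''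
        (Metric.closedBall 0 η.rOut ×ˢ tsupport v) := by
  have hcpt : IsCompact ((fun z : (Fin N → ℝ) × (Fin N → ℝ) => 𝔾.mul z.1 z.2) ''
      (Metric.closedBall 0 η.rOut ×ˢ tsupport v)) :=
    ((isCompact_closedBall _ _).prod hvc.isCompact).image 𝔾.continuous_mul
  refine closure_minimal (fun x hx => ?_) hcpt.isClosed
  by_contra hx'
  refine hx (integral_eq_zero_of_ae (Eventually.of_forall fun h => ?_))
  simp only [Pi.zero_apply, mul_eq_zero]
  by_contra! hne
  refine hx' ⟨(h, 𝔾.mul (𝔾.inv h) x), ⟨?_, subset_tsupport v hne.2⟩, 𝔾.mul_inv_cancel_left h x⟩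
  have h1 : h ∈ Function.support (η.normed volume) := hne.1
  rw [η.support_normed_eq] at h1
  exact Metric.ball_subset_closedBall h1

theorem tendsto_mollify {η : ℕ → ContDiffBump (0 : Fin N → ℝ)}
    (hη : Tendsto (fun n => (η n).rOut) atTop (𝓝 0)) {v : (Fin N → ℝ) → ℝ} (hv : Continuous v)
    (x : Fin N → ℝ) : Tendsto (fun n => mollify 𝔾 (η n) v x) atTop (𝓝 (v x)) := by
  have hc : Continuous fun y : Fin N → ℝ => v (𝔾.mul (𝔾.inv (-y)) x) :=
    hv.comp (𝔾.continuous_inv_mul.comp (by fun_prop : Continuous fun h : Fin N → ℝ => (-h, x)))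
  have h := ContDiffBump.convolution_tendsto_right_of_continuous (μ := volume) hη hc 0
  simp only [neg_zero, 𝔾.inv_zero, 𝔾.zero_mul] at h
  refine h.congr fun n => ?_
  simp [convolution_def, mollify]

/-- Approximation by test functions in the norm of `X_0`. -/
theorem exists_testFunction_of_compactSupport (hp : 1 ≤ p) (hΩo : IsOpen Ω)
    {v : (Fin N → ℝ) → ℝ} (hv : Continuous v) (hvc : HasCompactSupport v) (hvΩ : tsupport v ⊆ Ω)
    (hg : gagliardo ρ s p v < ⊤) {ε : ℝ≥0∞} (hε : 0 < ε) :
    ∃ φ, IsTestFunction Ω φ ∧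
      eLpNorm (φ - v) (ENNReal.ofReal p) volume + gagliardo ρ s p (φ - v) < ε := by
  have hp0 : 0 < p := by linarith
  set η : ℕ → ContDiffBump (0 : Fin N → ℝ) := fun n =>
    ⟨1 / (2 * ((n : ℝ) + 1)), 1 / ((n : ℝ) + 1), by positivity, by gcongr; linarith⟩
  have hη : Tendsto (fun n => (η n).rOut) atTop (𝓝 0) := tendsto_one_div_add_atTop_nhds_zero_nat
  have hpt : ∀ x, Tendsto (fun n => mollify 𝔾 (η n) v x) atTop (𝓝 (v x)) := tendsto_mollify hη hv
  have hcm : ∀ n, Continuous (mollify 𝔾 (η n) v) := fun n => (contDiff_mollify _ hv hvc).continuous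
  have h1 := tendsto_eLpNorm_sub_zero hp (f := fun n => mollify 𝔾 (η n) v) (g := v) (μ := volume)
    (fun n => (hcm n).aestronglyMeasurable) (hv.memLp_of_hasCompactSupport hvc)
    (fun n => eLpNorm_mollify_le hp _ hv) (Eventually.of_forall hpt)
  have h2 := tendsto_eLpNorm_sub_zero hp
    (f := fun n => diffQuot ρ s p (mollify 𝔾 (η n) v)) (g := diffQuot ρ s p v) (μ := volume)
    (fun n => (measurable_diffQuot (hcm n)).aestronglyMeasurable)
    ⟨(measurable_diffQuot hv).aestronglyMeasurable, by rwa [← gagliardo_eq_eLpNorm hp0]⟩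
    (fun n => by
      rw [← gagliardo_eq_eLpNorm hp0, ← gagliardo_eq_eLpNorm hp0]
      exact gagliardo_mollify_le hp _ hv hvc)
    (Eventually.of_forall fun z => ((hpt z.1).sub (hpt z.2)).div_const _)
  simp only [← diffQuot_sub, ← gagliardo_eq_eLpNorm hp0] at h2
  have h3 := h1.add h2
  rw [add_zero] at h3
  -- The tube lemma at {0} × supp v: translating the compact support by elements near 0 keeps it in
  -- the open set Ω, which places the mollification among the test functions.
  obtain ⟨U, V, hU, -, h0U, hVV, hUV⟩ := generalized_tube_lemma (isCompact_singleton (x := 0))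
    hvc.isCompact (hΩo.preimage 𝔾.continuous_mul) (by
      rintro ⟨a, b⟩ ⟨ha, hb⟩
      simp only [mem_singleton_iff] at ha
      simp only [mem_preimage, ha, 𝔾.zero_mul]
      exact hvΩ hb)
  obtain ⟨δ, hδ, hδU⟩ := Metric.isOpen_iff.mp hU 0 (h0U rfl)
  obtain ⟨n, hn1, hn2⟩ := ((h3.eventually (gt_mem_nhds hε)).and
    (hη.eventually (gt_mem_nhds hδ))).exists
  have hts := tsupport_mollify_subset (𝔾 := 𝔾) (η n) hvc
  have hsub : (fun z : (Fin N → ℝ) × (Fin N → ℝ) => 𝔾.mul z.1 z.2) ''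
      (Metric.closedBall 0 (η n).rOut ×ˢ tsupport v) ⊆ Ω := by
    rintro _ ⟨⟨a, b⟩, ⟨ha, hb⟩, rfl⟩
    exact hUV ⟨hδU (Metric.closedBall_subset_ball hn2 ha), hVV hb⟩
  refine ⟨mollify 𝔾 (η n) v, ⟨contDiff_mollify _ hv hvc, ?_, hts.trans hsub⟩, hn1⟩
  exact (((isCompact_closedBall _ _).prod hvc.isCompact).image 𝔾.continuous_mul).of_isClosed_subset
    (isClosed_tsupport _) hts

/-! ### Continuous functions vanishing outside `Ω` belong to `X_0` -/

/-- The soft thresholding function. -/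
def softThreshold (δ a : ℝ) : ℝ := a - max (-δ) (min δ a)

theorem abs_softThreshold_sub_le (δ a b : ℝ) :
    |softThreshold δ a - softThreshold δ b| ≤ |a - b| := by
  unfold softThreshold
  rcases max_cases (-δ) (min δ a) with h1 | h1 <;> rcases max_cases (-δ) (min δ b) with h2 | h2 <;>
  rcases min_cases δ a with h3 | h3 <;> rcases min_cases δ b with h4 | h4 <;>
  rcases abs_cases (a - b) with h5 | h5 <;> rw [abs_le] <;> constructor <;> linarith

theorem softThreshold_zero {δ : ℝ} (hδ : 0 ≤ δ) : softThreshold δ 0 = 0 := by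
  simp [softThreshold, hδ]

theorem softThreshold_eq_zero {δ a : ℝ} (h : |a| ≤ δ) : softThreshold δ a = 0 := by
  rw [abs_le] at h
  simp [softThreshold, min_eq_right h.2, max_eq_right h.1]

theorem abs_softThreshold_sub_self_le {δ : ℝ} (hδ : 0 ≤ δ) (a : ℝ) :
    |softThreshold δ a - a| ≤ δ := by
  have : softThreshold δ a - a = -max (-δ) (min δ a) := by simp [softThreshold]
  rw [this, abs_neg, abs_le]
  exact ⟨le_max_left _ _, max_le (by linarith) (min_le_left _ _)⟩

theorem continuous_softThreshold (δ : ℝ) : Continuous (softThreshold δ) := by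
  unfold softThreshold; fun_prop

/-- No regularity of the boundary is needed. Soft thresholding at level δ moves the support into the
closed set {|u| ≥ δ}, contained in Ω. It is 1-Lipschitz and fixes 0, so neither |u| nor its
difference quotient increases; pointwise convergence then upgrades to convergence in both norms, and
each thresholded function can be mollified. -/
theorem memX0_of_continuous (hp : 1 ≤ p) (hΩo : IsOpen Ω) (hΩb : Bornology.IsBounded Ω)
    {u : (Fin N → ℝ) → ℝ} (hu : Continuous u) (h0 : ∀ x ∉ Ω, u x = 0)
    (hg : gagliardo ρ s p u < ⊤) : MemX0 ρ s p Ω u := by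
  have hp0 : 0 < p := by linarith
  have huL : MemLp u (ENNReal.ofReal p) volume := memLp_of_eq_zero_off hΩb hu h0 _
  refine ⟨⟨huL, hg⟩, ?_⟩
  set δ : ℕ → ℝ := fun n => 1 / ((n : ℝ) + 1)
  have hδ : ∀ n, 0 < δ n := fun n => by positivity
  have hδ0 : Tendsto δ atTop (𝓝 0) := tendsto_one_div_add_atTop_nhds_zero_nat
  set v : ℕ → (Fin N → ℝ) → ℝ := fun n x => softThreshold (δ n) (u x)
  have hvc : ∀ n, Continuous (v n) := fun n => (continuous_softThreshold _).comp hu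
  have hts : ∀ n, tsupport (v n) ⊆ {x | δ n ≤ |u x|} := fun n => by
    refine closure_minimal (fun x hx => ?_) (isClosed_le continuous_const hu.abs)
    by_contra h
    exact hx (softThreshold_eq_zero (not_le.mp h).le)
  have htΩ : ∀ n, tsupport (v n) ⊆ Ω := fun n x hx => by
    by_contra h
    have := hts n hx
    rw [mem_ofPred_eq, h0 x h, abs_zero] at this
    exact absurd this (not_le.mpr (hδ n))
  have hcs : ∀ n, HasCompactSupport (v n) := fun n =>
    hΩb.isCompact_closure.of_isClosed_subset (isClosed_tsupport _) ((htΩ n).trans subset_closure)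
  have hpt : ∀ x, Tendsto (fun n => v n x) atTop (𝓝 (u x)) := fun x => by
    rw [tendsto_iff_dist_tendsto_zero]
    exact squeeze_zero (fun _ => dist_nonneg)
      (fun n => abs_softThreshold_sub_self_le (hδ n).le (u x)) hδ0
  have hq : ∀ n z, ‖diffQuot ρ s p (v n) z‖ ≤ ‖diffQuot ρ s p u z‖ := fun n z => by
    rw [diffQuot, diffQuot, norm_div, norm_div]
    gcongr
    exact abs_softThreshold_sub_le (δ n) _ _
  have hgv : ∀ n, gagliardo ρ s p (v n) ≤ gagliardo ρ s p u := fun n => by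
    rw [gagliardo_eq_eLpNorm hp0, gagliardo_eq_eLpNorm hp0]
    exact eLpNorm_mono (hq n)
  have h1 := tendsto_eLpNorm_sub_zero hp (f := v) (g := u) (μ := volume)
    (fun n => (hvc n).aestronglyMeasurable) huL
    (fun n => eLpNorm_mono fun x => by
      have := abs_softThreshold_sub_le (δ n) (u x) 0
      rwa [softThreshold_zero (hδ n).le, sub_zero, sub_zero] at this)
    (Eventually.of_forall hpt)
  have h2 := tendsto_eLpNorm_sub_zero hp
    (f := fun n => diffQuot ρ s p (v n)) (g := diffQuot ρ s p u) (μ := volume)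
    (fun n => (measurable_diffQuot (hvc n)).aestronglyMeasurable)
    ⟨(measurable_diffQuot hu).aestronglyMeasurable, by rwa [← gagliardo_eq_eLpNorm hp0]⟩
    (fun n => eLpNorm_mono (hq n))
    (Eventually.of_forall fun z => ((hpt z.1).sub (hpt z.2)).div_const _)
  simp only [← diffQuot_sub, ← gagliardo_eq_eLpNorm hp0] at h2
  have hpos : ∀ n : ℕ, (0 : ℝ≥0∞) < ((n : ℝ≥0∞) + 1)⁻¹ := fun n => by simp
  have hlim : Tendsto (fun n : ℕ => ((n : ℝ≥0∞) + 1)⁻¹) atTop (𝓝 0) := by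
    have := (tendsto_add_atTop_iff_nat 1).mpr ENNReal.tendsto_inv_nat_nhds_zero
    simpa using this
  choose φ hφ hφv using fun n : ℕ => exists_testFunction_of_compactSupport (ρ := ρ) (s := s) hp hΩo
    (hvc n) (hcs n) (htΩ n) ((hgv n).trans_lt hg) (hpos n)
  refine ⟨φ, hφ, ?_⟩
  have hsum := (h1.add h2).add hlim
  simp only [add_zero] at hsum
  refine tendsto_of_tendsto_of_tendsto_of_le_of_le tendsto_const_nhds hsum
    (fun _ => zero_le) fun n => ?_
  have hdec : φ n - u = (φ n - v n) + (v n - u) := by ext; simp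
  have m1 : AEStronglyMeasurable (φ n - v n) volume :=
    ((hφ n).1.continuous.sub (hvc n)).aestronglyMeasurable
  have m2 : AEStronglyMeasurable (v n - u) volume := ((hvc n).sub hu).aestronglyMeasurable
  simp only
  rw [eLpNorm_sub_comm, gagliardo_sub_comm hp0, hdec]
  calc _ ≤ (eLpNorm (φ n - v n) (ENNReal.ofReal p) volume +
        eLpNorm (v n - u) (ENNReal.ofReal p) volume) +
        (gagliardo ρ s p (φ n - v n) + gagliardo ρ s p (v n - u)) :=
        add_le_add (eLpNorm_add_le m1 m2 (by simpa using hp)) (gagliardo_add_le hp m1 m2)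
    _ = (eLpNorm (v n - u) (ENNReal.ofReal p) volume + gagliardo ρ s p (v n - u)) +
        (eLpNorm (φ n - v n) (ENNReal.ofReal p) volume + gagliardo ρ s p (φ n - v n)) := by ring
    _ ≤ _ := by
        gcongr
        exact (hφv n).le

end Carnot

namespace Carnot

variable {N : ℕ} {𝔾 : StratifiedGroup N} {ρ : HomogeneousNorm 𝔾} {s p : ℝ}
  {Ω : Set (Fin N → ℝ)}

/-! ### The truncated cone -/

/-- The function equal to `1` on the ball of radius `R / 2` about `x₀`, to `0` off the ball of
radius `R`, and affine in the distance to `x₀` in between. -/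
def cone (ρ : HomogeneousNorm 𝔾) (x₀ : Fin N → ℝ) (R : ℝ) (x : Fin N → ℝ) : ℝ :=
  max 0 (min 1 (2 * (1 - ρ.dist x₀ x / R)))

variable {x₀ : Fin N → ℝ} {R : ℝ}

theorem cone_nonneg (x : Fin N → ℝ) : 0 ≤ cone ρ x₀ R x := le_max_left _ _

theorem cone_le_one (x : Fin N → ℝ) : cone ρ x₀ R x ≤ 1 :=
  max_le zero_le_one (min_le_left _ _)

theorem continuous_cone : Continuous (cone ρ x₀ R) :=
  continuous_const.max (continuous_const.min
    (continuous_const.mul (continuous_const.sub ((ρ.continuous_dist_left x₀).div_const R))))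

theorem cone_eq_one (hR : 0 < R) {x : Fin N → ℝ} (hx : ρ.dist x₀ x ≤ R / 2) :
    cone ρ x₀ R x = 1 := by
  have h : ρ.dist x₀ x / R ≤ 1 / 2 := by rw [div_le_iff₀ hR]; linarith
  rw [cone, min_eq_left (by linarith), max_eq_right zero_le_one]

theorem cone_eq_zero (hR : 0 < R) {x : Fin N → ℝ} (hx : R ≤ ρ.dist x₀ x) :
    cone ρ x₀ R x = 0 := by
  have h : 1 ≤ ρ.dist x₀ x / R := by rw [le_div_iff₀ hR]; linarith
  rw [cone, max_eq_left]
  exact (min_le_right _ _).trans (by linarith)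

theorem cone_le_of_le (hR : 0 < R) {x : Fin N → ℝ} (hx : ρ.dist x₀ x ≤ R) :
    cone ρ x₀ R x ≤ 2 * (R - ρ.dist x₀ x) / R := by
  have h : 2 * (R - ρ.dist x₀ x) / R = 2 * (1 - ρ.dist x₀ x / R) := by field_simp
  rw [h, cone]
  refine max_le ?_ (min_le_right _ _)
  have : ρ.dist x₀ x / R ≤ 1 := by rw [div_le_iff₀ hR]; linarith
  linarith

theorem one_sub_cone_le (hR : 0 < R) {x : Fin N → ℝ} (hx : R / 2 ≤ ρ.dist x₀ x) :
    1 - cone ρ x₀ R x ≤ 2 * (ρ.dist x₀ x - R / 2) / R := by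
  have h : 2 * (ρ.dist x₀ x - R / 2) / R = 1 - 2 * (1 - ρ.dist x₀ x / R) := by field_simp; ring
  have h1 : 1 / 2 ≤ ρ.dist x₀ x / R := by rw [le_div_iff₀ hR]; linarith
  rw [h, cone]
  have : 2 * (1 - ρ.dist x₀ x / R) ≤ max 0 (min 1 (2 * (1 - ρ.dist x₀ x / R))) := by
    rw [min_eq_right (by linarith)]; exact le_max_right _ _
  linarith

theorem abs_cone_sub_le (hR : 0 < R) (x y : Fin N → ℝ) :
    |cone ρ x₀ R x - cone ρ x₀ R y| ≤ 2 / R * ρ.dist x y := by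
  have h1 := ρ.dist_triangle x₀ x y
  have h2 := ρ.dist_triangle x₀ y x
  rw [ρ.dist_comm y x] at h2
  have h3 : |2 * (1 - ρ.dist x₀ x / R) - 2 * (1 - ρ.dist x₀ y / R)| ≤ 2 / R * ρ.dist x y := by
    have : 2 * (1 - ρ.dist x₀ x / R) - 2 * (1 - ρ.dist x₀ y / R) =
        2 / R * (ρ.dist x₀ y - ρ.dist x₀ x) := by ring
    rw [this, abs_mul, abs_of_pos (by positivity)]
    gcongr
    rw [abs_le]; constructor <;> linarith
  unfold cone
  refine le_trans (abs_max_sub_max_le_max _ _ _ _) ?_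
  rw [sub_self, abs_zero]
  refine max_le (by have := ρ.dist_nonneg x y; positivity) ?_
  refine le_trans (abs_min_sub_min_le_max _ _ _ _) ?_
  rw [sub_self, abs_zero]
  exact max_le (by have := ρ.dist_nonneg x y; positivity) h3

/-! ### The Gagliardo seminorm of the cone -/

/-- The density of the `p`-th power of the Gagliardo seminorm. -/
def gagliardoDensity (ρ : HomogeneousNorm 𝔾) (s p : ℝ) (u : (Fin N → ℝ) → ℝ)
    (z : (Fin N → ℝ) × (Fin N → ℝ)) : ℝ≥0∞ :=
  ENNReal.ofReal (|u z.1 - u z.2| ^ p / ρ.dist z.1 z.2 ^ ((𝔾.Q : ℝ) + p * s))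

theorem gagliardoDensity_swap (u : (Fin N → ℝ) → ℝ) (z : (Fin N → ℝ) × (Fin N → ℝ)) :
    gagliardoDensity ρ s p u z.swap = gagliardoDensity ρ s p u z := by
  simp only [gagliardoDensity, Prod.fst_swap, Prod.snd_swap]
  rw [abs_sub_comm, ρ.dist_comm]

theorem measurable_gagliardoDensity {u : (Fin N → ℝ) → ℝ} (hu : Continuous u) :
    Measurable (gagliardoDensity ρ s p u) := by
  have h1 : Measurable fun z : (Fin N → ℝ) × (Fin N → ℝ) => |u z.1 - u z.2| ^ p :=
    ((hu.comp continuous_fst).sub (hu.comp continuous_snd)).abs.measurable.pow_const p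
  exact (h1.div (measurable_dist_rpow _)).ennreal_ofReal

theorem setLIntegral_gagliardoDensity_swap {u : (Fin N → ℝ) → ℝ} (hu : Continuous u)
    {U V : Set (Fin N → ℝ)} (hU : MeasurableSet U) (hV : MeasurableSet V) :
    ∫⁻ z in U ×ˢ V, gagliardoDensity ρ s p u z = ∫⁻ z in V ×ˢ U, gagliardoDensity ρ s p u z := by
  have h := (Measure.measurePreserving_swap (μ := (volume : Measure (Fin N → ℝ)))
    (ν := (volume : Measure (Fin N → ℝ)))).setLIntegral_comp_preimage (hV.prod hU)
    (measurable_gagliardoDensity (ρ := ρ) (s := s) (p := p) hu)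
  rw [preimage_swap_prod] at h
  simp only [gagliardoDensity_swap] at h
  exact h

theorem setLIntegral_gagliardoDensity_le {u : (Fin N → ℝ) → ℝ} (hu : Continuous u)
    {U V : Set (Fin N → ℝ)} (hU : MeasurableSet U) {c : ℝ≥0∞}
    (h : ∀ x ∈ U, ∫⁻ y in V, gagliardoDensity ρ s p u (x, y) ≤ c) :
    ∫⁻ z in U ×ˢ V, gagliardoDensity ρ s p u z ≤ c * volume U := by
  have h1 : (volume : Measure ((Fin N → ℝ) × (Fin N → ℝ))).restrict (U ×ˢ V) =
      (volume.restrict U).prod (volume.restrict V) := (Measure.prod_restrict U V).symm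
  rw [h1, lintegral_prod _ (measurable_gagliardoDensity hu).aemeasurable]
  calc _ ≤ ∫⁻ _ in U, c := setLIntegral_mono' hU h
    _ = _ := setLIntegral_const _ _

/-- Lipschitz bound for the inner integral. -/
theorem setLIntegral_cone_le_of_dist_lt (hN : 0 < N) (hs1 : s < 1) (hp : 1 < p) (hR : 0 < R)
    (x : Fin N → ℝ) {V : Set (Fin N → ℝ)} (hV : MeasurableSet V)
    (hd : ∀ y ∈ V, ρ.dist x y < 2 * R) :
    ∫⁻ y in V, gagliardoDensity ρ s p (cone ρ x₀ R) (x, y) ≤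
      ENNReal.ofReal (2 ^ (p * (2 - s)) * R ^ (-(p * s)) / ((1 - s) * p)) * ρ.omega := by
  have hp0 : 0 < p := by linarith
  have ha : 0 < (1 - s) * p := mul_pos (by linarith) hp0
  set a := (1 - s) * p
  set F : ℝ → ℝ≥0∞ := (Iio (2 * R)).indicator fun t => ENNReal.ofReal (t ^ (a - 𝔾.Q))
  have hF : Measurable F := (by fun_prop : Measurable fun t : ℝ =>
    ENNReal.ofReal (t ^ (a - 𝔾.Q))).indicator measurableSet_Iio
  calc ∫⁻ y in V, gagliardoDensity ρ s p (cone ρ x₀ R) (x, y)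
      -- The Lipschitz constant 2 / R bounds the density by (2 / R)^p d^(p − ps − Q), which is
      -- integrable near the diagonal because s < 1.
      ≤ ∫⁻ y in V, ENNReal.ofReal ((2 / R) ^ p) * F (ρ.dist x y) := by
        refine setLIntegral_mono' hV fun y hy => ?_
        have hmem : ρ.dist x y ∈ Iio (2 * R) := hd y hy
        simp only [F, indicator_of_mem hmem, gagliardoDensity]
        rw [← ENNReal.ofReal_mul (by positivity)]
        refine ENNReal.ofReal_le_ofReal ?_
        rcases (ρ.dist_nonneg x y).eq_or_lt with h0 | h0
        · rw [ρ.eq_of_dist_eq_zero h0.symm, sub_self, abs_zero, Real.zero_rpow hp0.ne', zero_div,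
            ρ.dist_self]
          positivity
        · rw [div_le_iff₀ (by positivity), mul_assoc, ← Real.rpow_add h0,
            show a - 𝔾.Q + (𝔾.Q + p * s) = p by simp only [a]; ring,
            ← Real.mul_rpow (by positivity) h0.le]
          exact Real.rpow_le_rpow (abs_nonneg _) (abs_cone_sub_le hR x y) hp0.le
    _ ≤ ∫⁻ y, ENNReal.ofReal ((2 / R) ^ p) * F (ρ.dist x y) := setLIntegral_le_lintegral _ _
    _ = ENNReal.ofReal ((2 / R) ^ p) * (ENNReal.ofReal ((2 * R) ^ a / a) * ρ.omega) := by
        rw [lintegral_const_mul (f := fun y => F (ρ.dist x y)) _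
            (hF.comp (ρ.continuous_dist_left x).measurable),
          ρ.lintegral_dist x F hF, ρ.lintegral_rpow_lt hN ha (by positivity)]
    _ = _ := by
        rw [← mul_assoc, ← ENNReal.ofReal_mul (by positivity)]
        congr 2
        rw [Real.div_rpow (by norm_num) hR.le, Real.mul_rpow (by norm_num) hR.le,
          show p * (2 - s) = p + a by simp only [a]; ring, Real.rpow_add (by norm_num),
          show -(p * s) = a - p by simp only [a]; ring, Real.rpow_sub hR]
        field_simp

/-- Tail bound for the inner integral. -/
theorem setLIntegral_cone_le_of_le_dist (hN : 0 < N) (hs0 : 0 < s) (hs1 : s < 1) (hp : 1 < p)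
    (hR : 0 < R) (x : Fin N → ℝ) {V : Set (Fin N → ℝ)} (hV : MeasurableSet V) {h : ℝ} (hh : 0 ≤ h)
    (hhR : h ≤ R / 2) (hd : ∀ y ∈ V, h ≤ ρ.dist x y)
    (hw : ∀ y ∈ V, |cone ρ x₀ R x - cone ρ x₀ R y| ≤ 2 * h / R) :
    ∫⁻ y in V, gagliardoDensity ρ s p (cone ρ x₀ R) (x, y) ≤
      ENNReal.ofReal (2 ^ (p * s) * R ^ (-(p * s)) / (p * s)) * ρ.omega := by
  have hp0 : 0 < p := by linarith
  have hb : 0 < p * s := mul_pos hp0 hs0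
  -- For h = 0 the density vanishes, whereas the tail integral below requires a positive inner
  -- radius.
  rcases hh.eq_or_lt with h0 | h0
  · have hz : ∫⁻ y in V, gagliardoDensity ρ s p (cone ρ x₀ R) (x, y) = 0 := by
      rw [setLIntegral_congr_fun (g := fun _ => 0) hV fun y hy => ?_]
      · simp
      · have h1 := hw y hy
        rw [← h0, mul_zero, zero_div] at h1
        have h2 : |cone ρ x₀ R x - cone ρ x₀ R y| = 0 := le_antisymm h1 (abs_nonneg _)
        simp [gagliardoDensity, h2, Real.zero_rpow hp0.ne']
    rw [hz]
    exact zero_le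
  set F : ℝ → ℝ≥0∞ := (Ici h).indicator fun t => ENNReal.ofReal (t ^ (-(p * s) - 𝔾.Q))
  have hF : Measurable F := (by fun_prop : Measurable fun t : ℝ =>
    ENNReal.ofReal (t ^ (-(p * s) - 𝔾.Q))).indicator measurableSet_Ici
  calc ∫⁻ y in V, gagliardoDensity ρ s p (cone ρ x₀ R) (x, y)
      ≤ ∫⁻ y in V, ENNReal.ofReal ((2 * h / R) ^ p) * F (ρ.dist x y) := by
        refine setLIntegral_mono' hV fun y hy => ?_
        have hmem : ρ.dist x y ∈ Ici h := hd y hy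
        have hd0 : 0 < ρ.dist x y := lt_of_lt_of_le h0 (hd y hy)
        simp only [F, indicator_of_mem hmem, gagliardoDensity]
        rw [← ENNReal.ofReal_mul (by positivity)]
        refine ENNReal.ofReal_le_ofReal ?_
        rw [div_le_iff₀ (by positivity), mul_assoc, ← Real.rpow_add hd0,
          show -(p * s) - 𝔾.Q + (𝔾.Q + p * s) = 0 by ring, Real.rpow_zero, mul_one]
        exact Real.rpow_le_rpow (abs_nonneg _) (hw y hy) hp0.le
    _ ≤ ∫⁻ y, ENNReal.ofReal ((2 * h / R) ^ p) * F (ρ.dist x y) := setLIntegral_le_lintegral _ _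
    _ = ENNReal.ofReal ((2 * h / R) ^ p) *
        (ENNReal.ofReal (h ^ (-(p * s)) / (p * s)) * ρ.omega) := by
        rw [lintegral_const_mul (f := fun y => F (ρ.dist x y)) _
            (hF.comp (ρ.continuous_dist_left x).measurable),
          ρ.lintegral_dist x F hF, ρ.lintegral_rpow_ge hN hb h0]
    _ ≤ _ := by
        rw [← mul_assoc, ← ENNReal.ofReal_mul (by positivity)]
        gcongr
        rw [mul_div_assoc', div_le_div_iff_of_pos_right hb]
        -- The bound is proportional to h^(p − ps), increasing in h because s < 1, so it is largest
        -- at h = R / 2.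
        have e1 : (2 * h / R) ^ p * h ^ (-(p * s)) = (2 / R) ^ p * h ^ (p - p * s) := by
          rw [mul_div_right_comm, Real.mul_rpow (by positivity) h0.le, mul_assoc,
            ← Real.rpow_add h0, ← sub_eq_add_neg]
        have e2 : (2 : ℝ) ^ (p * s) * R ^ (-(p * s)) = (2 / R) ^ p * (R / 2) ^ (p - p * s) := by
          rw [Real.rpow_neg hR.le, ← div_eq_mul_inv, ← Real.div_rpow (by norm_num) hR.le,
            show R / 2 = (2 / R)⁻¹ by rw [inv_div], Real.inv_rpow (by positivity),
            ← Real.rpow_neg (by positivity), ← Real.rpow_add (by positivity)]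
          congr 1; ring
        rw [e1, e2]
        gcongr
        nlinarith

/-- Space splits into the inner ball I, the annulus A and the exterior O. Pairs inside I or inside O
contribute nothing. The block A × A is bounded through the Lipschitz estimate and gives the first
term of the constant. The four blocks pairing A with I or O each cost at most one tail bound times
|A|, whence 2^(2 + ps); the two blocks pairing I with O cost the same tail bound times |I|, whence
2^(1 + ps − Q). -/
theorem gagliardo_cone_rpow_le (hN : 0 < N) (hs0 : 0 < s) (hs1 : s < 1) (hp : 1 < p)
    (hR : 0 < R) : gagliardo ρ s p (cone ρ x₀ R) ^ p ≤
      ENNReal.ofReal (constC p 𝔾.Q s * R ^ ((𝔾.Q : ℝ) - p * s) / 𝔾.Q) * (ρ.omega * ρ.omega) := by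
  have hp0 : 0 < p := by linarith
  have hQ : (0 : ℝ) < 𝔾.Q := by exact_mod_cast 𝔾.Q_pos hN
  set w := cone ρ x₀ R
  have hw : Continuous w := continuous_cone
  set f := gagliardoDensity ρ s p w
  set I : Set (Fin N → ℝ) := {x | ρ.dist x₀ x < R / 2}
  set B : Set (Fin N → ℝ) := {x | ρ.dist x₀ x < R}
  set A : Set (Fin N → ℝ) := B \ I
  have hIm : MeasurableSet I := (ρ.isOpen_dist_lt x₀ _).measurableSet
  have hBm : MeasurableSet B := (ρ.isOpen_dist_lt x₀ _).measurableSet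
  have hAm : MeasurableSet A := hBm.diff hIm
  have hOm : MeasurableSet Bᶜ := hBm.compl
  have hIB : I ⊆ B := fun x (hx : ρ.dist x₀ x < R / 2) =>
    (by linarith : ρ.dist x₀ x < R)
  have hA1 : ∀ x ∈ A, R / 2 ≤ ρ.dist x₀ x := fun x hx => not_lt.mp hx.2
  have hA2 : ∀ x ∈ A, ρ.dist x₀ x < R := fun x hx => hx.1
  have hI1 : ∀ x ∈ I, ρ.dist x₀ x < R / 2 := fun x hx => hx
  have hO1 : ∀ x ∈ Bᶜ, R ≤ ρ.dist x₀ x := fun x hx => not_lt.mp hx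
  set S : Set (Fin N → ℝ) → Set (Fin N → ℝ) → ℝ≥0∞ := fun U V => ∫⁻ z in U ×ˢ V, f z
  set e := 2 ^ (p * s) * R ^ (-(p * s)) / (p * s) with he
  set l := 2 ^ (p * (2 - s)) * R ^ (-(p * s)) / ((1 - s) * p) with hl
  set E := ENNReal.ofReal e * ρ.omega
  set L := ENNReal.ofReal l * ρ.omega
  have hAA : S A A ≤ L * volume A := by
    refine setLIntegral_gagliardoDensity_le hw hAm fun x hx => ?_
    refine setLIntegral_cone_le_of_dist_lt hN hs1 hp hR x hAm fun y hy => ?_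
    have h1 := ρ.dist_triangle x x₀ y
    rw [ρ.dist_comm x x₀] at h1
    linarith [hA2 x hx, hA2 y hy]
  have hAI : S A I ≤ E * volume A := by
    refine setLIntegral_gagliardoDensity_le hw hAm fun x hx => ?_
    -- Here h is the excess of d(x₀, x) over R / 2: it bounds the distance to the inner ball from
    -- below and, up to the slope 2 / R, the deviation of the cone from 1.
    refine setLIntegral_cone_le_of_le_dist hN hs0 hs1 hp hR x hIm (h := ρ.dist x₀ x - R / 2)
      (by linarith [hA1 x hx]) (by linarith [hA2 x hx]) (fun y hy => ?_) fun y hy => ?_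
    · have h1 := ρ.dist_triangle x₀ y x
      rw [ρ.dist_comm y x] at h1
      linarith [hI1 y hy]
    · rw [cone_eq_one hR (hI1 y hy).le, abs_sub_comm, abs_of_nonneg (by
        linarith [cone_le_one (ρ := ρ) (x₀ := x₀) (R := R) x])]
      exact one_sub_cone_le hR (hA1 x hx)
  have hAO : S A Bᶜ ≤ E * volume A := by
    refine setLIntegral_gagliardoDensity_le hw hAm fun x hx => ?_
    refine setLIntegral_cone_le_of_le_dist hN hs0 hs1 hp hR x hOm (h := R - ρ.dist x₀ x)
      (by linarith [hA2 x hx]) (by linarith [hA1 x hx]) (fun y hy => ?_) fun y hy => ?_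
    · have h1 := ρ.dist_triangle x₀ x y
      linarith [hO1 y hy]
    · rw [cone_eq_zero hR (hO1 y hy), sub_zero, abs_of_nonneg (cone_nonneg x)]
      exact cone_le_of_le hR (hA2 x hx).le
  have hIBc : S I Bᶜ ≤ E * volume I := by
    refine setLIntegral_gagliardoDensity_le hw hIm fun x hx => ?_
    refine setLIntegral_cone_le_of_le_dist hN hs0 hs1 hp hR x hOm (h := R / 2)
      (by linarith) le_rfl (fun y hy => ?_) fun y hy => ?_
    · have h1 := ρ.dist_triangle x₀ x y
      linarith [hO1 y hy, hI1 x hx]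
    · rw [cone_eq_zero hR (hO1 y hy), cone_eq_one hR (hI1 x hx).le, sub_zero, abs_one]
      rw [le_div_iff₀ hR]; linarith
  have hzero : ∀ U : Set (Fin N → ℝ), MeasurableSet U → (∀ x ∈ U, ∀ y ∈ U, w x = w y) →
      S U U ≤ 0 := by
    intro U hU h
    refine (setLIntegral_gagliardoDensity_le (c := 0) hw hU fun x hx => ?_).trans (by simp)
    rw [setLIntegral_congr_fun (g := fun _ => 0) hU fun y hy => ?_]
    · simp
    · simp [gagliardoDensity, h x hx y hy, Real.zero_rpow hp0.ne']
  have hII : S I I ≤ 0 := hzero I hIm fun x hx y hy => by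
    simp only [w]
    rw [cone_eq_one hR (hI1 x hx).le, cone_eq_one hR (hI1 y hy).le]
  have hOO : S Bᶜ Bᶜ ≤ 0 := hzero Bᶜ hOm fun x hx y hy => by
    simp only [w]
    rw [cone_eq_zero hR (hO1 x hx), cone_eq_zero hR (hO1 y hy)]
  have hsw : ∀ U V : Set (Fin N → ℝ), MeasurableSet U → MeasurableSet V → S U V = S V U :=
    fun U V hU hV => setLIntegral_gagliardoDensity_swap hw hU hV
  have hcov : (univ : Set (Fin N → ℝ)) = A ∪ (I ∪ Bᶜ) := by
    ext x
    simp only [mem_univ, mem_union, A, Set.mem_sdiff, mem_compl_iff, true_iff]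
    tauto
  have hS1 : ∀ U V W : Set (Fin N → ℝ), S U (V ∪ W) ≤ S U V + S U W := fun U V W => by
    simp only [S, prod_union]
    exact lintegral_union_le _ _ _
  have hS2 : ∀ U V W : Set (Fin N → ℝ), S (U ∪ V) W ≤ S U W + S V W := fun U V W => by
    simp only [S, union_prod]
    exact lintegral_union_le _ _ _
  have hS3 : ∀ U : Set (Fin N → ℝ), S U univ ≤ S U A + (S U I + S U Bᶜ) := fun U => by
    rw [hcov]
    exact (hS1 _ _ _).trans (add_le_add le_rfl (hS1 _ _ _))
  have htot : gagliardo ρ s p w ^ p ≤ S A univ + (S I univ + S Bᶜ univ) := by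
    have h1 : gagliardo ρ s p w ^ p = S univ univ := by
      rw [gagliardo_rpow hp0]
      simp only [S, univ_prod_univ, Measure.restrict_univ]
      rfl
    have h2 : S univ univ = S (A ∪ (I ∪ Bᶜ)) univ := by rw [← hcov]
    rw [h1, h2]
    exact (hS2 _ _ _).trans (add_le_add le_rfl (hS2 _ _ _))
  have hIA : S I A ≤ E * volume A := (hsw I A hIm hAm).le.trans hAI
  have hOA : S Bᶜ A ≤ E * volume A := (hsw Bᶜ A hOm hAm).le.trans hAO
  have hBI : S Bᶜ I ≤ E * volume I := (hsw Bᶜ I hOm hIm).le.trans hIBc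
  have hbound : gagliardo ρ s p w ^ p ≤
      (L * volume A + (E * volume A + E * volume A)) +
        ((E * volume A + (0 + E * volume I)) + (E * volume A + (E * volume I + 0))) := by
    refine htot.trans (add_le_add ?_ (add_le_add ?_ ?_))
    · exact (hS3 A).trans (add_le_add hAA (add_le_add hAI hAO))
    · exact (hS3 I).trans (add_le_add hIA (add_le_add hII hIBc))
    · exact (hS3 Bᶜ).trans (add_le_add hOA (add_le_add hBI hOO))
  refine hbound.trans (le_of_eq ?_)
  have hR2 : 0 < R / 2 := by linarith
  have hvI : volume I = ENNReal.ofReal ((R / 2) ^ 𝔾.Q / 𝔾.Q) * ρ.omega := by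
    rw [ρ.volume_dist_lt, ρ.volume_lt_eq_omega hN hR2]
  have hpow : (R / 2) ^ 𝔾.Q ≤ R ^ 𝔾.Q := pow_le_pow_left₀ hR2.le (by linarith) _
  have hvA : volume A = ENNReal.ofReal ((R ^ 𝔾.Q - (R / 2) ^ 𝔾.Q) / 𝔾.Q) * ρ.omega := by
    have hfin : volume I ≠ ⊤ := (ρ.isBounded_dist_lt x₀ _).measure_lt_top.ne
    rw [measure_sdiff hIB hIm.nullMeasurableSet hfin, hvI, ρ.volume_dist_lt,
      ρ.volume_lt_eq_omega hN hR, ← ENNReal.sub_mul (fun _ _ => (ρ.omega_lt_top hN).ne),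
      ← ENNReal.ofReal_sub _ (by positivity), sub_div]
  obtain ⟨W, hW0, hW⟩ : ∃ W : ℝ, 0 ≤ W ∧ ρ.omega = ENNReal.ofReal W :=
    ⟨ρ.omega.toReal, ENNReal.toReal_nonneg, (ENNReal.ofReal_toReal (ρ.omega_lt_top hN).ne).symm⟩
  have ha : 0 < (1 - s) * p := mul_pos (by linarith) hp0
  have hb : 0 < p * s := mul_pos hp0 hs0
  have hA0 : 0 ≤ (R ^ 𝔾.Q - (R / 2) ^ 𝔾.Q) / 𝔾.Q := div_nonneg (by linarith) hQ.le
  have hC0 : 0 ≤ constC p 𝔾.Q s := by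
    unfold constC
    have : (1 : ℝ) / 2 ^ 𝔾.Q ≤ 1 := by
      rw [div_le_one (by positivity)]; exact one_le_pow₀ (by norm_num)
    have h1s : 0 < 1 - s := by linarith
    have : (0 : ℝ) ≤ 1 - 1 / 2 ^ 𝔾.Q := by linarith
    positivity
  set vA := (R ^ 𝔾.Q - (R / 2) ^ 𝔾.Q) / 𝔾.Q with hvA'
  set vI := (R / 2) ^ 𝔾.Q / 𝔾.Q with hvI'
  have he0 : 0 ≤ e := by rw [he]; positivity
  have hl0 : 0 ≤ l := by rw [hl]; positivity
  have hvI0 : 0 ≤ vI := by positivity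
  simp only [E, L, hvI, hvA]
  rw [hW]
  simp only [← ENNReal.ofReal_mul, he0, hl0, hA0, hvI0, hW0, mul_nonneg, add_zero, zero_add]
  have n1 : 0 ≤ l * W * (vA * W) := by positivity
  have n2 : 0 ≤ e * W * (vA * W) := by positivity
  have n3 : 0 ≤ e * W * (vI * W) := by positivity
  have n4 : 0 ≤ constC p 𝔾.Q s * R ^ ((𝔾.Q : ℝ) - p * s) / 𝔾.Q := by positivity
  rw [← ENNReal.ofReal_add n2 n2, ← ENNReal.ofReal_add n1 (by positivity),
    ← ENNReal.ofReal_add n2 n3, ← ENNReal.ofReal_add (by positivity) (by positivity),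
    ← ENNReal.ofReal_add (by positivity) (by positivity), ← ENNReal.ofReal_mul n4]
  congr 1
  have r1 : R ^ ((𝔾.Q : ℝ) - p * s) = R ^ 𝔾.Q * R ^ (-(p * s)) := by
    rw [sub_eq_add_neg, Real.rpow_add hR, Real.rpow_natCast]
  have r2 : (2 : ℝ) ^ (2 + p * s) = 4 * 2 ^ (p * s) := by
    rw [Real.rpow_add (by norm_num)]; norm_num
  have r3 : (2 : ℝ) ^ (1 + p * s - (𝔾.Q : ℝ)) = 2 * 2 ^ (p * s) / 2 ^ 𝔾.Q := by
    rw [Real.rpow_sub (by norm_num), Real.rpow_add (by norm_num), Real.rpow_natCast]; norm_num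
  rw [hl, he, hvA', hvI', constC, r1, r2, r3, div_pow]
  have h1s : 1 - s ≠ 0 := by linarith
  field_simp
  ring

end Carnot

namespace Carnot

variable {N : ℕ} {𝔾 : StratifiedGroup N} {ρ : HomogeneousNorm 𝔾} {s p : ℝ}
  {Ω : Set (Fin N → ℝ)} {β : (Fin N → ℝ) → ℝ} {g : ℝ → ℝ} {lam : ℝ}

/-! ### The energy functional -/

theorem hasDerivAt_primitive (hg : Continuous g) (τ : ℝ) : HasDerivAt (primitive g) (g τ) τ :=
  (hg.integral_hasStrictDerivAt 0 τ).hasDerivAt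

theorem continuous_primitive (hg : Continuous g) : Continuous (primitive g) :=
  continuous_iff_continuousAt.mpr fun τ => (hasDerivAt_primitive hg τ).continuousAt

theorem primitive_zero : primitive g 0 = 0 := by simp [primitive]

/-- The maximum of the primitive of `g` on `[-τ, τ]`. -/
def maxPrimitive (g : ℝ → ℝ) (τ : ℝ) : ℝ := sSup (primitive g '' Icc (-τ) τ)

theorem bddAbove_primitive (hg : Continuous g) (τ : ℝ) :
    BddAbove (primitive g '' Icc (-τ) τ) :=
  (isCompact_Icc.image (continuous_primitive hg)).bddAbove

theorem primitive_le_maxPrimitive (hg : Continuous g) {τ a : ℝ} (ha : |a| ≤ τ) :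
    primitive g a ≤ maxPrimitive g τ :=
  le_csSup (bddAbove_primitive hg τ) ⟨a, abs_le.mp ha, rfl⟩

theorem maxPrimitive_nonneg (hg : Continuous g) {τ : ℝ} (hτ : 0 ≤ τ) : 0 ≤ maxPrimitive g τ := by
  have := primitive_le_maxPrimitive hg (τ := τ) (a := 0) (by simpa using hτ)
  rwa [primitive_zero] at this

/-- The potential term `∫_Ω β G(u)`. -/
def potential (Ω : Set (Fin N → ℝ)) (β : (Fin N → ℝ) → ℝ) (g : ℝ → ℝ)
    (u : (Fin N → ℝ) → ℝ) : ℝ :=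
  ∫ x in Ω, β x * primitive g (u x)

/-- The energy functional whose critical points are the weak solutions. -/
def energy (ρ : HomogeneousNorm 𝔾) (s p : ℝ) (Ω : Set (Fin N → ℝ)) (β : (Fin N → ℝ) → ℝ)
    (g : ℝ → ℝ) (lam : ℝ) (u : (Fin N → ℝ) → ℝ) : ℝ :=
  (gagliardo ρ s p u).toReal ^ p / p - lam * potential Ω β g u

theorem exists_abs_le_of_continuous {h : ℝ → ℝ} (hh : Continuous h) (τ : ℝ) :
    ∃ C, 0 ≤ C ∧ ∀ a, |a| ≤ τ → |h a| ≤ C := by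
  obtain ⟨C, hC⟩ := (isCompact_Icc (a := -τ) (b := τ)).exists_bound_of_continuousOn hh.continuousOn
  exact ⟨max C 0, le_max_right _ _, fun a ha => (hC a (abs_le.mp ha)).trans (le_max_left _ _)⟩

theorem integrableOn_mul_comp (hΩb : Bornology.IsBounded Ω)
    (hβm : AEStronglyMeasurable β (volume.restrict Ω)) {b : ℝ}
    (hβ : ∀ᵐ x ∂volume.restrict Ω, β x ∈ Icc 0 b) {h : ℝ → ℝ} (hh : Continuous h)
    {u : (Fin N → ℝ) → ℝ} (hu : AEStronglyMeasurable u (volume.restrict Ω)) {τ : ℝ}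
    (huτ : ∀ᵐ x ∂volume.restrict Ω, |u x| ≤ τ) :
    IntegrableOn (fun x => β x * h (u x)) Ω := by
  obtain ⟨C, hC0, hC⟩ := exists_abs_le_of_continuous hh τ
  have : IsFiniteMeasure (volume.restrict Ω) := ⟨by simpa using hΩb.measure_lt_top⟩
  refine Integrable.of_bound (C := b * C) (hβm.mul (hh.comp_aestronglyMeasurable hu)) ?_
  filter_upwards [hβ, huτ] with x h1 h2
  rw [norm_mul, Real.norm_of_nonneg h1.1]
  exact mul_le_mul h1.2 (hC _ h2) (norm_nonneg _) (h1.1.trans h1.2)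

theorem potential_le (hΩb : Bornology.IsBounded Ω)
    (hβm : AEStronglyMeasurable β (volume.restrict Ω)) {b : ℝ}
    (hβ : ∀ᵐ x ∂volume.restrict Ω, β x ∈ Icc 0 b) (hg : Continuous g)
    {u : (Fin N → ℝ) → ℝ} (hu : AEStronglyMeasurable u (volume.restrict Ω)) {τ : ℝ} (hτ : 0 ≤ τ)
    (huτ : ∀ᵐ x ∂volume.restrict Ω, |u x| ≤ τ) :
    potential Ω β g u ≤ b * volume.real Ω * maxPrimitive g τ := by
  have hfin : volume Ω ≠ ⊤ := hΩb.measure_lt_top.ne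
  have hI := integrableOn_mul_comp hΩb hβm hβ (continuous_primitive hg) hu huτ
  have hc : IntegrableOn (fun _ : Fin N → ℝ => b * maxPrimitive g τ) Ω := integrableOn_const hfin
  calc potential Ω β g u ≤ ∫ _ in Ω, b * maxPrimitive g τ := by
        refine integral_mono_ae hI hc ?_
        filter_upwards [hβ, huτ] with x h1 h2
        exact (mul_le_mul_of_nonneg_left (primitive_le_maxPrimitive hg h2) h1.1).trans
          (mul_le_mul_of_nonneg_right h1.2 (maxPrimitive_nonneg hg hτ))
    _ = _ := by
        rw [setIntegral_const, smul_eq_mul]; ring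

theorem tendsto_potential (hΩb : Bornology.IsBounded Ω)
    (hβm : AEStronglyMeasurable β (volume.restrict Ω)) {b : ℝ}
    (hβ : ∀ᵐ x ∂volume.restrict Ω, β x ∈ Icc 0 b) (hg : Continuous g)
    {v : ℕ → (Fin N → ℝ) → ℝ} {u : (Fin N → ℝ) → ℝ}
    (hv : ∀ n, AEStronglyMeasurable (v n) (volume.restrict Ω)) {τ : ℝ}
    (hvτ : ∀ n, ∀ᵐ x ∂volume.restrict Ω, |v n x| ≤ τ)
    (hlim : ∀ᵐ x ∂volume.restrict Ω, Tendsto (fun n => v n x) atTop (𝓝 (u x))) :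
    Tendsto (fun n => potential Ω β g (v n)) atTop (𝓝 (potential Ω β g u)) := by
  have hG := continuous_primitive hg
  obtain ⟨C, hC0, hC⟩ := exists_abs_le_of_continuous hG τ
  refine tendsto_integral_of_dominated_convergence (fun _ => b * C)
    (fun n => hβm.mul (hG.comp_aestronglyMeasurable (hv n)))
    (integrableOn_const hΩb.measure_lt_top.ne) (fun n => ?_) ?_
  · filter_upwards [hβ, hvτ n] with x h1 h2
    rw [norm_mul, Real.norm_of_nonneg h1.1]
    exact mul_le_mul h1.2 (hC _ h2) (norm_nonneg _) (h1.1.trans h1.2)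
  · filter_upwards [hlim] with x hx
    exact ((hG.tendsto _).comp hx).const_mul _

/-- Existence of a minimizer of the energy on balls of `X_0`. -/
theorem exists_minimizer (hN : 0 < N) (hs : 0 ≤ s) (hp : 1 ≤ p) (hsp : (𝔾.Q : ℝ) < s * p)
    (hΩo : IsOpen Ω) (hΩb : Bornology.IsBounded Ω)
    (hβm : AEStronglyMeasurable β (volume.restrict Ω)) {b : ℝ}
    (hβ : ∀ᵐ x ∂volume.restrict Ω, β x ∈ Icc 0 b) (hg : Continuous g) (hlam : 0 ≤ lam)
    {l : ℝ} (hl : 0 ≤ l) (hL : ∀ u, MemX0 ρ s p Ω u →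
      ∀ᵐ x ∂volume.restrict Ω, |u x| ≤ l * (gagliardo ρ s p u).toReal) {R : ℝ} (hR : 0 ≤ R) :
    ∃ u, MemX0 ρ s p Ω u ∧ gagliardo ρ s p u ≤ ENNReal.ofReal R ∧
      ∀ v, MemX0 ρ s p Ω v → gagliardo ρ s p v ≤ ENNReal.ofReal R →
        energy ρ s p Ω β g lam u ≤ energy ρ s p Ω β g lam v := by
  have hp0 : 0 < p := by linarith
  set K := {v | MemX0 ρ s p Ω v ∧ gagliardo ρ s p v ≤ ENNReal.ofReal R}
  have hKR : ∀ v ∈ K, (gagliardo ρ s p v).toReal ≤ R := fun v hv =>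
    ENNReal.toReal_le_of_le_ofReal hR hv.2
  have hbd : ∀ v ∈ K, ∀ᵐ x ∂volume.restrict Ω, |v x| ≤ l * R := fun v hv => by
    filter_upwards [hL v hv.1] with x hx
    exact hx.trans (mul_le_mul_of_nonneg_left (hKR v hv) hl)
  have hm : ∀ v ∈ K, AEStronglyMeasurable v (volume.restrict Ω) := fun v hv => hv.1.1.1.1.restrict
  have hne : (energy ρ s p Ω β g lam '' K).Nonempty :=
    ⟨_, 0, ⟨MemX0.zero hp0, by rw [gagliardo_zero hp0]; exact zero_le⟩, rfl⟩
  have hbb : BddBelow (energy ρ s p Ω β g lam '' K) := by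
    refine ⟨-(lam * (b * volume.real Ω * maxPrimitive g (l * R))), ?_⟩
    rintro _ ⟨v, hv, rfl⟩
    have h1 := potential_le hΩb hβm hβ hg (hm v hv) (mul_nonneg hl hR) (hbd v hv)
    have h2 := mul_le_mul_of_nonneg_left h1 hlam
    have h3 : 0 ≤ (gagliardo ρ s p v).toReal ^ p / p := by positivity
    unfold energy
    linarith
  obtain ⟨e, -, he, hem⟩ := exists_seq_tendsto_sInf hne hbb
  choose v hvK hve using hem
  obtain ⟨ns, u, hns, huc, hu0, hae⟩ := exists_subseq_tendsto_ae (ρ := ρ) hN hs hp hsp hΩb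
    ENNReal.ofReal_ne_top (fun n => (hvK n).1) (fun n => (hvK n).2)
  have hfat := gagliardo_le_liminf (ρ := ρ) (s := s) hp0 (fun n => (hvK (ns n)).1.1.1.1) hae
  have huR : gagliardo ρ s p u ≤ ENNReal.ofReal R :=
    hfat.trans (liminf_le_of_le (by isBoundedDefault) fun c hc =>
      (hc.exists.choose_spec).trans (hvK _).2)
  have huX : MemX0 ρ s p Ω u :=
    memX0_of_continuous hp hΩo hΩb huc hu0 (huR.trans_lt ENNReal.ofReal_lt_top)
  refine ⟨u, huX, huR, fun w hw hwR => ?_⟩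
  have hpot := tendsto_potential hΩb hβm hβ hg (fun n => hm _ (hvK (ns n)))
    (fun n => hbd _ (hvK (ns n))) (ae_restrict_of_ae hae)
  set m := sInf (energy ρ s p Ω β g lam '' K)
  -- Energies and potentials both converge along the subsequence, hence so do the seminorms. The
  -- lower limit in Fatou's bound is therefore a limit and can be compared with the infimum.
  have hE : Tendsto (fun n => (gagliardo ρ s p (v (ns n))).toReal ^ p) atTop
      (𝓝 (p * (m + lam * potential Ω β g u))) := by
    have h1 := ((he.comp hns.tendsto_atTop).add (hpot.const_mul lam)).const_mul p
    refine h1.congr fun n => ?_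
    simp only [Function.comp_apply, ← hve, energy]
    field_simp
    ring
  set A := p * (m + lam * potential Ω β g u)
  have hA0 : 0 ≤ A := ge_of_tendsto hE (Eventually.of_forall fun n => by positivity)
  have hroot : Tendsto (fun n => gagliardo ρ s p (v (ns n))) atTop
      (𝓝 (ENNReal.ofReal (A ^ (1 / p)))) := by
    have h1 : Tendsto (fun n => ((gagliardo ρ s p (v (ns n))).toReal ^ p) ^ (1 / p)) atTop
        (𝓝 (A ^ (1 / p))) :=
      ((Real.continuous_rpow_const (by positivity : 0 ≤ 1 / p)).tendsto _).comp hE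
    refine (ENNReal.tendsto_ofReal h1).congr fun n => ?_
    rw [← Real.rpow_mul ENNReal.toReal_nonneg, mul_one_div_cancel hp0.ne', Real.rpow_one,
      ENNReal.ofReal_toReal (hvK _).1.1.2.ne]
  rw [hroot.liminf_eq] at hfat
  have h2 : (gagliardo ρ s p u).toReal ≤ A ^ (1 / p) :=
    ENNReal.toReal_le_of_le_ofReal (by positivity) hfat
  have h3 : (gagliardo ρ s p u).toReal ^ p ≤ A := by
    calc _ ≤ (A ^ (1 / p)) ^ p := Real.rpow_le_rpow ENNReal.toReal_nonneg h2 hp0.le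
      _ = A := by rw [← Real.rpow_mul hA0, one_div_mul_cancel hp0.ne', Real.rpow_one]
  have h4 : m ≤ energy ρ s p Ω β g lam w := csInf_le hbb ⟨w, ⟨hw, hwR⟩, rfl⟩
  have h5 : (gagliardo ρ s p u).toReal ^ p / p ≤ m + lam * potential Ω β g u := by
    rw [div_le_iff₀ hp0, mul_comm]; exact h3
  unfold energy at h4 ⊢
  linarith

/-! ### Differentiability of the energy along lines -/

theorem gagliardo_toReal_rpow (hp : 0 < p) {u : (Fin N → ℝ) → ℝ} (hu : MemW ρ s p u) :
    (gagliardo ρ s p u).toReal ^ p = ∫ z, |diffQuot ρ s p u z| ^ p := by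
  rw [gagliardo_eq_eLpNorm hp, (memLp_diffQuot hp hu).eLpNorm_eq_integral_rpow_norm
    (by simpa using hp) ENNReal.ofReal_ne_top]
  have h0 : 0 ≤ ∫ z, ‖diffQuot ρ s p u z‖ ^ p := integral_nonneg fun z => by positivity
  rw [ENNReal.toReal_ofReal hp.le, ENNReal.toReal_ofReal (by positivity), ← Real.rpow_mul h0,
    inv_mul_cancel₀ hp.ne', Real.rpow_one]
  rfl

/-- The kernel exponent is shared among the p factors, since Q + sp = ((p − 2) + 1 + 1)(Q + ps)/p.
The weak form thus becomes the derivative of the p-th power of an L^p norm. On the diagonal both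
sides vanish. -/
theorem energyDensity_eq (hp : 0 < p) (u φ : (Fin N → ℝ) → ℝ) (z : (Fin N → ℝ) × (Fin N → ℝ)) :
    energyDensity ρ s p u φ z =
      |diffQuot ρ s p u z| ^ (p - 2) * diffQuot ρ s p u z * diffQuot ρ s p φ z := by
  rcases (ρ.dist_nonneg z.1 z.2).eq_or_lt with h | h
  · simp [energyDensity, diffQuot, ρ.eq_of_dist_eq_zero h.symm]
  · have hd := Real.rpow_pos_of_pos h (((𝔾.Q : ℝ) + p * s) / p)
    have h1 : ρ.dist z.1 z.2 ^ ((𝔾.Q : ℝ) + s * p) =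
        (ρ.dist z.1 z.2 ^ (((𝔾.Q : ℝ) + p * s) / p)) ^ (p - 2) *
          ρ.dist z.1 z.2 ^ (((𝔾.Q : ℝ) + p * s) / p) *
          ρ.dist z.1 z.2 ^ (((𝔾.Q : ℝ) + p * s) / p) := by
      rw [← Real.rpow_mul h.le, ← Real.rpow_add h, ← Real.rpow_add h]
      congr 1; field_simp; ring
    rw [energyDensity, h1, diffQuot, diffQuot, abs_div, abs_of_pos hd,
      Real.div_rpow (abs_nonneg _) hd.le]
    ring

/-- Differentiation of |U + tV|^p under the integral, dominated for |t| < 1 by p (|U| + |V|)^p; p >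
1 makes the integrand differentiable even where U + tV vanishes. Absolute convergence of the weak
form is a by-product. -/
theorem hasDerivAt_gagliardo_rpow (hp : 1 < p) {u φ : (Fin N → ℝ) → ℝ} (hu : MemW ρ s p u)
    (hφ : MemW ρ s p φ) :
    Integrable (energyDensity ρ s p u φ) ∧
      HasDerivAt (fun t : ℝ => (gagliardo ρ s p (u + t • φ)).toReal ^ p)
        (p * ∫ z, energyDensity ρ s p u φ z) 0 := by
  have hp0 : 0 < p := by linarith
  set U := diffQuot ρ s p u
  set V := diffQuot ρ s p φ
  have hU := memLp_diffQuot hp0 hu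
  have hV := memLp_diffQuot hp0 hφ
  have hF : ∀ t : ℝ, (gagliardo ρ s p (u + t • φ)).toReal ^ p = ∫ z, |U z + t * V z| ^ p := by
    intro t
    rw [gagliardo_toReal_rpow hp0 (hu.add hp.le (hφ.smul hp0 t)), diffQuot_add, diffQuot_smul]
    rfl
  have hUV : ∀ t : ℝ, AEStronglyMeasurable (fun z => U z + t * V z) volume := fun t =>
    hU.1.add (hV.1.const_mul t)
  have hmeas : ∀ t : ℝ, AEStronglyMeasurable (fun z => |U z + t * V z| ^ p) volume := fun t =>
    (Real.continuous_rpow_const hp0.le).comp_aestronglyMeasurable (hUV t).norm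
  have hint : ∀ {f : (Fin N → ℝ) × (Fin N → ℝ) → ℝ}, MemLp f (ENNReal.ofReal p) volume →
      Integrable (fun z => |f z| ^ p) volume := fun hf => by
    have := hf.integrable_norm_rpow (by simpa using hp0) ENNReal.ofReal_ne_top
    rw [ENNReal.toReal_ofReal hp0.le] at this
    exact this
  have hsum : MemLp (fun z => |U z| + |V z|) (ENNReal.ofReal p) volume := hU.norm.add hV.norm
  have h := hasDerivAt_integral_of_dominated_loc_of_deriv_le (𝕜 := ℝ) (μ := volume)
    (s := Metric.ball (0 : ℝ) 1) (x₀ := 0) (F := fun t z => |U z + t * V z| ^ p)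
    (F' := fun t z => p * |U z + t * V z| ^ (p - 2) * (U z + t * V z) * V z)
    (bound := fun z => p * |(|U z| + |V z|)| ^ p) (Metric.ball_mem_nhds _ one_pos)
    (Eventually.of_forall hmeas) (by simpa using hint hU)
    (by
      have h1 : AEMeasurable (fun z => U z + 0 * V z) volume := (hUV 0).aemeasurable
      have h2 : AEMeasurable (fun z => |U z + 0 * V z|) volume := (hUV 0).norm.aemeasurable
      exact ((((h2.pow_const (p - 2)).const_mul p).mul h1).mul
        hV.1.aemeasurable).aestronglyMeasurable)
    (Eventually.of_forall fun z t ht => by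
      have ht1 : |t| ≤ 1 := by simpa using (mem_ball_zero_iff.mp ht).le
      have h1 : |U z + t * V z| ≤ |U z| + |V z| := by
        refine (abs_add_le _ _).trans ?_
        rw [abs_mul]
        gcongr
        exact mul_le_of_le_one_left (abs_nonneg _) ht1
      -- The power p − 2 may be negative, so it is always paired with one more factor, and the zero
      -- of U + tV is treated apart.
      have h2 : |U z + t * V z| ^ (p - 2) * |U z + t * V z| ≤ (|U z| + |V z|) ^ (p - 1) := by
        rcases (abs_nonneg (U z + t * V z)).eq_or_lt with h0 | h0
        · rw [← h0, mul_zero]; positivity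
        · rw [← Real.rpow_add_one h0.ne', show p - 2 + 1 = p - 1 by ring]
          exact Real.rpow_le_rpow h0.le h1 (by linarith)
      have h3 : 0 ≤ |U z| + |V z| := by positivity
      rw [abs_of_nonneg h3]
      calc ‖p * |U z + t * V z| ^ (p - 2) * (U z + t * V z) * V z‖
          = p * (|U z + t * V z| ^ (p - 2) * |U z + t * V z|) * |V z| := by
            rw [norm_mul, norm_mul, norm_mul, Real.norm_of_nonneg hp0.le,
              Real.norm_of_nonneg (Real.rpow_nonneg (abs_nonneg _) _)]
            simp only [Real.norm_eq_abs]; ring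
        _ ≤ p * (|U z| + |V z|) ^ (p - 1) * (|U z| + |V z|) := by
            gcongr
            linarith [abs_nonneg (U z)]
        _ = p * (|U z| + |V z|) ^ p := by
            rcases h3.eq_or_lt with h0 | h0
            · rw [← h0, mul_zero, Real.zero_rpow hp0.ne', mul_zero]
            · rw [mul_assoc, ← Real.rpow_add_one h0.ne', sub_add_cancel])
    ((hint hsum).const_mul p)
    (Eventually.of_forall fun z t _ => by
      have h1 : HasDerivAt (fun t : ℝ => U z + t * V z) (V z) t := by
        simpa using ((hasDerivAt_id t).mul_const (V z)).const_add (U z)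
      exact (hasDerivAt_abs_rpow (U z + t * V z) hp).comp t h1)
  have hD : ∀ z, p * |U z + 0 * V z| ^ (p - 2) * (U z + 0 * V z) * V z =
      p * energyDensity ρ s p u φ z := fun z => by
    rw [energyDensity_eq hp0, zero_mul, add_zero]; ring
  simp only [hD, integral_const_mul, ← hF] at h
  refine ⟨?_, h.2⟩
  have h1 := h.1.const_mul p⁻¹
  refine h1.congr (Eventually.of_forall fun z => ?_)
  simp only
  rw [← mul_assoc, inv_mul_cancel₀ hp0.ne', one_mul]

/-- Since u and φ are bounded on Ω, `g` is evaluated only on a compact interval, and a constant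
dominates on the bounded set Ω. -/
theorem hasDerivAt_potential (hΩb : Bornology.IsBounded Ω)
    (hβm : AEStronglyMeasurable β (volume.restrict Ω)) {b : ℝ}
    (hβ : ∀ᵐ x ∂volume.restrict Ω, β x ∈ Icc 0 b) (hg : Continuous g)
    {u φ : (Fin N → ℝ) → ℝ} (hu : AEStronglyMeasurable u (volume.restrict Ω))
    (hφ : AEStronglyMeasurable φ (volume.restrict Ω)) {τ σ : ℝ}
    (huτ : ∀ᵐ x ∂volume.restrict Ω, |u x| ≤ τ) (hφσ : ∀ᵐ x ∂volume.restrict Ω, |φ x| ≤ σ) :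
    IntegrableOn (fun x => β x * g (u x) * φ x) Ω ∧
      HasDerivAt (fun t : ℝ => potential Ω β g (u + t • φ))
        (∫ x in Ω, β x * g (u x) * φ x) 0 := by
  have hG := continuous_primitive hg
  obtain ⟨C, hC0, hC⟩ := exists_abs_le_of_continuous hg (τ + σ)
  have hut : ∀ t : ℝ, AEStronglyMeasurable (fun x => u x + t * φ x) (volume.restrict Ω) :=
    fun t => hu.add (hφ.const_mul t)
  have h := hasDerivAt_integral_of_dominated_loc_of_deriv_le (𝕜 := ℝ) (μ := volume.restrict Ω)
    (s := Metric.ball (0 : ℝ) 1) (x₀ := 0) (F := fun t x => β x * primitive g (u x + t * φ x))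
    (F' := fun t x => β x * (g (u x + t * φ x) * φ x))
    (bound := fun _ => b * (C * σ)) (Metric.ball_mem_nhds _ one_pos)
    (Eventually.of_forall fun t => hβm.mul (hG.comp_aestronglyMeasurable (hut t)))
    (by simpa [IntegrableOn] using integrableOn_mul_comp hΩb hβm hβ hG hu huτ)
    (hβm.mul ((hg.comp_aestronglyMeasurable (hut 0)).mul hφ))
    (by
      filter_upwards [hβ, huτ, hφσ] with x h1 h2 h3 t ht
      have ht1 : |t| ≤ 1 := by simpa using (mem_ball_zero_iff.mp ht).le
      have h4 : |u x + t * φ x| ≤ τ + σ := by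
        refine (abs_add_le _ _).trans (add_le_add h2 ?_)
        rw [abs_mul]
        exact (mul_le_of_le_one_left (abs_nonneg _) ht1).trans h3
      rw [norm_mul, norm_mul, Real.norm_of_nonneg h1.1]
      exact mul_le_mul h1.2 (mul_le_mul (hC _ h4) h3 (norm_nonneg _) hC0)
        (by positivity) (h1.1.trans h1.2))
    (integrableOn_const hΩb.measure_lt_top.ne)
    (Eventually.of_forall fun x t _ => by
      have h1 : HasDerivAt (fun t : ℝ => u x + t * φ x) (φ x) t := by
        simpa using ((hasDerivAt_id t).mul_const (φ x)).const_add (u x)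
      exact ((hasDerivAt_primitive hg _).comp t h1).const_mul (β x))
  simp only [zero_mul, add_zero, ← mul_assoc] at h
  exact h

/-- A minimizer of the energy on a ball of `X_0` that lies in the interior of the ball solves the
Euler–Lagrange equation. -/
theorem isWeakSolution_of_minimizer (hp : 1 < p) (hΩb : Bornology.IsBounded Ω)
    (hβm : AEStronglyMeasurable β (volume.restrict Ω)) {b : ℝ}
    (hβ : ∀ᵐ x ∂volume.restrict Ω, β x ∈ Icc 0 b) (hg : Continuous g)
    {l : ℝ} (hL : ∀ u, MemX0 ρ s p Ω u →
      ∀ᵐ x ∂volume.restrict Ω, |u x| ≤ l * (gagliardo ρ s p u).toReal) {R : ℝ≥0∞}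
    {u : (Fin N → ℝ) → ℝ} (hu : MemX0 ρ s p Ω u) (hu0 : ¬ (u =ᵐ[volume] 0))
    (huR : gagliardo ρ s p u < R)
    (hmin : ∀ v, MemX0 ρ s p Ω v → gagliardo ρ s p v ≤ R →
        energy ρ s p Ω β g lam u ≤ energy ρ s p Ω β g lam v) :
    IsWeakSolution ρ s p Ω β g lam u := by
  have hp0 : 0 < p := by linarith
  refine ⟨hu, hu0, fun φ hφ => ?_⟩
  obtain ⟨hI1, hd1⟩ := hasDerivAt_gagliardo_rpow hp hu.1 hφ.1
  obtain ⟨hI2, hd2⟩ := hasDerivAt_potential hΩb hβm hβ hg hu.1.1.1.restrict hφ.1.1.1.restrict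
    (hL u hu) (hL φ hφ)
  refine ⟨hI1, hI2, ?_⟩
  have hd : HasDerivAt (fun t : ℝ => energy ρ s p Ω β g lam (u + t • φ))
      (p * (∫ z, energyDensity ρ s p u φ z) / p - lam * ∫ x in Ω, β x * g (u x) * φ x) 0 :=
    (hd1.div_const p).sub (hd2.const_mul lam)
  -- Strict interiority leaves room for small variations in every direction, so the constrained
  -- minimum is a local minimum along each line.
  have hnear : ∀ᶠ t : ℝ in 𝓝 0, gagliardo ρ s p (u + t • φ) < R := by
    have h1 : Tendsto (fun t : ℝ => gagliardo ρ s p u + ENNReal.ofReal |t| * gagliardo ρ s p φ)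
        (𝓝 0) (𝓝 (gagliardo ρ s p u + ENNReal.ofReal |0| * gagliardo ρ s p φ)) :=
      tendsto_const_nhds.add (ENNReal.Tendsto.mul_const
        (ENNReal.tendsto_ofReal (continuous_abs.tendsto 0)) (Or.inr hφ.1.2.ne))
    rw [abs_zero, ENNReal.ofReal_zero, zero_mul, add_zero] at h1
    filter_upwards [h1.eventually (gt_mem_nhds huR)] with t ht
    refine lt_of_le_of_lt (gagliardo_add_le hp.le hu.1.1.1 (hφ.1.1.1.const_smul t)) ?_
    rwa [gagliardo_smul hp0]
  have hloc : IsLocalMin (fun t : ℝ => energy ρ s p Ω β g lam (u + t • φ)) 0 := by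
    filter_upwards [hnear] with t ht
    simp only [zero_smul, add_zero]
    exact hmin _ (hu.add hp.le (hφ.smul hp0 t)) ht.le
  have h0 := hloc.hasDerivAt_eq_zero hd
  rw [mul_div_cancel_left₀ _ hp0.ne'] at h0
  linarith

end Carnot

namespace Carnot

variable {N : ℕ} {𝔾 : StratifiedGroup N} {ρ : HomogeneousNorm 𝔾} {s p : ℝ}
  {Ω : Set (Fin N → ℝ)} {β : (Fin N → ℝ) → ℝ} {g : ℝ → ℝ} {lam : ℝ}
  {x₀ : Fin N → ℝ} {R : ℝ}

/-! ### The cone as a test function -/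

theorem gagliardo_cone_lt_top (hN : 0 < N) (hs0 : 0 < s) (hs1 : s < 1) (hp : 1 < p)
    (hR : 0 < R) : gagliardo ρ s p (cone ρ x₀ R) < ⊤ := by
  have hp0 : 0 < p := by linarith
  have hω := (ρ.omega_lt_top hN).ne
  have h := (gagliardo_cone_rpow_le (ρ := ρ) (x₀ := x₀) hN hs0 hs1 hp hR).trans_lt
    (ENNReal.mul_lt_top ENNReal.ofReal_lt_top (ENNReal.mul_lt_top hω.lt_top hω.lt_top))
  by_contra h'
  rw [not_lt, top_le_iff] at h'
  rw [h', ENNReal.top_rpow_of_pos hp0] at h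
  exact lt_irrefl _ h

theorem cone_memX0 (hN : 0 < N) (hs0 : 0 < s) (hs1 : s < 1) (hp : 1 < p) (hΩo : IsOpen Ω)
    (hΩb : Bornology.IsBounded Ω) (hR : 0 < R) (hsub : {y | ρ.dist x₀ y < R} ⊆ Ω) :
    MemX0 ρ s p Ω (cone ρ x₀ R) :=
  memX0_of_continuous hp.le hΩo hΩb continuous_cone
    (fun _ hx => cone_eq_zero hR (not_lt.mp fun h => hx (hsub h)))
    (gagliardo_cone_lt_top hN hs0 hs1 hp hR)

/-- The cone is a nonzero competitor in the supremum, so radii τ / L make sense. -/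
theorem constL_pos (hN : 0 < N) (hs0 : 0 < s) (hs1 : s < 1) (hp : 1 < p) (hΩo : IsOpen Ω)
    (hΩb : Bornology.IsBounded Ω) (hR : 0 < R) (hsub : {y | ρ.dist x₀ y < R} ⊆ Ω) :
    0 < constL ρ s p Ω := by
  have hX := cone_memX0 (ρ := ρ) hN hs0 hs1 hp hΩo hΩb hR hsub
  have hne : ¬ (cone ρ x₀ R =ᵐ[volume] 0) := fun h => by
    have h1 := (Continuous.ae_eq_iff_eq volume continuous_cone continuous_zero).mp h
    have h2 := congrFun h1 x₀
    rw [cone_eq_one hR (by rw [ρ.dist_self]; positivity)] at h2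
    simp at h2
  have hnorm : normLinf Ω (cone ρ x₀ R) ≠ 0 := fun h => by
    rw [normLinf, eLpNorm_eq_zero_iff continuous_cone.aestronglyMeasurable (by simp)] at h
    refine hne ?_
    have h1 := (ae_restrict_iff' hΩo.measurableSet).mp h
    filter_upwards [h1] with x hx
    by_cases hxΩ : x ∈ Ω
    · exact hx hxΩ
    · exact cone_eq_zero hR (not_lt.mp fun h => hxΩ (hsub h))
  refine lt_of_lt_of_le (ENNReal.div_pos hnorm hX.1.2.ne)
    (le_iSup₂ (f := fun (u : (Fin N → ℝ) → ℝ) (_ : MemX0 ρ s p Ω u ∧ ¬ (u =ᵐ[volume] 0)) =>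
        normLinf Ω u / gagliardo ρ s p u) (cone ρ x₀ R) ⟨hX, hne⟩)

theorem constC_pos (hs0 : 0 < s) (hs1 : s < 1) (hp : 0 < p) (Q : ℕ) : 0 < constC p Q s := by
  unfold constC
  have h1 : (1 : ℝ) / 2 ^ Q ≤ 1 := by
    rw [div_le_one (by positivity)]; exact one_le_pow₀ (by norm_num)
  have h1s : 0 < 1 - s := by linarith
  have h2 : (0 : ℝ) ≤ 1 - 1 / 2 ^ Q := by linarith
  positivity

/-- On the ball of radius R / 2 the cone is 1, so the integrand is at least β₀ G(τ). Elsewhere it is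
discarded, being nonnegative because the multiple of the cone takes values in [0, ∞), where G ≥ 0.
-/
theorem le_potential_smul_cone (hΩb : Bornology.IsBounded Ω)
    (hβm : AEStronglyMeasurable β (volume.restrict Ω)) {b β₀ : ℝ}
    (hβ : ∀ᵐ x ∂volume.restrict Ω, β x ∈ Icc 0 b) (hβ₀ : ∀ᵐ x ∂volume.restrict Ω, β₀ ≤ β x)
    (hg : Continuous g) (hG : ∀ τ, 0 ≤ τ → 0 ≤ primitive g τ) (hR : 0 < R)
    (hsub : {y | ρ.dist x₀ y < R} ⊆ Ω) {τ : ℝ} (hτ : 0 ≤ τ) :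
    β₀ * primitive g τ * volume.real {y | ρ.dist x₀ y < R / 2} ≤
      potential Ω β g (τ • cone ρ x₀ R) := by
  set I := {y | ρ.dist x₀ y < R / 2}
  have hIm : MeasurableSet I := (ρ.isOpen_dist_lt x₀ _).measurableSet
  have hIΩ : I ⊆ Ω := fun y (hy : ρ.dist x₀ y < R / 2) =>
    hsub (by linarith : ρ.dist x₀ y < R)
  have hint : IntegrableOn (fun x => β x * primitive g ((τ • cone ρ x₀ R) x)) Ω :=
    integrableOn_mul_comp hΩb hβm hβ (continuous_primitive hg)
      (continuous_cone.const_smul τ).aestronglyMeasurable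
      (τ := τ) (Eventually.of_forall fun x => by
        rw [Pi.smul_apply, smul_eq_mul, abs_of_nonneg (mul_nonneg hτ (cone_nonneg x))]
        exact mul_le_of_le_one_right hτ (cone_le_one x))
  have hIfin : volume I ≠ ⊤ := (ρ.isBounded_dist_lt x₀ _).measure_lt_top.ne
  calc β₀ * primitive g τ * volume.real I = ∫ _ in I, β₀ * primitive g τ := by
        rw [setIntegral_const, smul_eq_mul, mul_comm]
    _ ≤ ∫ x in I, β x * primitive g ((τ • cone ρ x₀ R) x) := by
        refine integral_mono_ae (integrableOn_const hIfin) (hint.mono_set hIΩ) ?_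
        filter_upwards [ae_restrict_of_ae_restrict_of_subset hIΩ hβ₀, ae_restrict_mem hIm]
          with x h1 hx
        have hx' : ρ.dist x₀ x < R / 2 := hx
        simp only [Pi.smul_apply, smul_eq_mul]
        rw [cone_eq_one hR hx'.le, mul_one]
        exact mul_le_mul_of_nonneg_right h1 (hG τ hτ)
    _ ≤ potential Ω β g (τ • cone ρ x₀ R) := by
        refine setIntegral_mono_set hint ?_ hIΩ.eventuallyLE
        filter_upwards [hβ] with x h1
        exact mul_nonneg h1.1 (hG _ (mul_nonneg hτ (cone_nonneg x)))

/-- The seminorm term scales exactly like τ^p, and G(τ) > B τ^p makes the potential at least a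
multiple of τ^p. The witness ε is the gap between the two coefficients. -/
theorem exists_energy_smul_cone_le (hN : 0 < N) (hs0 : 0 < s) (hs1 : s < 1) (hp : 1 < p)
    (hΩb : Bornology.IsBounded Ω)
    (hβm : AEStronglyMeasurable β (volume.restrict Ω)) {b β₀ : ℝ}
    (hβ : ∀ᵐ x ∂volume.restrict Ω, β x ∈ Icc 0 b) (hβ₀ : ∀ᵐ x ∂volume.restrict Ω, β₀ ≤ β x)
    (hβ₀p : 0 ≤ β₀) (hlam : 0 ≤ lam)
    (hg : Continuous g) (hG : ∀ τ, 0 ≤ τ → 0 ≤ primitive g τ) (hR : 0 < R)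
    (hsub : {y | ρ.dist x₀ y < R} ⊆ Ω) {B : ℝ}
    (hB : 2 ^ 𝔾.Q * constC p 𝔾.Q s * ρ.omega.toReal < lam * p * β₀ * B * R ^ (p * s)) :
    ∃ ε > 0, ∀ τ, 0 < τ → B < primitive g τ / τ ^ p →
      energy ρ s p Ω β g lam (τ • cone ρ x₀ R) ≤ -(ε * τ ^ p) := by
  have hp0 : 0 < p := by linarith
  have hQ : (0 : ℝ) < 𝔾.Q := by exact_mod_cast 𝔾.Q_pos hN
  set W := ρ.omega.toReal
  have hW : 0 < W := ENNReal.toReal_pos (ρ.omega_pos hN).ne' (ρ.omega_lt_top hN).ne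
  set E := (gagliardo ρ s p (cone ρ x₀ R)).toReal ^ p
  set v := volume.real {y | ρ.dist x₀ y < R / 2}
  have hC := constC_pos hs0 hs1 hp0 𝔾.Q
  have hv : v = R ^ 𝔾.Q / 2 ^ 𝔾.Q / 𝔾.Q * W := by
    simp only [v, measureReal_def]
    rw [ρ.volume_dist_lt, ρ.volume_lt_eq_omega hN (by linarith), ENNReal.toReal_mul,
      ENNReal.toReal_ofReal (by positivity), div_pow]
  have hE : E ≤ constC p 𝔾.Q s * R ^ ((𝔾.Q : ℝ) - p * s) / 𝔾.Q * (W * W) := by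
    have h := gagliardo_cone_rpow_le (ρ := ρ) (x₀ := x₀) hN hs0 hs1 hp hR
    have hω := (ρ.omega_lt_top hN).ne
    have h2 := ENNReal.toReal_mono (ENNReal.mul_ne_top ENNReal.ofReal_ne_top
      (ENNReal.mul_ne_top hω hω)) h
    rw [← ENNReal.toReal_rpow, ENNReal.toReal_mul, ENNReal.toReal_mul,
      ENNReal.toReal_ofReal (by positivity)] at h2
    exact h2
  have hε : 0 < lam * β₀ * B * v - E / p := by
    -- Both coefficients are written with the same positive factor, after which their comparison is
    -- exactly `hB`.
    have h1 : E / p ≤ 2 ^ 𝔾.Q * constC p 𝔾.Q s * W *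
        (R ^ 𝔾.Q / 2 ^ 𝔾.Q / 𝔾.Q * W * R ^ (-(p * s)) / p) := by
      rw [div_le_iff₀ hp0]
      refine hE.trans (le_of_eq ?_)
      rw [sub_eq_add_neg, Real.rpow_add hR, Real.rpow_natCast]
      field_simp
    have h2 : lam * β₀ * B * v = lam * p * β₀ * B * R ^ (p * s) *
        (R ^ 𝔾.Q / 2 ^ 𝔾.Q / 𝔾.Q * W * R ^ (-(p * s)) / p) := by
      rw [hv, Real.rpow_neg hR.le]
      field_simp
    have h3 := mul_lt_mul_of_pos_right hB
      (by positivity : 0 < R ^ 𝔾.Q / 2 ^ 𝔾.Q / 𝔾.Q * W * R ^ (-(p * s)) / p)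
    linarith
  refine ⟨_, hε, fun τ hτ hBτ => ?_⟩
  have hτp : 0 < τ ^ p := Real.rpow_pos_of_pos hτ p
  have hpot := le_potential_smul_cone (ρ := ρ) hΩb hβm hβ hβ₀ hg hG hR hsub hτ.le
  have hgag : (gagliardo ρ s p (τ • cone ρ x₀ R)).toReal ^ p = τ ^ p * E := by
    rw [gagliardo_smul hp0, ENNReal.toReal_mul, ENNReal.toReal_ofReal (abs_nonneg _),
      abs_of_pos hτ, Real.mul_rpow hτ.le ENNReal.toReal_nonneg]
  rw [lt_div_iff₀ hτp] at hBτ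
  have hv0 : 0 ≤ v := measureReal_nonneg
  have h1 : lam * (β₀ * (B * τ ^ p) * v) ≤ lam * potential Ω β g (τ • cone ρ x₀ R) := by
    refine mul_le_mul_of_nonneg_left (le_trans ?_ hpot) hlam
    gcongr
  rw [energy, hgag]
  have h2 : τ ^ p * E / p = E / p * τ ^ p := by ring
  rw [h2]
  nlinarith

/-! ### Solutions on sublevel sets -/

theorem energy_of_ae_eq_zero (hp : 0 < p) {u : (Fin N → ℝ) → ℝ} (hu : u =ᵐ[volume] 0) :
    energy ρ s p Ω β g lam u = 0 := by
  have h1 : gagliardo ρ s p u = 0 := by rw [gagliardo_congr_ae hp hu, gagliardo_zero hp]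
  have h2 : potential Ω β g u = 0 := by
    refine integral_eq_zero_of_ae ?_
    filter_upwards [ae_restrict_of_ae hu] with x hx
    rw [hx]
    simp [primitive_zero]
  rw [energy, h1, h2]
  simp [Real.zero_rpow hp.ne']

/-- If `max_{[-τ, τ]} G` is small compared with `τ ^ p`, the energy has a critical point in the ball
of `X_0` of radius `τ / l` that minimizes the energy there. -/
theorem exists_isWeakSolution (hN : 0 < N) (hs : 0 ≤ s) (hp : 1 < p) (hsp : (𝔾.Q : ℝ) < s * p)
    (hΩo : IsOpen Ω) (hΩb : Bornology.IsBounded Ω)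
    (hβm : AEStronglyMeasurable β (volume.restrict Ω)) {b : ℝ}
    (hβ : ∀ᵐ x ∂volume.restrict Ω, β x ∈ Icc 0 b) (hg : Continuous g) (hlam : 0 ≤ lam)
    {l : ℝ} (hl : 0 < l) (hL : ∀ u, MemX0 ρ s p Ω u →
      ∀ᵐ x ∂volume.restrict Ω, |u x| ≤ l * (gagliardo ρ s p u).toReal) {τ : ℝ} (hτ : 0 < τ)
    (hmax : lam * (p * b * volume.real Ω * l ^ p * (maxPrimitive g τ / τ ^ p)) < 1)
    {w : (Fin N → ℝ) → ℝ} (hw : MemX0 ρ s p Ω w)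
    (hwτ : gagliardo ρ s p w ≤ ENNReal.ofReal (τ / l)) (hwE : energy ρ s p Ω β g lam w < 0) :
    ∃ u, IsWeakSolution ρ s p Ω β g lam u ∧ gagliardo ρ s p u ≤ ENNReal.ofReal (τ / l) ∧
      energy ρ s p Ω β g lam u ≤ energy ρ s p Ω β g lam w := by
  have hp0 : 0 < p := by linarith
  have hR : 0 < τ / l := by positivity
  obtain ⟨u, hu, huR, hmin⟩ := exists_minimizer hN hs hp.le hsp hΩo hΩb hβm hβ hg hlam hl.le hL
    hR.le
  have huw := hmin w hw hwτ
  have hu0 : ¬ (u =ᵐ[volume] 0) := fun h => by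
    rw [energy_of_ae_eq_zero hp0 h] at huw
    linarith
  have hgR : (gagliardo ρ s p u).toReal ≤ τ / l := ENNReal.toReal_le_of_le_ofReal hR.le huR
  have huτ : ∀ᵐ x ∂volume.restrict Ω, |u x| ≤ τ := by
    filter_upwards [hL u hu] with x hx
    refine hx.trans ((mul_le_mul_of_nonneg_left hgR hl.le).trans (le_of_eq ?_))
    field_simp
  have hpot := potential_le hΩb hβm hβ hg hu.1.1.1.restrict hτ.le huτ
  -- Negative energy bounds [u]^p / p by λ times the potential, which by `hmax` is below its value
  -- on the boundary of the ball.
  have hlt : gagliardo ρ s p u < ENNReal.ofReal (τ / l) := by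
    have h1 : (gagliardo ρ s p u).toReal ^ p / p ≤
        lam * (b * volume.real Ω * maxPrimitive g τ) := by
      have h2 := mul_le_mul_of_nonneg_left hpot hlam
      have h3 : energy ρ s p Ω β g lam u < 0 := lt_of_le_of_lt huw hwE
      unfold energy at h3
      linarith
    have hτp : 0 < τ ^ p := Real.rpow_pos_of_pos hτ p
    have hlp : 0 < l ^ p := Real.rpow_pos_of_pos hl p
    have h2 : lam * (b * volume.real Ω * maxPrimitive g τ) < (τ / l) ^ p / p := by
      rw [Real.div_rpow hτ.le hl.le]
      have h3 : lam * (p * b * volume.real Ω * l ^ p * (maxPrimitive g τ / τ ^ p)) =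
          lam * (b * volume.real Ω * maxPrimitive g τ) / (τ ^ p / l ^ p / p) := by
        field_simp
      rw [h3, div_lt_one (by positivity)] at hmax
      exact hmax
    have h4 : (gagliardo ρ s p u).toReal ^ p < (τ / l) ^ p := by
      have := lt_of_le_of_lt h1 h2
      rwa [div_lt_div_iff_of_pos_right hp0] at this
    have h5 : (gagliardo ρ s p u).toReal < τ / l :=
      (Real.rpow_lt_rpow_iff ENNReal.toReal_nonneg hR.le hp0).mp h4
    exact (ENNReal.lt_ofReal_iff_toReal_lt hu.1.2.ne).mpr h5
  exact ⟨u, isWeakSolution_of_minimizer hp hΩb hβm hβ hg hL hu hu0 hlt hmin, huR, huw⟩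

/-! ### Reading off the hypotheses on the parameter -/

/-- Used to lower the possibly infinite quantities r^(sp) and B_M to finite ones without losing a
strict inequality. -/
theorem exists_lt_of_lt_mul {a b c : ℝ≥0∞} (hc : c < a * b) : ∃ a' < a, c < a' * b := by
  obtain ⟨a', hc, ha'⟩ := exists_between (ENNReal.div_lt_of_lt_mul hc)
  exact ⟨_, ha', (ENNReal.div_lt_iff (.inl <| by rintro rfl; simp at *)
    (.inr <| by rintro rfl; simp at *)).1 hc⟩

/-- If `lam > λ₁`, there are a ball in `Ω` and a level that is frequently exceeded by
`G(τ) / τ ^ p`, for which the energy of the cone is negative. -/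
theorem exists_ball_of_lambda1_lt (hN : 0 < N) (hs0 : 0 < s) (hs1 : s < 1) (hp : 1 < p)
    {M : Filter ℝ} (hβ0 : 0 < betaZero Ω β) (hlam : 0 ≤ lam)
    (hlam1 : lambda1 ρ s p Ω β g M < ENNReal.ofReal lam) :
    ∃ (x₀ : Fin N → ℝ) (R B : ℝ), 0 < R ∧ {y | ρ.dist x₀ y < R} ⊆ Ω ∧
      2 ^ 𝔾.Q * constC p 𝔾.Q s * ρ.omega.toReal <
        lam * p * betaZero Ω β * B * R ^ (p * s) ∧
      ∃ᶠ τ in M, B < primitive g τ / τ ^ p := by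
  have hp0 : 0 < p := by linarith
  have hsp0 : 0 < s * p := by positivity
  have hC := constC_pos hs0 hs1 hp0 𝔾.Q
  have hω := ρ.omega_lt_top hN
  set X : ℝ≥0∞ := 2 ^ 𝔾.Q * ENNReal.ofReal (constC p 𝔾.Q s) * ρ.omega with hX
  have hX0 : X ≠ 0 := mul_ne_zero (mul_ne_zero (by simp) (by simpa using hC))
    (ρ.omega_pos hN).ne'
  have hXt : X ≠ ⊤ := ENNReal.mul_ne_top (ENNReal.mul_ne_top (by simp) (by simp)) hω.ne
  rw [lambda1, ENNReal.div_lt_iff (Or.inr hX0) (Or.inr hXt)] at hlam1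
  set r := inradius ρ Ω
  have h1 : X < r ^ (s * p) * (ENNReal.ofReal (lam * p * betaZero Ω β) * constB g p M) := by
    refine lt_of_lt_of_eq hlam1 ?_
    rw [ENNReal.ofReal_mul (by positivity), ENNReal.ofReal_mul hlam]
    ring
  obtain ⟨a, ha, h2⟩ := exists_lt_of_lt_mul h1
  have h3 : X < constB g p M * (ENNReal.ofReal (lam * p * betaZero Ω β) * a) := by
    refine lt_of_lt_of_eq h2 ?_
    ring
  obtain ⟨B, hB, h4⟩ := exists_lt_of_lt_mul h3
  have hat : a ≠ ⊤ := ha.ne_top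
  have hBt : B ≠ ⊤ := hB.ne_top
  have ha0 : a ≠ 0 := by rintro rfl; simp at h4
  -- Since R' < r, some point of Ω is at distance more than R' from the boundary, so its ball of
  -- radius R' stays in Ω.
  set R' := a ^ (s * p)⁻¹
  have hR'r : R' < r := by
    rw [← ENNReal.rpow_lt_rpow_iff hsp0, ← ENNReal.rpow_mul, inv_mul_cancel₀ hsp0.ne',
      ENNReal.rpow_one]
    exact ha
  have hR't : R' ≠ ⊤ := hR'r.ne_top
  have hR'0 : R' ≠ 0 := by
    simp [R', ENNReal.rpow_eq_zero_iff, ha0, hat]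
  obtain ⟨x₀, hx₀⟩ := lt_iSup_iff.mp hR'r
  obtain ⟨hxΩ, hx₁⟩ := lt_iSup_iff.mp hx₀
  refine ⟨x₀, R'.toReal, B.toReal, ENNReal.toReal_pos hR'0 hR't, ?_, ?_, ?_⟩
  · refine ρ.setOf_dist_lt_subset hxΩ fun y hy => ?_
    have h5 : R' ≤ ENNReal.ofReal (ρ.dist x₀ y) := hx₁.le.trans (iInf₂_le y hy)
    exact ENNReal.toReal_le_of_le_ofReal (ρ.dist_nonneg _ _) h5
  · have h5 := (ENNReal.toReal_lt_toReal hXt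
      (ENNReal.mul_ne_top hBt (ENNReal.mul_ne_top ENNReal.ofReal_ne_top hat))).mpr h4
    have h6 : R'.toReal ^ (p * s) = a.toReal := by
      rw [ENNReal.toReal_rpow, ← ENNReal.rpow_mul, mul_comm p s, inv_mul_cancel₀ hsp0.ne',
        ENNReal.rpow_one]
    simp only [hX, ENNReal.toReal_mul, ENNReal.toReal_pow, ENNReal.toReal_ofNat] at h5
    rw [ENNReal.toReal_ofReal hC.le, ENNReal.toReal_ofReal (by positivity)] at h5
    rw [h6]
    linarith
  · exact (frequently_lt_of_lt_limsup (by isBoundedDefault) hB).mono fun τ hτ =>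
      (ENNReal.lt_ofReal_iff_toReal_lt hBt).mp hτ

theorem frequently_of_lt_lambda2 {M : Filter ℝ} [M.NeBot] (hp : 0 < p)
    (hβ : normLinf Ω β ≠ ⊤) (hΩ : volume Ω ≠ ⊤) (hL : constL ρ s p Ω ≠ ⊤) (hlam : 0 ≤ lam)
    (hg : Continuous g) (hM : ∀ᶠ τ in M, 0 < τ)
    (hlam2 : ENNReal.ofReal lam < lambda2 ρ s p Ω β g M) :
    ∃ᶠ τ in M, 0 < τ ∧ lam * (p * (normLinf Ω β).toReal * volume.real Ω *
      (constL ρ s p Ω).toReal ^ p * (maxPrimitive g τ / τ ^ p)) < 1 := by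
  set K : ℝ≥0∞ := ENNReal.ofReal p * normLinf Ω β * volume Ω * constL ρ s p Ω ^ p with hK
  have hKt : K ≠ ⊤ := ENNReal.mul_ne_top (ENNReal.mul_ne_top (ENNReal.mul_ne_top (by simp) hβ) hΩ)
    (ENNReal.rpow_ne_top_of_nonneg hp.le hL)
  set k := ENNReal.ofReal lam * K with hk
  have hkt : k ≠ ⊤ := ENNReal.mul_ne_top (by simp) hKt
  have h1 : constA g p M * k < 1 := by
    have := ENNReal.mul_lt_of_lt_div hlam2
    refine lt_of_eq_of_lt ?_ this
    rw [hk]; ring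
  have h2 : ∃ᶠ τ in M, ENNReal.ofReal (sSup (primitive g '' Icc (-τ) τ) / τ ^ p) * k < 1 := by
    -- The case k = 0 is separate because A_M may then be infinite, so that A_M < 1 / k could fail.
    rcases eq_or_ne k 0 with h0 | h0
    · simp only [h0, mul_zero, zero_lt_one]
      exact (Eventually.of_forall fun _ => trivial).frequently
    · have h3 : constA g p M < 1 / k := by
        rw [ENNReal.lt_div_iff_mul_lt (Or.inl h0) (Or.inl hkt)]
        exact h1
      exact (frequently_lt_of_liminf_lt (by isBoundedDefault) h3).mono fun τ hτ =>
        ENNReal.mul_lt_of_lt_div hτ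
  refine (h2.and_eventually hM).mono fun τ hτ => ⟨hτ.2, ?_⟩
  have h4 := (ENNReal.toReal_lt_toReal hτ.1.ne_top ENNReal.one_ne_top).mpr hτ.1
  have h5 : 0 ≤ sSup (primitive g '' Icc (-τ) τ) / τ ^ p :=
    div_nonneg (maxPrimitive_nonneg hg hτ.2.le) (Real.rpow_nonneg hτ.2.le _)
  rw [hk, hK, ENNReal.toReal_one] at h4
  simp only [ENNReal.toReal_mul, ← ENNReal.toReal_rpow] at h4
  rw [ENNReal.toReal_ofReal h5, ENNReal.toReal_ofReal hlam, ENNReal.toReal_ofReal hp.le] at h4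
  refine lt_of_eq_of_lt ?_ h4
  rw [maxPrimitive, measureReal_def]
  ring

theorem ae_abs_le_of_memLp_top (hβ : MemLp β ⊤ (volume.restrict Ω)) :
    ∀ᵐ x ∂volume.restrict Ω, |β x| ≤ (normLinf Ω β).toReal := by
  filter_upwards [enorm_ae_le_eLpNormEssSup β (volume.restrict Ω)] with x hx
  rw [← eLpNorm_exponent_top] at hx
  have := ENNReal.toReal_mono hβ.2.ne hx
  rwa [toReal_enorm, Real.norm_eq_abs] at this

theorem MemX0.ae_abs_le (hN : 0 < N) (hs : 0 ≤ s) (hp : 1 ≤ p)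
    (hsp : (𝔾.Q : ℝ) < s * p) (hΩb : Bornology.IsBounded Ω) {u : (Fin N → ℝ) → ℝ}
    (hu : MemX0 ρ s p Ω u) : ∀ᵐ x ∂volume.restrict Ω,
      |u x| ≤ (constL ρ s p Ω).toReal * (gagliardo ρ s p u).toReal := by
  filter_upwards [enorm_ae_le_eLpNormEssSup u (volume.restrict Ω)] with x hx
  rw [← eLpNorm_exponent_top] at hx
  have h1 : ‖u x‖ₑ ≤ constL ρ s p Ω * gagliardo ρ s p u :=
    hx.trans (hu.normLinf_le hN hs hp hsp hΩb)
  have := ENNReal.toReal_mono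
    (ENNReal.mul_ne_top (constL_lt_top ρ hN hs hp hsp hΩb).ne hu.1.2.ne) h1
  simpa using this

end Carnot

end

/-! ### Construction of the sequence of solutions. -/

theorem theorem1p4 {N : ℕ} (hN : 0 < N) (𝔾 : Carnot.StratifiedGroup N)
    (ρ : Carnot.HomogeneousNorm 𝔾) (s p : ℝ) (hs0 : 0 < s) (hs1 : s < 1) (hp : 1 < p)
    (hsp : (𝔾.Q : ℝ) < s * p)
    (Ω : Set (Fin N → ℝ)) (hΩo : IsOpen Ω) (hΩb : Bornology.IsBounded Ω)
    (β : (Fin N → ℝ) → ℝ) (hβ : MemLp β ⊤ (volume.restrict Ω))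
    (hβ0 : 0 < Carnot.betaZero Ω β)
    (g : ℝ → ℝ) (hg : Continuous g)
    (M : Filter ℝ) (hM : M = 𝓝[>] 0 ∨ M = atTop)
    (hG : IsGLB (Carnot.primitive g '' Ici 0) 0)
    (hAB : Carnot.constA g p M < Carnot.constD ρ s p Ω β * Carnot.constB g p M)
    (lam : ℝ)
    (hlam1 : Carnot.lambda1 ρ s p Ω β g M < ENNReal.ofReal lam)
    (hlam2 : ENNReal.ofReal lam < Carnot.lambda2 ρ s p Ω β g M) :
    ∃ u : ℕ → (Fin N → ℝ) → ℝ,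
      (∀ n, Carnot.IsWeakSolution ρ s p Ω β g lam (u n)) ∧
      (M = atTop → Tendsto (fun n => Carnot.gagliardo ρ s p (u n)) atTop (𝓝 ⊤)) ∧
      (M = 𝓝[>] 0 →
        Tendsto (fun n => Carnot.gagliardo ρ s p (u n)) atTop (𝓝 0) ∧
        Tendsto (fun n => Carnot.normLinf Ω (u n)) atTop (𝓝 0)) := by
  open Carnot in
  have hp0 : 0 < p := by linarith
  have hlam0 : 0 < lam := ENNReal.ofReal_pos.mp (lt_of_le_of_lt zero_le hlam1)
  have hMne : M.NeBot := by rcases hM with rfl | rfl <;> infer_instance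
  have hMpos : ∀ᶠ τ in M, 0 < τ := by
    rcases hM with rfl | rfl
    · exact self_mem_nhdsWithin
    · exact eventually_gt_atTop 0
  obtain ⟨x₀, R, B, hR, hsub, hB, hfreqB⟩ :=
    exists_ball_of_lambda1_lt hN hs0 hs1 hp hβ0 hlam0.le hlam1
  have hLt := (constL_lt_top ρ hN hs0.le hp.le hsp hΩb).ne
  have hfreqA := frequently_of_lt_lambda2 hp0 hβ.2.ne hΩb.measure_lt_top.ne hLt hlam0.le hg
    hMpos hlam2
  set b := (normLinf Ω β).toReal
  set l := (constL ρ s p Ω).toReal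
  have hl : 0 < l := ENNReal.toReal_pos (constL_pos hN hs0 hs1 hp hΩo hΩb hR hsub).ne' hLt
  have hb := ae_abs_le_of_memLp_top hβ
  have hβ₀ : ∀ᵐ x ∂volume.restrict Ω, betaZero Ω β ≤ β x := by
    refine ae_essInf_le ⟨-b, ?_⟩
    rw [eventually_map]
    filter_upwards [hb] with x hx
    exact (abs_le.mp hx).1
  have hβI : ∀ᵐ x ∂volume.restrict Ω, β x ∈ Icc 0 b := by
    filter_upwards [hb, hβ₀] with x h1 h2
    exact ⟨hβ0.le.trans h2, (abs_le.mp h1).2⟩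
  have hGnn : ∀ τ, 0 ≤ τ → 0 ≤ primitive g τ := fun τ hτ => hG.1 ⟨τ, hτ, rfl⟩
  have hL : ∀ u, MemX0 ρ s p Ω u →
      ∀ᵐ x ∂volume.restrict Ω, |u x| ≤ l * (gagliardo ρ s p u).toReal := fun u hu =>
    hu.ae_abs_le hN hs0.le hp.le hsp hΩb
  obtain ⟨ε, hε, hcone⟩ := exists_energy_smul_cone_le hN hs0 hs1 hp hΩb hβ.1 hβI hβ₀ hβ0.le
    hlam0.le hg hGnn hR hsub hB
  have hX := cone_memX0 (ρ := ρ) hN hs0 hs1 hp hΩo hΩb hR hsub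
  have hsol := fun τ hτ hmax w hw hwτ hwE => exists_isWeakSolution (ρ := ρ) hN hs0.le hp hsp hΩo
    hΩb hβ.1 hβI hg hlam0.le hl hL (τ := τ) hτ hmax (w := w) hw hwτ hwE
  have hgag : ∀ τ, 0 < τ → gagliardo ρ s p (τ • cone ρ x₀ R) =
      ENNReal.ofReal (τ * (gagliardo ρ s p (cone ρ x₀ R)).toReal) := fun τ hτ => by
    rw [gagliardo_smul hp0, abs_of_pos hτ, ENNReal.ofReal_mul hτ.le,
      ENNReal.ofReal_toReal hX.1.2.ne]
  rcases hM with rfl | rfl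
  · have key : ∀ n : ℕ, ∃ u, IsWeakSolution ρ s p Ω β g lam u ∧
        gagliardo ρ s p u ≤ ENNReal.ofReal (1 / ((n : ℝ) + 1)) := by
      intro n
      -- Taking τ₂ < L / (n + 1) makes the ball radius τ₂ / L smaller than 1 / (n + 1).
      have hn : 0 < l * (1 / ((n : ℝ) + 1)) := by positivity
      obtain ⟨τ₂, ⟨hτ₂, hmax⟩, hτ₂n⟩ := (hfreqA.and_eventually
        (eventually_nhdsWithin_of_eventually_nhds (gt_mem_nhds hn))).exists
      have hsmall : ∀ᶠ τ in 𝓝[>] (0 : ℝ),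
          τ * (gagliardo ρ s p (cone ρ x₀ R)).toReal < τ₂ / l := by
        have hc : Tendsto (fun τ : ℝ => τ * (gagliardo ρ s p (cone ρ x₀ R)).toReal) (𝓝 0)
            (𝓝 (0 * (gagliardo ρ s p (cone ρ x₀ R)).toReal)) := tendsto_id.mul_const _
        rw [zero_mul] at hc
        exact eventually_nhdsWithin_of_eventually_nhds
          (hc.eventually (gt_mem_nhds (by positivity)))
      -- The multiple of the cone is chosen after the ball: a small τ₁ places it inside, and any
      -- negative energy suffices.
      obtain ⟨τ₁, hBτ, hτ₁, hτ₁s⟩ := (hfreqB.and_eventually (hMpos.and hsmall)).exists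
      obtain ⟨u, hu, hug, -⟩ := hsol τ₂ hτ₂ hmax _ (hX.smul hp0 τ₁)
        (by rw [hgag τ₁ hτ₁]; exact ENNReal.ofReal_le_ofReal hτ₁s.le)
        (lt_of_le_of_lt (hcone τ₁ hτ₁ hBτ) (by
          have := mul_pos hε (Real.rpow_pos_of_pos hτ₁ p); linarith))
      refine ⟨u, hu, hug.trans (ENNReal.ofReal_le_ofReal ?_)⟩
      rw [div_le_iff₀ hl, mul_comm]
      exact hτ₂n.le
    choose u hu hug using key
    have hlim : Tendsto (fun n => gagliardo ρ s p (u n)) atTop (𝓝 0) := by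
      have h1 := ENNReal.tendsto_ofReal (tendsto_one_div_add_atTop_nhds_zero_nat (𝕜 := ℝ))
      rw [ENNReal.ofReal_zero] at h1
      exact tendsto_of_tendsto_of_tendsto_of_le_of_le tendsto_const_nhds h1
        (fun _ => zero_le) hug
    refine ⟨u, hu, fun h => ?_, fun _ => ⟨hlim, ?_⟩⟩
    -- The two filters differ: one is eventually below 1, the other eventually above.
    · exfalso
      have h1 : ∀ᶠ τ : ℝ in 𝓝[>] 0, τ < 1 :=
        eventually_nhdsWithin_of_eventually_nhds (gt_mem_nhds one_pos)
      have h2 : ∀ᶠ τ : ℝ in 𝓝[>] 0, 1 ≤ τ := by rw [h]; exact eventually_ge_atTop 1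
      obtain ⟨τ, h3, h4⟩ := (h1.and h2).exists
      linarith
    · have h1 := ENNReal.Tendsto.const_mul hlim (Or.inr hLt)
      rw [mul_zero] at h1
      exact tendsto_of_tendsto_of_tendsto_of_le_of_le tendsto_const_nhds h1
        (fun _ => zero_le) fun n => (hu n).1.normLinf_le hN hs0.le hp.le hsp hΩb
  · have key : ∀ n : ℕ, ∃ u, IsWeakSolution ρ s p Ω β g lam u ∧
        (n : ℝ≥0∞) ≤ gagliardo ρ s p u := by
      intro n
      have hln : 0 ≤ l * n := by positivity
      -- On [u] ≤ n one has |u| ≤ L n, so the energy there is at least −m; an energy below −m forces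
      -- a seminorm larger than n.
      set m := lam * (b * volume.real Ω * maxPrimitive g (l * n))
      have hm : 0 ≤ m := by
        have := maxPrimitive_nonneg hg hln
        have hb0 : 0 ≤ b := ENNReal.toReal_nonneg
        positivity
      have hlarge : ∀ᶠ τ : ℝ in atTop, m < ε * τ ^ p :=
        ((tendsto_rpow_atTop hp0).const_mul_atTop hε).eventually_gt_atTop m
      obtain ⟨τ₁, hBτ, hτ₁, hτ₁l⟩ := (hfreqB.and_eventually (hMpos.and hlarge)).exists
      have hE1 := hcone τ₁ hτ₁ hBτ
      -- Here the ball is chosen after the multiple of the cone, large enough to contain it, so the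
      -- minimizer inherits its energy bound.
      have hτ₂l : ∀ᶠ τ : ℝ in atTop,
          τ₁ * (gagliardo ρ s p (cone ρ x₀ R)).toReal ≤ τ / l :=
        (tendsto_id.atTop_div_const hl).eventually_ge_atTop _
      obtain ⟨τ₂, ⟨hτ₂, hmax⟩, hτ₂n⟩ := (hfreqA.and_eventually hτ₂l).exists
      obtain ⟨u, hu, -, huE⟩ := hsol τ₂ hτ₂ hmax _ (hX.smul hp0 τ₁)
        (by rw [hgag τ₁ hτ₁]; exact ENNReal.ofReal_le_ofReal hτ₂n)
        (lt_of_le_of_lt hE1 (by linarith))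
      refine ⟨u, hu, ?_⟩
      by_contra! hlt
      have hgn : (gagliardo ρ s p u).toReal ≤ n := by
        have := ENNReal.toReal_mono (by simp) hlt.le
        simpa using this
      have hpot := potential_le hΩb hβ.1 hβI hg hu.1.1.1.1.restrict hln (by
        filter_upwards [hL u hu.1] with x hx
        exact hx.trans (mul_le_mul_of_nonneg_left hgn hl.le))
      have h1 := mul_le_mul_of_nonneg_left hpot hlam0.le
      have h2 : 0 ≤ (gagliardo ρ s p u).toReal ^ p / p := by positivity
      unfold energy at huE hE1
      linarith
    choose u hu hug using key
    refine ⟨u, hu, fun _ => ?_, fun h => ?_⟩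
    · exact tendsto_of_tendsto_of_tendsto_of_le_of_le ENNReal.tendsto_nat_nhds_top
        tendsto_const_nhds hug (fun _ => le_top)
    · exfalso
      have h1 : ∀ᶠ τ : ℝ in 𝓝[>] 0, τ < 1 :=
        eventually_nhdsWithin_of_eventually_nhds (gt_mem_nhds one_pos)
      have h2 : ∀ᶠ τ : ℝ in 𝓝[>] 0, 1 ≤ τ := by rw [← h]; exact eventually_ge_atTop 1
      obtain ⟨τ, h3, h4⟩ := (h1.and h2).exists
      linarith
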